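/- **Setting.** Indices $a,b,c,\dots$ take the values $1,2$, repeated indices are summed, round brackets denote symmetrisation ($F_{(ab)}=\frac12(F_{ab}+F_{ba})$) and square brackets antisymmetrisation. Let $U\subset\mathbb R^2$ be open with coordinates $(x^1,x^2)=(x,y)$. Connections are torsion-free connections $\Gamma=(\Gamma^c_{ab})$ on $U$ with continuous fifth derivatives. Two of them are projectively equivalent, $[\hat\Gamma]=[\Gamma]$, if $\hat\Gamma^c_{ab}=\Gamma^c_{ab}+\delta^c_a\omega_b+\delta^c_b\omega_a$ for some one-form $\omega$. A *special pair* $(\Gamma,\epsilon)$ is a connection with a nowhere vanishing bivector $\epsilon^{ab}=-\epsilon^{ba}$ such that $\nabla_a\epsilon^{bc}=0$. **The obstruction $\mathcal D(\Gamma)$.** Let $[\nabla_a,\nabla_b]X^c=R_{abd}{}^cX^d$, and let $\mathrm P_{ab}$ be the Schouten tensor, defined by $R_{abd}{}^c=\delta_a^c\mathrm P_{bd}-\delta_b^c\mathrm P_{ad}+\beta_{ab}\delta^c_d$ with $\beta_{ab}=\mathrm P_{ba}-\mathrm P_{ab}$. For a special pair put $Y_{abc}=\frac12(\nabla_a\mathrm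 P_{bc}-\nabla_b\mathrm P_{ac})$, $Y_c=\epsilon^{ab}\nabla_a\mathrm P_{bc}$, $Z_{ab}=\nabla_{(a}Y_{b)}$ and $$P_a=5Y_a,\quad Q_{ab}=12Z_{ab},\quad R_c=5Y_c,\quad S_{ca}=5\nabla_aY_c+2Z_{ac},\quad U_{cd}=Z_{cd},$$ $$T_{cab}=5\nabla_{(a}\nabla_{b)}Y_c+4\nabla_{(a}Z_{b)c}-5\mathrm P_{ab}Y_c-15\mathrm P_{c(a}Y_{b)},\qquad V_{cda}=\nabla_aZ_{cd}-5\mathrm P_{a(c}Y_{d)},$$ $$X_{cdab}=\nabla_{(a}\nabla_{b)}Z_{cd}-5(\nabla_{(a}\mathrm P_{b)(c})Y_{d)}-5\mathrm P_{c(a}\nabla_{b)}Y_d-5\mathrm P_{d(a}\nabla_{b)}Y_c-\mathrm P_{c(a}Z_{b)d}-\mathrm P_{d(a}Z_{b)c}+10Y_{(a}Y_{b)(cd)} .$$ Then $\mathcal D(\Gamma)$ is the complete contraction $$\epsilon^{ab}\epsilon^{cd}\epsilon^{ef}\epsilon^{gh}\epsilon^{ij}\epsilon^{kl}\epsilon^{mn}\epsilon^{pq}\Big[Q_{gi}S_{mp}T_{njk}U_{ac}V_{deq}X_{bfhl}-\tfrac16P_pR_mS_{nq}X_{acgi}X_{behk}X_{dfjl}-\tfrac12P_pS_{mq}T_{njl}U_{ce}X_{adgk}X_{bfhi}$$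 $$-\tfrac12P_pT_{mgi}T_{njk}U_{ac}V_{deq}X_{bfhl}+\tfrac12P_pR_mT_{ngi}V_{acq}X_{dejk}X_{bfhl}-\tfrac12Q_{gi}R_mS_{np}V_{acq}X_{dejk}X_{bfhl}$$ $$-\tfrac12Q_{gi}R_mT_{njk}V_{acp}V_{deq}X_{bfhl}-\tfrac14Q_{gi}S_{mp}S_{nq}U_{ac}X_{dejk}X_{bfhl}-\tfrac14Q_{gi}T_{mjk}T_{nhl}U_{ac}V_{dep}V_{bfq}\Big].$$ Put $$\bar\Theta=\begin{pmatrix}0&\bar P_a&\bar Q_{ab}\\ \bar R_c&\bar S_{ca}&\bar T_{cab}\\ \bar U_{cd}&\bar V_{cda}&\bar X_{cdab}\end{pmatrix}=\begin{pmatrix}0&12P_a&Q_{ab}\\30R_c&12S_{ca}&T_{cab}-5\mathrm P_{ab}R_c\\30U_{cd}&12V_{cda}&X_{cdab}-5\mathrm P_{ab}U_{cd}\end{pmatrix},$$ a $6\times6$ matrix, the pairs $(ab)$ and $(cd)$ running through $11,12,22$. As a section of the $14$th power of the canonical bundle, $\mathcal D(\Gamma)$ denotes $\mathcal D(\Gamma)\,\kappa^{\otimes14}$,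 where $\kappa=(\epsilon^{12})^{-1}dx\wedge dy$. **The matrix $\mathcal M([\Gamma])$.** Let $A_0=-\Gamma^2_{11}$, $A_1=\Gamma^1_{11}-2\Gamma^2_{12}$, $A_2=2\Gamma^1_{12}-\Gamma^2_{22}$, $A_3=\Gamma^1_{22}$ be the coefficients of the equation $y''=A_3y'^3+A_2y'^2+A_1y'+A_0$ of the unparametrised geodesics. Let $$L_1=\tfrac23\partial_x\partial_yA_1-\tfrac13\partial_x^2A_2-\partial_y^2A_0+A_0\partial_yA_2+A_2\partial_yA_0-A_3\partial_xA_0-2A_0\partial_xA_3-\tfrac23A_1\partial_yA_1+\tfrac13A_1\partial_xA_2,$$ $$L_2=\tfrac23\partial_x\partial_yA_2-\tfrac13\partial_y^2A_1-\partial_x^2A_3-A_3\partial_xA_1-A_1\partial_xA_3+A_0\partial_yA_3+2A_3\partial_yA_0+\tfrac23A_2\partial_xA_2-\tfrac13A_2\partial_yA_1,$$ and let $\mathbf V=(V_1,\dots,V_6)$ with $V_1=2\partial_yL_2+4A_2L_2+8A_3L_1$, $V_2=-2\partial_yL_1-2\partial_xL_2-\frac43A_1L_2+\frac43A_2L_1$,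 $V_3=2\partial_xL_1-8A_0L_2-4A_1L_1$, $V_4=-5L_2$, $V_5=-5L_1$, $V_6=0$. For a row vector $\mathbf W$ put $D_a\mathbf W=\partial_a\mathbf W-\mathbf W\,\Omega_a$, where $$\Omega_1=\begin{pmatrix}-\frac23A_1&2A_0&0&0&0&0\\0&0&0&-\frac12&0&0\\-2A_3&-\frac23A_2&\frac43A_1&0&1&0\\(\Omega_1)_{41}&(\Omega_1)_{42}&(\Omega_1)_{43}&-\frac13A_1&-3A_0&0\\0&0&0&0&0&-1\\(\Omega_1)_{61}&(\Omega_1)_{62}&(\Omega_1)_{63}&(\Omega_1)_{64}&(\Omega_1)_{65}&(\Omega_1)_{66}\end{pmatrix},$$ $$\Omega_2=\begin{pmatrix}-\frac43A_2&\frac23A_1&2A_0&1&0&0\\0&0&0&0&-\frac12&0\\0&-2A_3&\frac23A_2&0&0&0\\0&0&0&0&0&-1\\(\Omega_2)_{51}&(\Omega_2)_{52}&(\Omega_2)_{53}&3A_3&\frac13A_2&0\\(\Omega_2)_{61}&(\Omega_2)_{62}&(\Omega_2)_{63}&(\Omega_2)_{64}&(\Omega_2)_{65}&(\Omega_2)_{66}\end{pmatrix}$$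 and $$\begin{aligned} (\Omega_1)_{41}&=-\frac{4}{3}\partial_xA_2+4A_0A_3+\frac{2}{3}\partial_yA_1,\\ (\Omega_1)_{42}&=-2\partial_yA_0+\frac{2}{3}\partial_xA_1+4A_2A_0-\frac{4}{9}(A_1)^2,\\ (\Omega_1)_{43}&=2\partial_xA_0-4A_0A_1,\\ (\Omega_1)_{61}&= -\frac{4}{3}\partial_x\partial_y A_2-\frac{20}{3}A_0A_2A_3+\frac{2}{3} (\partial_y)^2A_1+4A_3\partial_yA_0-2A_0\partial_y A_3\\ &-\frac{16}{9}A_2\partial_x A_2+\frac{8}{9}A_2\partial_y A_1 ,\\ (\Omega_1)_{62}&= \frac{2}{3}\partial_x\partial_y A_1-\frac{4}{3}A_1\partial_y A_1+2 A_0\partial_y A_2-2 (\partial_y)^2 A_0+4 A_2\partial_y A_0+4 A_3 \partial_x A_0\\ &+6A_0\partial_x A_3+\frac{8}{9}A_1\partial_x A_2 +\frac{4}{3}A_0A_1A_3-\frac{4}{3}A_0(A_2)^2 ,\\ (\Omega_1)_{63}&= 2\partial_x\partial_y A_0+\frac{2}{3}A_0\partial_x A_2-\frac{4}{3}A_2\partial_x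 A_0 -4A_1\partial_y A_0-\frac{4}{3}A_0\partial_y A_1\\&+\frac{8}{3}A_0A_1A_2+4 A_3 (A_0)^2,\\ (\Omega_1)_{64}&=\frac{4}{3}\partial_x A_2-\partial_y A_1+5 A_0A_3,\\ (\Omega_1)_{65}&=\frac{1}{3}\partial_x A_1-4\partial_y A_0 +3A_2A_0-\frac{2}{9}(A_1)^2,\\ (\Omega_1)_{66}&=-\frac{1}{3}A_1, \end{aligned}$$ $$\begin{aligned} (\Omega_2)_{51}&=-2\partial_yA_3-4A_3A_2,\\ (\Omega_2)_{52}&=2\partial_xA_3-\frac{2}{3}\partial_yA_2+4A_1A_3-\frac{4}{9}(A_2)^2,\\ (\Omega_2)_{53}&=\frac{4}{3}\partial_y A_1-\frac{2}{3}\partial_x A_2+4A_0A_3,\\ (\Omega_2)_{61}&=-2\partial_x\partial_y A_3-4A_2\partial_xA_3-\frac{4}{3}A_3\partial_x A_2 +\frac{2}{3}A_3\partial_y A_1-\frac{4}{3}A_1\partial_y A_3\\ &-4A_0(A_3)^2-\frac{8}{3}A_1A_2A_3, \\ (\Omega_2)_{62}&=2(\partial_x)^2A_3-\frac{4}{3}A_2\partial_x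 A_2-\frac{4}{3}A_0A_2A_3 -\frac{2}{3}\partial_x\partial_y A_2\\ &+ 4A_1\partial_x A_3+4 A_0\partial_y A_3+6 A_3\partial_y A_0+\frac{4}{3}A_3(A_1)^2+2A_3\partial_x A_1+ \frac{8}{9}A_2\partial_y A_1,\\ (\Omega_2)_{63}&=-\frac{2}{3}(\partial_x)^2A_2+\frac{8}{9}A_1\partial_x A_2 +4 A_0\partial_x A_3-2 A_3\partial_x A_0-\frac{16}{9}A_1\partial_y A_1\\ &+\frac{4}{3}\partial_x\partial_y A_1+\frac{20}{3}A_0A_1A_3,\\ (\Omega_2)_{64}&= 4\partial_x A_3-\frac{1}{3}\partial_y A_2+3 A_1A_3-\frac{2}{9}(A_2)^2,\\ (\Omega_2)_{65}&= \partial_x A_2-\frac{4}{3}\partial_y A_1+5 A_0A_3, \\ (\Omega_2)_{66}&=\frac{1}{3}A_2. \end{aligned}$$ $\mathcal M([\Gamma])$ is the $6\times 6$ matrix with rows $\mathbf V,\ D_1\mathbf V,\ D_2\mathbf V,\ D_{(1}D_{1)}\mathbf V,\ D_{(1}D_{2)}\mathbf V,\ D_{(2}D_{2)}\mathbf V$.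 **Theorem.** 1. *(Weight $-42$; row and column operations.)* For every special pair, $\mathcal D(\Gamma)=\frac1{4320}(\epsilon^{12})^8\det\bar\Theta$. Let $(\Gamma,\epsilon)$ be a special pair, let $f$ be a $C^6$ function and $\omega_a=\partial_af$, and let $\hat\Gamma^c_{ab}=\Gamma^c_{ab}+\delta_a^c\omega_b+\delta_b^c\omega_a$ and $\hat\epsilon^{ab}=e^{-3f}\epsilon^{ab}$. Then $(\hat\Gamma,\hat\epsilon)$ is a special pair, and $e^{3f}\,\widehat{\bar\Theta}$ is $$\begin{pmatrix}0&\tilde P_a&\tilde Q_{ab}-\tilde P_{(a}\omega_{b)}\\ \tilde R_c&\tilde S_{ca}-2\tilde R_c\omega_a&\tilde T_{cab}-\tilde S_{c(a}\omega_{b)}+\tilde R_c\omega_a\omega_b\\ \tilde U_{cd}&\tilde V_{cda}-2\tilde U_{cd}\omega_a&\tilde X_{cdab}-\tilde V_{cd(a}\omega_{b)}+\tilde U_{cd}\omega_a\omega_b\end{pmatrix},$$ where $$\tilde\Theta=\begin{pmatrix}0&\bar P_a&\bar Q_{ab}\\ \bar R_c&\bar S_{ca}-2\omega_c\bar P_a&\bar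 T_{cab}-2\omega_c\bar Q_{ab}\\ \bar U_{cd}-\omega_{(c}\bar R_{d)}&\bar V_{cda}-\omega_{(c}\bar S_{d)a}+\omega_c\omega_d\bar P_a&\bar X_{cdab}-\omega_{(c}\bar T_{d)ab}+\omega_c\omega_d\bar Q_{ab}\end{pmatrix}.$$ For every covector $\omega$, the passage from $\bar\Theta$ to $\tilde\Theta$ is multiplication on the left by a lower triangular matrix with unit diagonal, and the passage from $\tilde\Theta$ to the first matrix is multiplication on the right by an upper triangular matrix with unit diagonal; both matrices depend only on $\omega$. Moreover $\mathcal D(\hat\Gamma)=e^{-42f}\mathcal D(\Gamma)$, that is, $\mathcal D$ has projective weight $-42$. 2. *(Projective invariance of $\mathcal D([\Gamma])$.)* Every projective class contains a connection which belongs to a special pair. If $(\Gamma,\epsilon)$ and $(\hat\Gamma,\hat\epsilon)$ are special pairs with $\Gamma$ and $\hat\Gamma$ projectively equivalent, then the sections of the $14$th power of the canonical bundle which they define are equal. 3. *(Coordinates.)* If $\varphi:U\to U'$ is a $C^7$ local diffeomorphism between open subsets of $\mathbb R^2$ and the special pair $(\Gamma',\epsilon')$ on $U$ is the pull-back by $\varphi$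 of the special pair $(\Gamma,\epsilon)$ on $U'$, then $\mathcal D(\Gamma')=\mathcal D(\Gamma)\circ\varphi$. 4. *(The section $\det\mathcal M([\Gamma])\,(dx\wedge dy)^{\otimes14}$.)* There is a universal constant $k\ne0$ such that, for every special pair, $\det\mathcal M([\Gamma])\,(dx\wedge dy)^{\otimes14}$ is $k$ times the section defined by $\mathcal D(\Gamma)$. For arbitrary connections, $\det\mathcal M([\Gamma])\,(dx\wedge dy)^{\otimes14}$ depends only on the projective class, and it is a projectively invariant section of the $14$th power of the canonical bundle: if $\varphi:U\to U'$ is a $C^7$ local diffeomorphism and the connection $\Gamma'$ on $U$ is the pull-back of the connection $\Gamma$ on $U'$, then $$\det\mathcal M([\Gamma'])\,(dx\wedge dy)^{\otimes14}=\varphi^*\big(\det\mathcal M([\Gamma])\,(dx\wedge dy)^{\otimes14}\big).$$ -/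

import Mathlib

namespace ProjSurf

/-! ### Calculus on open subsets of the plane -/

/-- Points (and tangent vectors) of the coordinate plane; `p 0 = x`, `p 1 = y`. -/
abbrev Pt : Type := Fin 2 → ℝ

/-- The partial derivative `∂ₐ f` at `p`. -/
noncomputable def pderiv (a : Fin 2) (f : Pt → ℝ) (p : Pt) : ℝ :=
  fderiv ℝ f p (Pi.single a 1)

/-- The Kronecker delta. -/
def kron (a b : Fin 2) : ℝ := if a = b then 1 else 0

/-- Symmetrisation over a pair of indices, `F₍ₐᵦ₎ = (Fₐᵦ + Fᵦₐ) / 2`. -/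
noncomputable def sym (F : Fin 2 → Fin 2 → ℝ) (a b : Fin 2) : ℝ := (F a b + F b a) / 2

/-! ### Torsion-free connections and their projective classes -/

/-- Families of connection symbols; `Γ c a b` is the function `Γ^c_{ab}`. -/
abbrev Symbols : Type := Fin 2 → Fin 2 → Fin 2 → Pt → ℝ

/-- `Γ` is a torsion-free connection on `U` with continuous fifth derivatives. -/
structure IsConnection (U : Set Pt) (Γ : Symbols) : Prop where
  contDiffOn : ∀ c a b, ContDiffOn ℝ 5 (Γ c a b) U
  torsionFree : ∀ c a b, ∀ p ∈ U, Γ c a b p = Γ c b a p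

/-- `Γ'^c_{ab} = Γ^c_{ab} + δ_a^c ω_b + δ_b^c ω_a` on `U`. -/
def IsProjChange (U : Set Pt) (ω : Fin 2 → Pt → ℝ) (Γ Γ' : Symbols) : Prop :=
  ∀ p ∈ U, ∀ a b c, Γ' c a b p = Γ c a b p + kron a c * ω b p + kron b c * ω a p

/-- `Γ` and `Γ'` belong to the same projective class on `U`. -/
def ProjEquiv (U : Set Pt) (Γ Γ' : Symbols) : Prop :=
  ∃ ω : Fin 2 → Pt → ℝ, IsProjChange U ω Γ Γ'

/-- Covariant derivative of a one-form: `cov1 Γ φ a b = ∇ₐ φ_b`. -/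
noncomputable def cov1 (Γ : Symbols) (φ : Fin 2 → Pt → ℝ) (a b : Fin 2) (p : Pt) : ℝ :=
  pderiv a (φ b) p - ∑ e, Γ e a b p * φ e p

/-- Covariant derivative of a covariant two-tensor: `cov2 Γ τ a b c = ∇ₐ τ_{bc}`. -/
noncomputable def cov2 (Γ : Symbols) (τ : Fin 2 → Fin 2 → Pt → ℝ) (a b c : Fin 2) (p : Pt) : ℝ :=
  pderiv a (τ b c) p - ∑ e, Γ e a b p * τ e c p - ∑ e, Γ e a c p * τ b e p

/-- Covariant derivative of a covariant three-tensor: `cov3 Γ τ a b c d = ∇ₐ τ_{bcd}`. -/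
noncomputable def cov3 (Γ : Symbols) (τ : Fin 2 → Fin 2 → Fin 2 → Pt → ℝ)
    (a b c d : Fin 2) (p : Pt) : ℝ :=
  pderiv a (τ b c d) p - ∑ e, Γ e a b p * τ e c d p - ∑ e, Γ e a c p * τ b e d p
    - ∑ e, Γ e a d p * τ b c e p

/-- Covariant derivative of a bivector: `covBivector Γ ε a b c = ∇ₐ ε^{bc}`. -/
noncomputable def covBivector (Γ : Symbols) (ε : Fin 2 → Fin 2 → Pt → ℝ)
    (a b c : Fin 2) (p : Pt) : ℝ :=
  pderiv a (ε b c) p + ∑ e, Γ b a e p * ε e c p + ∑ e, Γ c a e p * ε b e p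

/-- `ε^{bc}` is a (contravariant) volume form on `U` with `∇ₐ ε^{bc} = 0`. -/
structure IsParallelVolume (U : Set Pt) (Γ : Symbols) (ε : Fin 2 → Fin 2 → Pt → ℝ) : Prop where
  contDiffOn : ∀ b c, ContDiffOn ℝ 1 (ε b c) U
  skew : ∀ b c, ∀ p ∈ U, ε b c p = - ε c b p
  ne_zero : ∀ p ∈ U, ε 0 1 p ≠ 0
  parallel : ∀ a b c, ∀ p ∈ U, covBivector Γ ε a b c p = 0

/-! ### Curvature -/

/-- The curvature, `[∇ₐ, ∇_b] X^c = R_{abd}^c X^d`; `curv Γ a b d c` is `R_{abd}^c`. -/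
noncomputable def curv (Γ : Symbols) (a b d c : Fin 2) (p : Pt) : ℝ :=
  pderiv a (Γ c b d) p - pderiv b (Γ c a d) p
    + ∑ e, Γ c a e p * Γ e b d p - ∑ e, Γ c b e p * Γ e a d p

/-- The Ricci tensor `R_{bd} = R_{abd}^a`. -/
noncomputable def ricci (Γ : Symbols) (b d : Fin 2) (p : Pt) : ℝ := ∑ a, curv Γ a b d a p

/-- The Schouten tensor `P_{ab}`. -/
noncomputable def schouten (Γ : Symbols) (b d : Fin 2) (p : Pt) : ℝ :=
  (2 / 3) * ricci Γ b d p + (1 / 3) * ricci Γ d b p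

/-- The Schouten tensor is the tensor `P` in
`R_{abd}^c = δ_a^c P_{bd} - δ_b^c P_{ad} + β_{ab} δ_d^c`, where `β_{ab} = P_{ba} - P_{ab}`. -/
theorem curv_decomposition (Γ : Symbols) (a b d c : Fin 2) (p : Pt) :
    curv Γ a b d c p = kron a c * schouten Γ b d p - kron b c * schouten Γ a d p
      + (schouten Γ b a p - schouten Γ a b p) * kron d c := by
  fin_cases a <;> fin_cases b <;> fin_cases c <;> fin_cases d <;>
    simp [kron, schouten, ricci, curv] <;> ring

/-- The Schouten tensor is determined by that decomposition. -/
theorem schouten_unique (Γ : Symbols) (p : Pt) (P : Fin 2 → Fin 2 → ℝ)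
    (h : ∀ a b d c, curv Γ a b d c p =
      kron a c * P b d - kron b c * P a d + (P b a - P a b) * kron d c) (b d : Fin 2) :
    P b d = schouten Γ b d p := by
  simp only [schouten, ricci, h, Fin.sum_univ_two]
  fin_cases b <;> fin_cases d <;> simp [kron] <;> ring

/-- The Cotton tensor `Y_{abc} = (∇ₐ P_{bc} - ∇_b P_{ac}) / 2`. -/
noncomputable def cotton (Γ : Symbols) (a b c : Fin 2) (p : Pt) : ℝ :=
  (cov2 Γ (schouten Γ) a b c p - cov2 Γ (schouten Γ) b a c p) / 2

/-- `Y_c = ε^{ab} ∇ₐ P_{bc}`. -/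
noncomputable def cottonForm (Γ : Symbols) (ε : Fin 2 → Fin 2 → Pt → ℝ) (c : Fin 2) (p : Pt) : ℝ :=
  ∑ a, ∑ b, ε a b p * cov2 Γ (schouten Γ) a b c p

/-- `Z_{ab} = ∇_{(a} Y_{b)}`. -/
noncomputable def zTensor (Γ : Symbols) (ε : Fin 2 → Fin 2 → Pt → ℝ) (a b : Fin 2) (p : Pt) : ℝ :=
  sym (fun a b => cov1 Γ (cottonForm Γ ε) a b p) a b

/-! ### The obstruction as a complete contraction -/

/-- The tensors `Pₐ, Qₐᵦ, R_c, S_{ca}, T_{cab}, U_{cd}, V_{cda}, X_{cdab}` at a point, which are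
the blocks of a six by six matrix whose remaining corner entry is `0`. -/
@[ext] structure Blocks where
  P : Fin 2 → ℝ
  Q : Fin 2 → Fin 2 → ℝ
  R : Fin 2 → ℝ
  S : Fin 2 → Fin 2 → ℝ
  T : Fin 2 → Fin 2 → Fin 2 → ℝ
  U : Fin 2 → Fin 2 → ℝ
  V : Fin 2 → Fin 2 → Fin 2 → ℝ
  X : Fin 2 → Fin 2 → Fin 2 → Fin 2 → ℝ

namespace Blocks

/-- The six by six matrix with the given blocks; pairs of indices run through `00, 01, 11`. -/
def toMatrix (B : Blocks) : Matrix (Fin 6) (Fin 6) ℝ :=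
  !![0, B.P 0, B.P 1, B.Q 0 0, B.Q 0 1, B.Q 1 1;
     B.R 0, B.S 0 0, B.S 0 1, B.T 0 0 0, B.T 0 0 1, B.T 0 1 1;
     B.R 1, B.S 1 0, B.S 1 1, B.T 1 0 0, B.T 1 0 1, B.T 1 1 1;
     B.U 0 0, B.V 0 0 0, B.V 0 0 1, B.X 0 0 0 0, B.X 0 0 0 1, B.X 0 0 1 1;
     B.U 0 1, B.V 0 1 0, B.V 0 1 1, B.X 0 1 0 0, B.X 0 1 0 1, B.X 0 1 1 1;
     B.U 1 1, B.V 1 1 0, B.V 1 1 1, B.X 1 1 0 0, B.X 1 1 0 1, B.X 1 1 1 1]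

/-- Multiplication of all blocks by a number. -/
def scale (r : ℝ) (B : Blocks) : Blocks where
  P a := r * B.P a
  Q a b := r * B.Q a b
  R c := r * B.R c
  S c a := r * B.S c a
  T c a b := r * B.T c a b
  U c d := r * B.U c d
  V c d a := r * B.V c d a
  X c d a b := r * B.X c d a b

/-- Contraction of two indices with `ε^{ab}`. -/
noncomputable def contr (ε : Fin 2 → Fin 2 → ℝ) (F : Fin 2 → Fin 2 → ℝ) : ℝ :=
  ∑ a, ∑ b, ε a b * F a b

/-- The complete contraction of the blocks with
`ε^{ab} ε^{cd} ε^{ef} ε^{gh} ε^{ij} ε^{kl} ε^{mn} ε^{pq}`. -/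
noncomputable def contraction (ε : Fin 2 → Fin 2 → ℝ) (B : Blocks) : ℝ :=
  contr ε fun a b => contr ε fun c d => contr ε fun e f => contr ε fun g h =>
  contr ε fun i j => contr ε fun k l => contr ε fun m n => contr ε fun p q =>
    B.Q g i * B.S m p * B.T n j k * B.U a c * B.V d e q * B.X b f h l
    - (1 / 6) * (B.P p * B.R m * B.S n q * B.X a c g i * B.X b e h k * B.X d f j l)
    - (1 / 2) * (B.P p * B.S m q * B.T n j l * B.U c e * B.X a d g k * B.X b f h i)
    - (1 / 2) * (B.P p * B.T m g i * B.T n j k * B.U a c * B.V d e q * B.X b f h l)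
    + (1 / 2) * (B.P p * B.R m * B.T n g i * B.V a c q * B.X d e j k * B.X b f h l)
    - (1 / 2) * (B.Q g i * B.R m * B.S n p * B.V a c q * B.X d e j k * B.X b f h l)
    - (1 / 2) * (B.Q g i * B.R m * B.T n j k * B.V a c p * B.V d e q * B.X b f h l)
    - (1 / 4) * (B.Q g i * B.S m p * B.S n q * B.U a c * B.X d e j k * B.X b f h l)
    - (1 / 4) * (B.Q g i * B.T m j k * B.T n h l * B.U a c * B.V d e p * B.V b f q)

/-- The row operations with coefficients given by a covector `ω`. -/
noncomputable def rowOps (ω : Fin 2 → ℝ) (B : Blocks) : Blocks where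
  P := B.P
  Q := B.Q
  R := B.R
  S c a := B.S c a - 2 * ω c * B.P a
  T c a b := B.T c a b - 2 * ω c * B.Q a b
  U c d := B.U c d - sym (fun c d => ω c * B.R d) c d
  V c d a := B.V c d a - sym (fun c d => ω c * B.S d a) c d + ω c * ω d * B.P a
  X c d a b := B.X c d a b - sym (fun c d => ω c * B.T d a b) c d + ω c * ω d * B.Q a b

/-- The column operations with coefficients given by a covector `ω`. -/
noncomputable def colOps (ω : Fin 2 → ℝ) (B : Blocks) : Blocks where
  P := B.P
  Q a b := B.Q a b - sym (fun a b => B.P a * ω b) a b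
  R := B.R
  S c a := B.S c a - 2 * B.R c * ω a
  T c a b := B.T c a b - sym (fun a b => B.S c a * ω b) a b + B.R c * ω a * ω b
  U := B.U
  V c d a := B.V c d a - 2 * B.U c d * ω a
  X c d a b := B.X c d a b - sym (fun a b => B.V c d a * ω b) a b + B.U c d * ω a * ω b

end Blocks

/-- The tensors `P, Q, R, S, T, U, V, X` built from the connection and the volume form. -/
noncomputable def theta (Γ : Symbols) (ε : Fin 2 → Fin 2 → Pt → ℝ) (p : Pt) : Blocks :=
  let P := schouten Γ
  let Y := cottonForm Γ ε
  let Z := zTensor Γ ε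
  { P := fun a => 5 * Y a p
    Q := fun a b => 12 * Z a b p
    R := fun c => 5 * Y c p
    S := fun c a => 5 * cov1 Γ Y a c p + 2 * Z a c p
    T := fun c a b =>
      5 * sym (fun a b => cov2 Γ (cov1 Γ Y) a b c p) a b
      + 4 * sym (fun a b => cov2 Γ Z a b c p) a b
      - 5 * P a b p * Y c p
      - 15 * sym (fun a b => P c a p * Y b p) a b
    U := fun c d => Z c d p
    V := fun c d a => cov2 Γ Z a c d p - 5 * sym (fun c d => P a c p * Y d p) c d
    X := fun c d a b =>
      sym (fun a b => cov3 Γ (cov2 Γ Z) a b c d p) a b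
      - 5 * sym (fun c d => sym (fun a b => cov2 Γ P a b c p) a b * Y d p) c d
      - 5 * sym (fun a b => P c a p * cov1 Γ Y b d p) a b
      - 5 * sym (fun a b => P d a p * cov1 Γ Y b c p) a b
      - sym (fun a b => P c a p * Z b d p) a b
      - sym (fun a b => P d a p * Z b c p) a b
      + 10 * sym (fun a b => Y a p * sym (fun c d => cotton Γ b c d p) c d) a b }

/-- The matrix `Θ̄`, in blocks. -/
noncomputable def thetaBar (Γ : Symbols) (ε : Fin 2 → Fin 2 → Pt → ℝ) (p : Pt) : Blocks :=
  let B := theta Γ ε p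
  { P := fun a => 12 * B.P a
    Q := B.Q
    R := fun c => 30 * B.R c
    S := fun c a => 12 * B.S c a
    T := fun c a b => B.T c a b - 5 * schouten Γ a b p * B.R c
    U := fun c d => 30 * B.U c d
    V := fun c d a => 12 * B.V c d a
    X := fun c d a b => B.X c d a b - 5 * schouten Γ a b p * B.U c d }

/-- The obstruction `D(Γ)`, computed with the volume form `ε^{ab}`. -/
noncomputable def obstruction (Γ : Symbols) (ε : Fin 2 → Fin 2 → Pt → ℝ) (p : Pt) : ℝ :=
  (theta Γ ε p).contraction (fun a b => ε a b p)

/-! ### The matrix `M([Γ])` -/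

/-- The coefficients of the equation `y'' = A₃ y'³ + A₂ y'² + A₁ y' + A₀` of the unparametrised
geodesics. -/
noncomputable def odeCoeff (Γ : Symbols) : Fin 4 → Pt → ℝ :=
  ![fun p => - Γ 1 0 0 p,
    fun p => Γ 0 0 0 p - 2 * Γ 1 0 1 p,
    fun p => 2 * Γ 0 0 1 p - Γ 1 1 1 p,
    fun p => Γ 0 1 1 p]

/-- Liouville's expression `L₁`. -/
noncomputable def liouvilleL1 (A : Fin 4 → Pt → ℝ) (p : Pt) : ℝ :=
  (2 / 3) * pderiv 0 (pderiv 1 (A 1)) p - (1 / 3) * pderiv 0 (pderiv 0 (A 2)) p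
  - pderiv 1 (pderiv 1 (A 0)) p + A 0 p * pderiv 1 (A 2) p + A 2 p * pderiv 1 (A 0) p
  - A 3 p * pderiv 0 (A 0) p - 2 * A 0 p * pderiv 0 (A 3) p
  - (2 / 3) * A 1 p * pderiv 1 (A 1) p + (1 / 3) * A 1 p * pderiv 0 (A 2) p

/-- Liouville's expression `L₂`. -/
noncomputable def liouvilleL2 (A : Fin 4 → Pt → ℝ) (p : Pt) : ℝ :=
  (2 / 3) * pderiv 0 (pderiv 1 (A 2)) p - (1 / 3) * pderiv 1 (pderiv 1 (A 1)) p
  - pderiv 0 (pderiv 0 (A 3)) p - A 3 p * pderiv 0 (A 1) p - A 1 p * pderiv 0 (A 3) p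
  + A 0 p * pderiv 1 (A 3) p + 2 * A 3 p * pderiv 1 (A 0) p
  + (2 / 3) * A 2 p * pderiv 0 (A 2) p - (1 / 3) * A 2 p * pderiv 1 (A 1) p

/-- The vector `V = (V₁, …, V₆)`. -/
noncomputable def vecV (A : Fin 4 → Pt → ℝ) (p : Pt) : Fin 6 → ℝ :=
  let L1 := liouvilleL1 A
  let L2 := liouvilleL2 A
  ![2 * pderiv 1 L2 p + 4 * A 2 p * L2 p + 8 * A 3 p * L1 p,
    -2 * pderiv 1 L1 p - 2 * pderiv 0 L2 p - (4 / 3) * A 1 p * L2 p + (4 / 3) * A 2 p * L1 p,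
    2 * pderiv 0 L1 p - 8 * A 0 p * L2 p - 4 * A 1 p * L1 p,
    -5 * L2 p,
    -5 * L1 p,
    0]

/-- The matrix `Ω₁` of the prolongation connection. -/
noncomputable def omega1 (A : Fin 4 → Pt → ℝ) (p : Pt) : Matrix (Fin 6) (Fin 6) ℝ :=
  let a0 := A 0 p
  let a1 := A 1 p
  let a2 := A 2 p
  let a3 := A 3 p
  let x0 := pderiv 0 (A 0) p
  let x1 := pderiv 0 (A 1) p
  let x2 := pderiv 0 (A 2) p
  let x3 := pderiv 0 (A 3) p
  let y0 := pderiv 1 (A 0) p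
  let y1 := pderiv 1 (A 1) p
  let y2 := pderiv 1 (A 2) p
  let y3 := pderiv 1 (A 3) p
  let o41 := -(4 / 3) * x2 + 4 * a0 * a3 + (2 / 3) * y1
  let o42 := -2 * y0 + (2 / 3) * x1 + 4 * a2 * a0 - (4 / 9) * a1 ^ 2
  let o43 := 2 * x0 - 4 * a0 * a1
  let o61 := -(4 / 3) * pderiv 0 (pderiv 1 (A 2)) p - (20 / 3) * a0 * a2 * a3
    + (2 / 3) * pderiv 1 (pderiv 1 (A 1)) p + 4 * a3 * y0 - 2 * a0 * y3
    - (16 / 9) * a2 * x2 + (8 / 9) * a2 * y1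
  let o62 := (2 / 3) * pderiv 0 (pderiv 1 (A 1)) p - (4 / 3) * a1 * y1 + 2 * a0 * y2
    - 2 * pderiv 1 (pderiv 1 (A 0)) p + 4 * a2 * y0 + 4 * a3 * x0
    + 6 * a0 * x3 + (8 / 9) * a1 * x2 + (4 / 3) * a0 * a1 * a3 - (4 / 3) * a0 * a2 ^ 2
  let o63 := 2 * pderiv 0 (pderiv 1 (A 0)) p + (2 / 3) * a0 * x2 - (4 / 3) * a2 * x0
    - 4 * a1 * y0 - (4 / 3) * a0 * y1 + (8 / 3) * a0 * a1 * a2 + 4 * a3 * a0 ^ 2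
  let o64 := (4 / 3) * x2 - y1 + 5 * a0 * a3
  let o65 := (1 / 3) * x1 - 4 * y0 + 3 * a2 * a0 - (2 / 9) * a1 ^ 2
  let o66 := -(1 / 3) * a1
  !![-(2 / 3) * a1, 2 * a0, 0, 0, 0, 0;
     0, 0, 0, -(1 / 2), 0, 0;
     -2 * a3, -(2 / 3) * a2, (4 / 3) * a1, 0, 1, 0;
     o41, o42, o43, -(1 / 3) * a1, -3 * a0, 0;
     0, 0, 0, 0, 0, -1;
     o61, o62, o63, o64, o65, o66]

/-- The matrix `Ω₂` of the prolongation connection. -/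
noncomputable def omega2 (A : Fin 4 → Pt → ℝ) (p : Pt) : Matrix (Fin 6) (Fin 6) ℝ :=
  let a0 := A 0 p
  let a1 := A 1 p
  let a2 := A 2 p
  let a3 := A 3 p
  let x0 := pderiv 0 (A 0) p
  let x1 := pderiv 0 (A 1) p
  let x2 := pderiv 0 (A 2) p
  let x3 := pderiv 0 (A 3) p
  let y0 := pderiv 1 (A 0) p
  let y1 := pderiv 1 (A 1) p
  let y2 := pderiv 1 (A 2) p
  let y3 := pderiv 1 (A 3) p
  let o51 := -2 * y3 - 4 * a3 * a2
  let o52 := 2 * x3 - (2 / 3) * y2 + 4 * a1 * a3 - (4 / 9) * a2 ^ 2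
  let o53 := (4 / 3) * y1 - (2 / 3) * x2 + 4 * a0 * a3
  let o61 := -2 * pderiv 0 (pderiv 1 (A 3)) p - 4 * a2 * x3 - (4 / 3) * a3 * x2
    + (2 / 3) * a3 * y1 - (4 / 3) * a1 * y3 - 4 * a0 * a3 ^ 2 - (8 / 3) * a1 * a2 * a3
  let o62 := 2 * pderiv 0 (pderiv 0 (A 3)) p - (4 / 3) * a2 * x2 - (4 / 3) * a0 * a2 * a3
    - (2 / 3) * pderiv 0 (pderiv 1 (A 2)) p + 4 * a1 * x3 + 4 * a0 * y3 + 6 * a3 * y0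
    + (4 / 3) * a3 * a1 ^ 2 + 2 * a3 * x1 + (8 / 9) * a2 * y1
  let o63 := -(2 / 3) * pderiv 0 (pderiv 0 (A 2)) p + (8 / 9) * a1 * x2
    + 4 * a0 * x3 - 2 * a3 * x0 - (16 / 9) * a1 * y1
    + (4 / 3) * pderiv 0 (pderiv 1 (A 1)) p + (20 / 3) * a0 * a1 * a3
  let o64 := 4 * x3 - (1 / 3) * y2 + 3 * a1 * a3 - (2 / 9) * a2 ^ 2
  let o65 := x2 - (4 / 3) * y1 + 5 * a0 * a3
  let o66 := (1 / 3) * a2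
  !![-(4 / 3) * a2, (2 / 3) * a1, 2 * a0, 1, 0, 0;
     0, 0, 0, 0, -(1 / 2), 0;
     0, -2 * a3, (2 / 3) * a2, 0, 0, 0;
     0, 0, 0, 0, 0, -1;
     o51, o52, o53, 3 * a3, (1 / 3) * a2, 0;
     o61, o62, o63, o64, o65, o66]

/-- The operator `Dₐ W = ∂ₐ W - W Ωₐ` on row vectors. -/
noncomputable def opD (A : Fin 4 → Pt → ℝ) (a : Fin 2) (W : Pt → Fin 6 → ℝ) (p : Pt) :
    Fin 6 → ℝ :=
  fun j => pderiv a (fun q => W q j) p - Matrix.vecMul (W p) ((![omega1, omega2] a) A p) j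

/-- The matrix `M([Γ])` with rows `V, D₁V, D₂V, D₍₁D₁₎V, D₍₁D₂₎V, D₍₂D₂₎V`. -/
noncomputable def matrixM (Γ : Symbols) (p : Pt) : Matrix (Fin 6) (Fin 6) ℝ :=
  let A := odeCoeff Γ
  let V := vecV A
  let DD : Fin 2 → Fin 2 → Fin 6 → ℝ :=
    fun a b j => sym (fun a b => opD A a (opD A b V) p j) a b
  Matrix.of ![V p, opD A 0 V p, opD A 1 V p, DD 0 0, DD 0 1, DD 1 1]

/-! ### The 14th power of the canonical bundle -/

/-- The fibre `Λ²(T*U)` of the canonical bundle. -/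
abbrev Canonical : Type := Pt [⋀^Fin 2]→ₗ[ℝ] ℝ

/-- The fibre of the 14th tensor power of the canonical bundle. -/
abbrev Canonical14 : Type := PiTensorProduct ℝ (fun _ : Fin 14 => Canonical)

/-- `dx ∧ dy`. -/
def dxdy : Canonical := Matrix.detRowAlternating

/-- `κ^{⊗14}`. -/
noncomputable def power14 (κ : Canonical) : Canonical14 :=
  PiTensorProduct.tprod ℝ (fun _ => κ)

/-- Pull-back of two-forms by a linear map. -/
def pullForm (L : Pt →ₗ[ℝ] Pt) : Canonical →ₗ[ℝ] Canonical where
  toFun κ := κ.compLinearMap L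
  map_add' _ _ := rfl
  map_smul' _ _ := rfl

/-- Pull-back by a linear map on the 14th power of the canonical bundle. -/
noncomputable def pull14 (L : Pt →ₗ[ℝ] Pt) : Canonical14 →ₗ[ℝ] Canonical14 :=
  PiTensorProduct.map (fun _ => pullForm L)

/-- `det M([Γ]) (dx ∧ dy)^{⊗14}`. -/
noncomputable def detMSection (Γ : Symbols) (p : Pt) : Canonical14 :=
  (matrixM Γ p).det • power14 dxdy

/-- `D(Γ)` as a section of the 14th power of the canonical bundle: the number `D(Γ)` computed with
`ε^{ab}` is multiplied by the 14th power of the corresponding area form `(ε^{01})⁻¹ dx ∧ dy`. -/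
noncomputable def obstructionSection (Γ : Symbols) (ε : Fin 2 → Fin 2 → Pt → ℝ) (p : Pt) :
    Canonical14 :=
  obstruction Γ ε p • power14 ((ε 0 1 p)⁻¹ • dxdy)

/-! ### Changes of coordinates -/

/-- The Jacobian matrix, `jac φ p k a = ∂ₐ φ^k`. -/
noncomputable def jac (φ : Pt → Pt) (p : Pt) : Matrix (Fin 2) (Fin 2) ℝ :=
  Matrix.of fun k a => pderiv a (fun q => φ q k) p

/-- `φ` is a local diffeomorphism from `U` to `U'` (of class `C⁷`, so that connections of
class `C⁵` pull back to connections of class `C⁵`). -/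
structure IsCoordChange (U U' : Set Pt) (φ : Pt → Pt) : Prop where
  contDiffOn : ContDiffOn ℝ 7 φ U
  mapsTo : Set.MapsTo φ U U'
  det_ne_zero : ∀ p ∈ U, (jac φ p).det ≠ 0

/-- `Γ'` is the pull-back of the connection `Γ` by `φ` on `U`. -/
def IsPullback (U : Set Pt) (φ : Pt → Pt) (Γ Γ' : Symbols) : Prop :=
  ∀ p ∈ U, ∀ a b k, ∑ c, jac φ p k c * Γ' c a b p =
    pderiv a (fun q => pderiv b (fun r => φ r k) q) p
      + ∑ i, ∑ j, Γ k i j (φ p) * jac φ p i a * jac φ p j b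

/-- `ε'^{ab}` is the pull-back of the bivector `ε^{ij}` by `φ` on `U`. -/
def IsBivectorPullback (U : Set Pt) (φ : Pt → Pt) (ε ε' : Fin 2 → Fin 2 → Pt → ℝ) : Prop :=
  ∀ p ∈ U, ∀ i j, ε i j (φ p) = ∑ a, ∑ b, jac φ p i a * jac φ p j b * ε' a b p

end ProjSurf

open ProjSurf

/-!
The tensors `P, …, X` are the components of one section and of its derivatives. Let row sections
`(r, m_c, s_{cd})` of a bundle of rank six carry the connection `D` of `covRow_tractor`, built from
the Schouten and the Cotton tensor. For `W = (0, 5 Y_c, Z_{cd})` the rows of the transpose of the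
matrix `Θ` are `W`, `Dₐ W` and the symmetrised second derivatives of `W` (`toMatrix_theta`). Since
every contraction with a bivector in dimension two is an antisymmetrisation, the obstruction is
`(ε^{01})^8 det Θ`, a polynomial identity in the entries of `Θ` (`Blocks.contraction_eq`), and
`det Θ̄ = 4320 det Θ` because `Θ̄` arises from `Θ` by column operations.

All transformation laws then come from gauge transformations of row sections, that is, from matrices
`G` with `∂ₐ G = G N'ₐ - Nₐ G`, up to a weight, which carry one connection to another
(`covRow_vecMul`).

* For a change of connection by `df`, `G` is `e^{-3f}` times the matrix of the column operations
  (`pderiv_projGauge`); `W` goes to `W G`, and the weight of `W` produces a unipotent mixing of its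
  derivatives, so that `Θ̄` changes by row and column operations (`thetaBar_projChange`).
* For a change of coordinates, `G` consists of the Jacobian matrix and its symmetric square
  (`pderiv_jacGauge`), of determinant `(det J)^4`. The derivative indices contribute another
  `(det J)^4`, and the eight volume forms cancel both.
* For the trace-free representative of a projective class, with the constant volume form, there is an
  explicit `G` of determinant `-16` which carries `D` to the connection with matrices `Ω₁`, `Ω₂`, and
  `W` to the vector `V` (`pderiv_liouvilleGauge`, `vecV_eq`). Hence `det M([Γ])` is `-16` times the
  obstruction of that representative.

Two parallel volume forms of projectively equivalent connections have a quotient `± e^{-3f}` near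
each point, with the connections differing by `df`; the sign does not matter since the determinant has
even size and fourteen is even. This gives the invariance of the section
(`obstructionSection_congr`). As the matrix `M([Γ])` only sees the projective class, the assertions
on `det M([Γ])` reduce to those on the obstruction of the trace-free representative.
-/

namespace ProjSurf

/-! ### Partial derivatives on open subsets of the plane -/

section Calculus

variable {U : Set Pt} {p : Pt} {f g : Pt → ℝ} {a b : Fin 2}

theorem pderiv_add (hf : DifferentiableAt ℝ f p) (hg : DifferentiableAt ℝ g p) :
    pderiv a (fun q => f q + g q) p = pderiv a f p + pderiv a g p := by
  simp [pderiv, fderiv_fun_add hf hg]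

theorem pderiv_sub (hf : DifferentiableAt ℝ f p) (hg : DifferentiableAt ℝ g p) :
    pderiv a (fun q => f q - g q) p = pderiv a f p - pderiv a g p := by
  simp [pderiv, fderiv_fun_sub hf hg]

theorem pderiv_mul (hf : DifferentiableAt ℝ f p) (hg : DifferentiableAt ℝ g p) :
    pderiv a (fun q => f q * g q) p = pderiv a f p * g p + f p * pderiv a g p := by
  simp [pderiv, fderiv_fun_mul hf hg]; ring

theorem pderiv_neg : pderiv a (fun q => - f q) p = - pderiv a f p := by
  simp [pderiv, fderiv_fun_neg]

theorem pderiv_const (c : ℝ) : pderiv a (fun _ => c) p = 0 := by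
  simp [pderiv]

theorem pderiv_const_mul (c : ℝ) (hf : DifferentiableAt ℝ f p) :
    pderiv a (fun q => c * f q) p = c * pderiv a f p := by
  rw [pderiv_mul (by fun_prop) hf, pderiv_const]; ring

theorem pderiv_div_const (c : ℝ) (hf : DifferentiableAt ℝ f p) :
    pderiv a (fun q => f q / c) p = pderiv a f p / c := by
  simp only [div_eq_mul_inv]
  rw [pderiv_mul hf (by fun_prop), pderiv_const]; ring

theorem pderiv_pow (hf : DifferentiableAt ℝ f p) (n : ℕ) :
    pderiv a (fun q => f q ^ n) p = n * f p ^ (n - 1) * pderiv a f p := by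
  simp [pderiv, fderiv_fun_pow n hf]

theorem pderiv_exp (hf : DifferentiableAt ℝ f p) :
    pderiv a (fun q => Real.exp (f q)) p = Real.exp (f p) * pderiv a f p := by
  simp [pderiv, fderiv_exp hf]

theorem pderiv_congr (hU : IsOpen U) (h : ∀ q ∈ U, f q = g q) (hp : p ∈ U) :
    pderiv a f p = pderiv a g p := by
  have : f =ᶠ[nhds p] g := Filter.eventuallyEq_of_mem (hU.mem_nhds hp) h
  simp [pderiv, this.fderiv_eq]

/-- The chain rule for a map of the plane. -/
theorem pderiv_comp {φ : Pt → Pt} (hf : DifferentiableAt ℝ f (φ p))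
    (hφ : DifferentiableAt ℝ φ p) :
    pderiv a (fun q => f (φ q)) p = ∑ i, jac φ p i a * pderiv i f (φ p) := by
  have h1 : fderiv ℝ (fun q => f (φ q)) p = (fderiv ℝ f (φ p)).comp (fderiv ℝ φ p) :=
    fderiv_comp p hf hφ
  have h2 : fderiv ℝ φ p (Pi.single a 1) = ∑ i, jac φ p i a • (Pi.single i 1 : Pt) := by
    rw [pi_eq_sum_univ' (fderiv ℝ φ p (Pi.single a 1))]
    refine Finset.sum_congr rfl fun i _ => ?_
    congr 1
    · simp only [jac, Matrix.of_apply, pderiv]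
      rw [fderiv_apply hφ]
      rfl
  rw [pderiv, h1, ContinuousLinearMap.comp_apply, h2, map_sum]
  simp [pderiv]

theorem contDiffOn_pderiv {n m : WithTop ℕ∞} (hU : IsOpen U) (hf : ContDiffOn ℝ n f U)
    (h : m + 1 ≤ n) (a : Fin 2) : ContDiffOn ℝ m (pderiv a f) U :=
  (hf.fderiv_of_isOpen hU h).clm_apply contDiffOn_const

theorem differentiableAt_of_contDiffOn {n : WithTop ℕ∞} (hU : IsOpen U)
    (hf : ContDiffOn ℝ n f U) (hn : n ≠ 0) (hp : p ∈ U) : DifferentiableAt ℝ f p :=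
  (hf.contDiffAt (hU.mem_nhds hp)).differentiableAt hn

/-- Symmetry of second derivatives. -/
theorem pderiv_comm {n : WithTop ℕ∞} (hU : IsOpen U) (hf : ContDiffOn ℝ n f U) (hn : 2 ≤ n)
    (hp : p ∈ U) (a b : Fin 2) : pderiv a (pderiv b f) p = pderiv b (pderiv a f) p := by
  have h2 : ContDiffAt ℝ n f p := hf.contDiffAt (hU.mem_nhds hp)
  have hs : IsSymmSndFDerivAt ℝ f p := h2.isSymmSndFDerivAt (by simpa using hn)
  have hd : DifferentiableAt ℝ (fderiv ℝ f) p :=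
    ((h2.fderiv_right (m := 1) (by simpa [one_add_one_eq_two] using hn))).differentiableAt (by simp)
  have key : ∀ c d : Fin 2, pderiv c (pderiv d f) p
      = fderiv ℝ (fderiv ℝ f) p (Pi.single c 1) (Pi.single d 1) := by
    intro c d
    have : pderiv c (pderiv d f) p = fderiv ℝ (fun q => fderiv ℝ f q (Pi.single d 1)) p
      (Pi.single c 1) := rfl
    rw [this, fderiv_clm_apply hd (by fun_prop)]
    simp
  rw [key, key, hs.eq]

end Calculus

/-! ### The complete contraction as a determinant -/

namespace Blocks

theorem contr_of_skew {ε : Fin 2 → Fin 2 → ℝ} (hε : ∀ a b, ε a b = - ε b a)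
    (F : Fin 2 → Fin 2 → ℝ) : contr ε F = ε 0 1 * (F 0 1 - F 1 0) := by
  have h0 : ε 0 0 = 0 := by linarith [hε 0 0]
  have h1 : ε 1 1 = 0 := by linarith [hε 1 1]
  simp only [contr, Fin.sum_univ_two, h0, h1, hε 1 0]
  ring

/-- The symmetries of the blocks of `theta`: `Q`, `T`, `X` are symmetric in the pair `ab` of their
column indices, and `U`, `V`, `X` in the pair `cd` of their row indices. Only such blocks are
recovered from their six by six matrix, which lists each unordered pair once. -/
structure IsSymm (B : Blocks) : Prop where
  Q : ∀ a b, B.Q a b = B.Q b a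
  T : ∀ c a b, B.T c a b = B.T c b a
  U : ∀ c d, B.U c d = B.U d c
  V : ∀ c d a, B.V c d a = B.V d c a
  X_left : ∀ c d a b, B.X c d a b = B.X d c a b
  X_right : ∀ c d a b, B.X c d a b = B.X c d b a

set_option maxHeartbeats 4000000 in
set_option maxRecDepth 100000 in
/-- The complete contraction is the determinant of the matrix of blocks: in dimension two each
contraction with a bivector is an antisymmetrisation times `ε^{01}`, and expanding the eight
antisymmetrisations gives a polynomial identity in the independent components. -/
theorem contraction_eq {ε : Fin 2 → Fin 2 → ℝ} (hε : ∀ a b, ε a b = - ε b a) (B : Blocks)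
    (hB : B.IsSymm) : B.contraction ε = ε 0 1 ^ 8 * B.toMatrix.det := by
  have hd : ε 0 1 ^ 8 * B.toMatrix.det = ε 0 1 * (ε 0 1 * (ε 0 1 * (ε 0 1 * (ε 0 1 * (ε 0 1 *
    (ε 0 1 * (ε 0 1 * B.toMatrix.det))))))) := by ring
  rw [hd]
  simp only [contraction, contr_of_skew hε]
  simp only [← mul_sub]
  congr 8
  -- Rewrite everything in the independent components, then name them to speed up `ring`.
  simp only [hB.Q 1 0, hB.T _ 1 0, hB.U 1 0, hB.V 1 0, hB.X_left 1 0, hB.X_right _ _ 1 0]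
  simp only [toMatrix]
  generalize B.P 0 = P0
  generalize B.P 1 = P1
  generalize B.R 0 = R0
  generalize B.R 1 = R1
  generalize B.Q 0 0 = Q0
  generalize B.Q 0 1 = Q1
  generalize B.Q 1 1 = Q2
  generalize B.S 0 0 = S00
  generalize B.S 0 1 = S01
  generalize B.S 1 0 = S10
  generalize B.S 1 1 = S11
  generalize B.T 0 0 0 = T00
  generalize B.T 0 0 1 = T01
  generalize B.T 0 1 1 = T02
  generalize B.T 1 0 0 = T10
  generalize B.T 1 0 1 = T11
  generalize B.T 1 1 1 = T12
  generalize B.U 0 0 = U0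
  generalize B.U 0 1 = U1
  generalize B.U 1 1 = U2
  generalize B.V 0 0 0 = V00
  generalize B.V 0 0 1 = V01
  generalize B.V 0 1 0 = V10
  generalize B.V 0 1 1 = V11
  generalize B.V 1 1 0 = V20
  generalize B.V 1 1 1 = V21
  generalize B.X 0 0 0 0 = X00
  generalize B.X 0 0 0 1 = X01
  generalize B.X 0 0 1 1 = X02
  generalize B.X 0 1 0 0 = X10
  generalize B.X 0 1 0 1 = X11
  generalize B.X 0 1 1 1 = X12
  generalize B.X 1 1 0 0 = X20
  generalize B.X 1 1 0 1 = X21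
  generalize B.X 1 1 1 1 = X22
  conv_rhs => simp [Matrix.det_succ_row_zero, Fin.sum_univ_succ, Fin.succAbove]
  ring
end Blocks

/-! ### Row and column operations -/

namespace Blocks

/-- Symmetric blocks are determined by their matrix. -/
theorem IsSymm.ext_toMatrix {B C : Blocks} (hB : B.IsSymm) (hC : C.IsSymm)
    (h : B.toMatrix = C.toMatrix) : B = C := by
  have e : ∀ i j, B.toMatrix i j = C.toMatrix i j := fun i j => by rw [h]
  have e' := e
  simp only [Fin.forall_fin_succ, toMatrix, Matrix.of_apply, Matrix.cons_val_zero,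
    Matrix.cons_val_succ, Fin.forall_fin_zero, and_true, Fin.succ_zero_eq_one] at e'
  simp at e'
  obtain ⟨⟨h01, h02, h03, h04, h05⟩, ⟨h10, h11, h12, h13, h14, h15⟩, ⟨h20, h21, h22, h23, h24, h25⟩,
    ⟨h30, h31, h32, h33, h34, h35⟩, ⟨h40, h41, h42, h43, h44, h45⟩,
    ⟨h50, h51, h52, h53, h54, h55⟩⟩ := e'
  ext1
  · ext a; fin_cases a <;> simp [*]
  · ext a b; fin_cases a <;> fin_cases b <;> simp [*, hB.Q 1 0, hC.Q 1 0]
  · ext a; fin_cases a <;> simp [*]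
  · ext a b; fin_cases a <;> fin_cases b <;> simp [*]
  · ext c a b
    fin_cases c <;> fin_cases a <;> fin_cases b <;> simp [*, hB.T _ 1 0, hC.T _ 1 0]
  · ext a b; fin_cases a <;> fin_cases b <;> simp [*, hB.U 1 0, hC.U 1 0]
  · ext c d a
    fin_cases c <;> fin_cases d <;> fin_cases a <;> simp [*, hB.V 1 0, hC.V 1 0]
  · ext c d a b
    fin_cases c <;> fin_cases d <;> fin_cases a <;> fin_cases b <;>
      simp [*, hB.X_left 1 0, hC.X_left 1 0, hB.X_right _ _ 1 0, hC.X_right _ _ 1 0]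

theorem IsSymm.scale {B : Blocks} (hB : B.IsSymm) (r : ℝ) : (B.scale r).IsSymm where
  Q a b := by simp only [Blocks.scale, hB.Q a b]
  T c a b := by simp only [Blocks.scale, hB.T c a b]
  U c d := by simp only [Blocks.scale, hB.U c d]
  V c d a := by simp only [Blocks.scale, hB.V c d a]
  X_left c d a b := by simp only [Blocks.scale, hB.X_left c d a b]
  X_right c d a b := by simp only [Blocks.scale, hB.X_right c d a b]

theorem IsSymm.rowOps {B : Blocks} (hB : B.IsSymm) (ω : Fin 2 → ℝ) : (B.rowOps ω).IsSymm where
  Q a b := hB.Q a b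
  T c a b := by simp only [Blocks.rowOps, hB.T c a b, hB.Q a b]
  U c d := by simp only [Blocks.rowOps, hB.U c d, sym]; ring
  V c d a := by simp only [Blocks.rowOps, hB.V c d a, sym]; ring
  X_left c d a b := by simp only [Blocks.rowOps, hB.X_left c d a b, sym]; ring
  X_right c d a b := by
    simp only [Blocks.rowOps, hB.X_right c d a b, sym, hB.T _ a b, hB.Q a b]

theorem IsSymm.colOps {B : Blocks} (hB : B.IsSymm) (ω : Fin 2 → ℝ) : (B.colOps ω).IsSymm where
  Q a b := by simp only [Blocks.colOps, hB.Q a b, sym]; ring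
  T c a b := by simp only [Blocks.colOps, hB.T c a b, sym]; ring
  U c d := hB.U c d
  V c d a := by simp only [Blocks.colOps, hB.V c d a, hB.U c d]
  X_left c d a b := by
    simp only [Blocks.colOps, hB.X_left c d a b, sym, hB.V c d, hB.U c d]
  X_right c d a b := by simp only [Blocks.colOps, hB.X_right c d a b, sym]; ring

/-- The matrix of the row operations `Blocks.rowOps`. -/
noncomputable def rowMatrix (ω : Fin 2 → ℝ) : Matrix (Fin 6) (Fin 6) ℝ :=
  !![1, 0, 0, 0, 0, 0;
     -2 * ω 0, 1, 0, 0, 0, 0;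
     -2 * ω 1, 0, 1, 0, 0, 0;
     ω 0 ^ 2, -ω 0, 0, 1, 0, 0;
     ω 0 * ω 1, -(ω 1 / 2), -(ω 0 / 2), 0, 1, 0;
     ω 1 ^ 2, 0, -ω 1, 0, 0, 1]

/-- The matrix of the column operations `Blocks.colOps`. -/
noncomputable def colMatrix (ω : Fin 2 → ℝ) : Matrix (Fin 6) (Fin 6) ℝ := (rowMatrix ω).transpose

theorem rowMatrix_diag (ω : Fin 2 → ℝ) (i : Fin 6) : rowMatrix ω i i = 1 := by
  fin_cases i <;> simp [rowMatrix]

theorem rowMatrix_upper (ω : Fin 2 → ℝ) (i j : Fin 6) (h : i < j) : rowMatrix ω i j = 0 := by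
  fin_cases i <;> fin_cases j <;> first | (exfalso; revert h; decide) | simp [rowMatrix]

theorem det_rowMatrix (ω : Fin 2 → ℝ) : (rowMatrix ω).det = 1 := by
  rw [Matrix.det_of_isLowerTriangular _ fun i j h => rowMatrix_upper ω i j h]
  simp [rowMatrix_diag]

theorem det_colMatrix (ω : Fin 2 → ℝ) : (colMatrix ω).det = 1 := by
  rw [colMatrix, Matrix.det_transpose, det_rowMatrix]

theorem toMatrix_rowOps (ω : Fin 2 → ℝ) (B : Blocks) :
    (B.rowOps ω).toMatrix = rowMatrix ω * B.toMatrix := by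
  ext i j
  fin_cases i <;> fin_cases j <;>
    simp [toMatrix, rowMatrix, rowOps, sym, Matrix.mul_apply, Fin.sum_univ_succ] <;> ring

theorem toMatrix_colOps (ω : Fin 2 → ℝ) (B : Blocks) :
    (B.colOps ω).toMatrix = B.toMatrix * colMatrix ω := by
  ext i j
  fin_cases i <;> fin_cases j <;>
    simp [toMatrix, rowMatrix, colMatrix, colOps, sym, Matrix.mul_apply, Fin.sum_univ_succ] <;> ring

theorem toMatrix_scale (r : ℝ) (B : Blocks) : (B.scale r).toMatrix = r • B.toMatrix := by
  ext i j
  fin_cases i <;> fin_cases j <;> simp [toMatrix, scale]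

/-- The passage from the blocks `Θ` to the normalised blocks `Θ̄`; the tensor `P` stands for the
Schouten tensor at a point. -/
noncomputable def bar (P : Fin 2 → Fin 2 → ℝ) (B : Blocks) : Blocks where
  P a := 12 * B.P a
  Q := B.Q
  R c := 30 * B.R c
  S c a := 12 * B.S c a
  T c a b := B.T c a b - 5 * P a b * B.R c
  U c d := 30 * B.U c d
  V c d a := 12 * B.V c d a
  X c d a b := B.X c d a b - 5 * P a b * B.U c d

theorem IsSymm.bar {B : Blocks} (hB : B.IsSymm) {P : Fin 2 → Fin 2 → ℝ}
    (hP : ∀ a b, P a b = P b a) : (B.bar P).IsSymm where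
  Q a b := hB.Q a b
  T c a b := by simp only [Blocks.bar, hB.T c a b, hP a b]
  U c d := by simp only [Blocks.bar, hB.U c d]
  V c d a := by simp only [Blocks.bar, hB.V c d a]
  X_left c d a b := by simp only [Blocks.bar, hB.X_left c d a b, hB.U c d]
  X_right c d a b := by simp only [Blocks.bar, hB.X_right c d a b, hP a b]

/-- The matrix of the column operations `Blocks.bar`. -/
noncomputable def barMatrix (P : Fin 2 → Fin 2 → ℝ) : Matrix (Fin 6) (Fin 6) ℝ :=
  !![30, 0, 0, -5 * P 0 0, -5 * P 0 1, -5 * P 1 1;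
     0, 12, 0, 0, 0, 0;
     0, 0, 12, 0, 0, 0;
     0, 0, 0, 1, 0, 0;
     0, 0, 0, 0, 1, 0;
     0, 0, 0, 0, 0, 1]

theorem toMatrix_bar (P : Fin 2 → Fin 2 → ℝ) (B : Blocks) :
    (B.bar P).toMatrix = B.toMatrix * barMatrix P := by
  ext i j
  fin_cases i <;> fin_cases j <;>
    simp [toMatrix, barMatrix, bar, Matrix.mul_apply, Fin.sum_univ_succ] <;> ring

theorem det_barMatrix (P : Fin 2 → Fin 2 → ℝ) : (barMatrix P).det = 4320 := by
  rw [Matrix.det_of_isUpperTriangular]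
  · simp [barMatrix, Fin.prod_univ_succ]; norm_num
  · intro i j h
    simp only [id] at h
    fin_cases i <;> fin_cases j <;> first | (exfalso; revert h; decide) | simp [barMatrix]

theorem det_bar (P : Fin 2 → Fin 2 → ℝ) (B : Blocks) :
    (B.bar P).toMatrix.det = 4320 * B.toMatrix.det := by
  rw [toMatrix_bar, Matrix.det_mul, det_barMatrix, mul_comm]

end Blocks

/-! ### Regularity of the curvature and of parallel volume forms -/

section Calculus

variable {U : Set Pt} {f : Pt → ℝ}

theorem fderiv_eq_sum_pderiv (f : Pt → ℝ) (p : Pt) :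
    fderiv ℝ f p = ∑ a, pderiv a f p • (ContinuousLinearMap.proj a : Pt →L[ℝ] ℝ) := by
  ext v
  conv_lhs => rw [pi_eq_sum_univ' v, map_sum]
  simp [pderiv, mul_comm]

/-- A differentiable function whose partial derivatives are of class `C^n` is of class `C^(n+1)`. -/
theorem contDiffOn_succ_of_pderiv {n : ℕ} (hU : IsOpen U) (hf : DifferentiableOn ℝ f U)
    (h : ∀ a, ContDiffOn ℝ n (pderiv a f) U) : ContDiffOn ℝ (n + 1) f U := by
  rw [contDiffOn_succ_iff_fderiv_of_isOpen hU]
  refine ⟨hf, by simp, ?_⟩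
  have : fderiv ℝ f = fun p => ∑ a, pderiv a f p • (ContinuousLinearMap.proj a : Pt →L[ℝ] ℝ) :=
    funext fun p => fderiv_eq_sum_pderiv f p
  rw [this]
  exact ContDiffOn.sum fun a _ => (h a).smul contDiffOn_const

end Calculus

section Regularity

variable {U : Set Pt} {Γ : Symbols} {ε : Fin 2 → Fin 2 → Pt → ℝ}

theorem IsConnection.contDiffOn_schouten (hU : IsOpen U) (hΓ : IsConnection U Γ) (b d : Fin 2) :
    ContDiffOn ℝ 4 (schouten Γ b d) U := by
  have h0 : ∀ c a b, ContDiffOn ℝ 4 (Γ c a b) U := fun c a b =>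
    (hΓ.contDiffOn c a b).of_le (by norm_num)
  have h1 : ∀ e c a b, ContDiffOn ℝ 4 (pderiv e (Γ c a b)) U := fun e c a b =>
    contDiffOn_pderiv hU (hΓ.contDiffOn c a b) (by norm_num) e
  unfold schouten ricci curv
  simp only [Fin.sum_univ_two]
  fun_prop

theorem IsConnection.contDiffOn_cotton (hU : IsOpen U) (hΓ : IsConnection U Γ) (a b c : Fin 2) :
    ContDiffOn ℝ 3 (cotton Γ a b c) U := by
  have h0 : ∀ c a b, ContDiffOn ℝ 3 (Γ c a b) U := fun c a b =>
    (hΓ.contDiffOn c a b).of_le (by norm_num)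
  have h1 : ∀ a b, ContDiffOn ℝ 3 (schouten Γ a b) U := fun a b =>
    (hΓ.contDiffOn_schouten hU a b).of_le (by norm_num)
  have h2 : ∀ e a b, ContDiffOn ℝ 3 (pderiv e (schouten Γ a b)) U := fun e a b =>
    contDiffOn_pderiv hU (hΓ.contDiffOn_schouten hU a b) (by norm_num) e
  unfold cotton cov2
  simp only [Fin.sum_univ_two]
  fun_prop

theorem IsParallelVolume.pderiv_eq (hε : IsParallelVolume U Γ ε) {p : Pt} (hp : p ∈ U)
    (a b c : Fin 2) : pderiv a (ε b c) p
      = - (∑ e, Γ b a e p * ε e c p) - ∑ e, Γ c a e p * ε b e p := by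
  have := hε.parallel a b c p hp
  simp only [covBivector] at this
  linarith

/-- A parallel volume form is one degree smoother than the connection: the equation
`∇ₐ ε^{bc} = 0` expresses its derivatives through itself and the connection. -/
theorem IsParallelVolume.contDiffOn_six (hU : IsOpen U) (hΓ : IsConnection U Γ)
    (hε : IsParallelVolume U Γ ε) (b c : Fin 2) : ContDiffOn ℝ 6 (ε b c) U := by
  have key : ∀ n : ℕ, n ≤ 5 → ∀ b c, ContDiffOn ℝ (n + 1) (ε b c) U := by
    intro n
    induction n with
    | zero => intro _ b c; simpa using hε.contDiffOn b c
    | succ n ih =>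
      intro hn b c
      have ih' : ∀ b c, ContDiffOn ℝ ((n + 1 : ℕ) : WithTop ℕ∞) (ε b c) U := by
        intro b c; exact_mod_cast ih (by omega) b c
      refine contDiffOn_succ_of_pderiv hU ((hε.contDiffOn b c).differentiableOn (by simp)) fun a => ?_
      have h0 : ∀ c a b, ContDiffOn ℝ ((n + 1 : ℕ) : WithTop ℕ∞) (Γ c a b) U := fun c a b =>
        (hΓ.contDiffOn c a b).of_le (by exact_mod_cast hn)
      refine ContDiffOn.congr (f := fun p => - (∑ e, Γ b a e p * ε e c p)
        - ∑ e, Γ c a e p * ε b e p) ?_ fun p hp => hε.pderiv_eq hp a b c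
      simp only [Fin.sum_univ_two]
      fun_prop
  have := key 5 le_rfl b c
  norm_num at this
  exact this

theorem IsParallelVolume.contDiffOn_cottonForm (hU : IsOpen U) (hΓ : IsConnection U Γ)
    (hε : IsParallelVolume U Γ ε) (c : Fin 2) : ContDiffOn ℝ 3 (cottonForm Γ ε c) U := by
  have h0 : ∀ c a b, ContDiffOn ℝ 3 (Γ c a b) U := fun c a b =>
    (hΓ.contDiffOn c a b).of_le (by norm_num)
  have h1 : ∀ a b, ContDiffOn ℝ 3 (schouten Γ a b) U := fun a b =>
    (hΓ.contDiffOn_schouten hU a b).of_le (by norm_num)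
  have h2 : ∀ e a b, ContDiffOn ℝ 3 (pderiv e (schouten Γ a b)) U := fun e a b =>
    contDiffOn_pderiv hU (hΓ.contDiffOn_schouten hU a b) (by norm_num) e
  have h3 : ∀ a b, ContDiffOn ℝ 3 (ε a b) U := fun a b =>
    (hε.contDiffOn_six hU hΓ a b).of_le (by norm_num)
  unfold cottonForm cov2
  simp only [Fin.sum_univ_two]
  fun_prop

theorem IsParallelVolume.contDiffOn_zTensor (hU : IsOpen U) (hΓ : IsConnection U Γ)
    (hε : IsParallelVolume U Γ ε) (a b : Fin 2) : ContDiffOn ℝ 2 (zTensor Γ ε a b) U := by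
  have h0 : ∀ c a b, ContDiffOn ℝ 2 (Γ c a b) U := fun c a b =>
    (hΓ.contDiffOn c a b).of_le (by norm_num)
  have h1 : ∀ a, ContDiffOn ℝ 2 (cottonForm Γ ε a) U := fun a =>
    (hε.contDiffOn_cottonForm hU hΓ a).of_le (by norm_num)
  have h2 : ∀ e a, ContDiffOn ℝ 2 (pderiv e (cottonForm Γ ε a)) U := fun e a =>
    contDiffOn_pderiv hU (hε.contDiffOn_cottonForm hU hΓ a) (by norm_num) e
  unfold zTensor sym cov1
  simp only [Fin.sum_univ_two]
  fun_prop

theorem zTensor_comm (Γ : Symbols) (ε : Fin 2 → Fin 2 → Pt → ℝ) (a b : Fin 2) :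
    zTensor Γ ε a b = zTensor Γ ε b a := by
  funext p; simp only [zTensor, sym]; ring

theorem IsParallelVolume.diag_eq_zero (hε : IsParallelVolume U Γ ε) {p : Pt} (hp : p ∈ U)
    (a : Fin 2) : ε a a p = 0 := by linarith [hε.skew a a p hp]

/-- The logarithmic derivative of a parallel volume form is minus the trace of the connection. -/
theorem IsParallelVolume.pderiv_eq_trace (hε : IsParallelVolume U Γ ε) {p : Pt} (hp : p ∈ U)
    (a : Fin 2) : pderiv a (ε 0 1) p = - (Γ 0 a 0 p + Γ 1 a 1 p) * ε 0 1 p := by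
  rw [hε.pderiv_eq hp]
  simp only [Fin.sum_univ_two, hε.diag_eq_zero hp]
  ring

/-- The Schouten tensor is symmetric if there is a parallel volume form: the trace of the
connection is then a closed one-form, minus the logarithmic derivative of the volume form. -/
theorem IsParallelVolume.schouten_comm (hU : IsOpen U) (hΓ : IsConnection U Γ)
    (hε : IsParallelVolume U Γ ε) {p : Pt} (hp : p ∈ U) (a b : Fin 2) :
    schouten Γ a b p = schouten Γ b a p := by
  have dΓ : ∀ c a b, DifferentiableAt ℝ (Γ c a b) p := fun c a b =>
    differentiableAt_of_contDiffOn hU (hΓ.contDiffOn c a b) (by norm_num) hp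
  have dε : DifferentiableAt ℝ (ε 0 1) p :=
    differentiableAt_of_contDiffOn hU (hε.contDiffOn_six hU hΓ 0 1) (by norm_num) hp
  have h2 : ∀ a b, pderiv a (pderiv b (ε 0 1)) p
      = (-(pderiv a (Γ 0 b 0) p + pderiv a (Γ 1 b 1) p)
        + (Γ 0 a 0 p + Γ 1 a 1 p) * (Γ 0 b 0 p + Γ 1 b 1 p)) * ε 0 1 p := by
    intro a b
    rw [pderiv_congr hU (fun q hq => hε.pderiv_eq_trace hq b) hp]
    simp (disch := fun_prop) only [pderiv_mul, pderiv_neg, pderiv_add, hε.pderiv_eq_trace hp]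
    ring
  have hc := pderiv_comm hU (hε.contDiffOn_six hU hΓ 0 1) (by norm_num) hp 0 1
  rw [h2, h2] at hc
  have hc' := mul_right_cancel₀ (hε.ne_zero p hp) hc
  have t : ∀ c a : Fin 2, pderiv c (Γ a 1 0) p = pderiv c (Γ a 0 1) p := fun c a =>
    pderiv_congr hU (fun q hq => hΓ.torsionFree a 1 0 q hq) hp
  have h01 : schouten Γ 0 1 p = schouten Γ 1 0 p := by
    simp only [schouten, ricci, curv, Fin.sum_univ_two, hΓ.torsionFree _ 1 0 p hp, t] at hc' ⊢
    linarith
  fin_cases a <;> fin_cases b <;> first | rfl | exact h01 | exact h01.symm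

/-- `Y_c` is the contraction of the Cotton tensor with the volume form. -/
theorem IsParallelVolume.cottonForm_eq (hε : IsParallelVolume U Γ ε) {p : Pt} (hp : p ∈ U)
    (c : Fin 2) : cottonForm Γ ε c p = 2 * ε 0 1 p * cotton Γ 0 1 c p := by
  simp only [cottonForm, cotton, Fin.sum_univ_two, hε.diag_eq_zero hp, hε.skew 1 0 p hp]
  ring

end Regularity

/-! ### The tractor connection and the columns of the matrix -/

/-- The derivative `Dₐ W = ∂ₐ W - W Nₐ` of a row section `W`, for the connection with matrices
`Nₐ`. -/
noncomputable def covRow (N : Fin 2 → Pt → Matrix (Fin 6) (Fin 6) ℝ) (a : Fin 2)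
    (W : Pt → Fin 6 → ℝ) (p : Pt) : Fin 6 → ℝ :=
  fun j => pderiv a (fun q => W q j) p - Matrix.vecMul (W p) (N a p) j

/-- The row vector with components `(r, m_c, s_{cd})`, where the symmetric pair `cd` runs through
`00, 01, 11`. -/
def rowOf (r : ℝ) (m : Fin 2 → ℝ) (s : Fin 2 → Fin 2 → ℝ) : Fin 6 → ℝ :=
  ![r, m 0, m 1, s 0 0, s 0 1, s 1 1]

theorem rowOf_sub_smul {r r' r₀ r₁ x y : ℝ} {m m' m₀ m₁ : Fin 2 → ℝ}
    {s s' s₀ s₁ : Fin 2 → Fin 2 → ℝ} (hr : r - (x * r₀ + y * r₁) = r')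
    (hm : ∀ c, m c - (x * m₀ c + y * m₁ c) = m' c)
    (hs : ∀ c d, s c d - (x * s₀ c d + y * s₁ c d) = s' c d) :
    rowOf r m s - (x • rowOf r₀ m₀ s₀ + y • rowOf r₁ m₁ s₁) = rowOf r' m' s' := by
  ext j
  fin_cases j <;> simp [rowOf, hr, hm, hs]

/-- The matrices of the connection attached to `Γ` on row sections `(r, m_c, s_{cd})`; written in
components, this connection is the formula of `covRow_tractor`. The weight of the sections is not
part of it, so that a change of `Γ` in its projective class adds a multiple of the identity to the
gauge transformed matrices. -/
noncomputable def tractorMatrix (Γ : Symbols) (a : Fin 2) (p : Pt) : Matrix (Fin 6) (Fin 6) ℝ :=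
  let P := fun b => schouten Γ a b p
  let C := fun c d => sym (fun c d => cotton Γ a c d p) c d
  !![0, 2 * P 0, 2 * P 1, -2 * C 0 0, -2 * C 0 1, -2 * C 1 1;
     -kron a 0, Γ 0 a 0 p, Γ 0 a 1 p, P 0, P 1 / 2, 0;
     -kron a 1, Γ 1 a 0 p, Γ 1 a 1 p, 0, P 0 / 2, P 1;
     0, -2 * kron a 0, 0, 2 * Γ 0 a 0 p, Γ 0 a 1 p, 0;
     0, -2 * kron a 1, -2 * kron a 0, 2 * Γ 1 a 0 p, Γ 0 a 0 p + Γ 1 a 1 p, 2 * Γ 0 a 1 p;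
     0, 0, -2 * kron a 1, 0, Γ 1 a 0 p, 2 * Γ 1 a 1 p]

/-- The tractor derivative in tensor notation. The matrices act on the component `s_{01}` alone, which
is why the symmetry of `s` is needed at the point, but not near it. -/
theorem covRow_tractor {U : Set Pt} (hU : IsOpen U) (Γ : Symbols) {W : Pt → Fin 6 → ℝ}
    {r : Pt → ℝ} {m : Fin 2 → Pt → ℝ} {s : Fin 2 → Fin 2 → Pt → ℝ}
    (hW : ∀ q ∈ U, W q = rowOf (r q) (fun c => m c q) (fun c d => s c d q))
    {p : Pt} (hp : p ∈ U) (hs : s 0 1 p = s 1 0 p) (a : Fin 2) :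
    covRow (tractorMatrix Γ) a W p =
      rowOf (pderiv a r p + m a p)
        (fun c => cov1 Γ m a c p + 2 * s a c p - 2 * schouten Γ a c p * r p)
        (fun c d => cov2 Γ s a c d p - sym (fun c d => schouten Γ a c p * m d p) c d
          + 2 * r p * sym (fun c d => cotton Γ a c d p) c d) := by
  have h : ∀ j, pderiv a (fun q => W q j) p
      = pderiv a (fun q => rowOf (r q) (fun c => m c q) (fun c d => s c d q) j) p :=
    fun j => pderiv_congr hU (fun q hq => by rw [hW q hq]) hp
  funext j
  simp only [covRow, h, hW p hp]
  fin_cases j <;> fin_cases a <;>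
    simp [rowOf, tractorMatrix, Matrix.vecMul, dotProduct, Fin.sum_univ_succ, kron, cov1, cov2,
      sym, hs] <;> ring

/-- The section `(0, 5 Y_c, Z_{cd})`, which is the first column of `Θ`. -/
noncomputable def row0 (Γ : Symbols) (ε : Fin 2 → Fin 2 → Pt → ℝ) (p : Pt) : Fin 6 → ℝ :=
  rowOf 0 (fun c => 5 * cottonForm Γ ε c p) (fun c d => zTensor Γ ε c d p)

/-- The derivative `Dₐ` of the section `row0`. -/
noncomputable def row1 (Γ : Symbols) (ε : Fin 2 → Fin 2 → Pt → ℝ) (a : Fin 2) : Pt → Fin 6 → ℝ :=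
  covRow (tractorMatrix Γ) a (row0 Γ ε)

/-- The second covariant derivative `Dₐ D_b` of the section `row0`, where `Γ` acts on the index
`b`. -/
noncomputable def row2 (Γ : Symbols) (ε : Fin 2 → Fin 2 → Pt → ℝ) (a b : Fin 2) (p : Pt) :
    Fin 6 → ℝ :=
  covRow (tractorMatrix Γ) a (row1 Γ ε b) p - ∑ e, Γ e a b p • row1 Γ ε e p

section

variable {U : Set Pt} {Γ : Symbols} {ε : Fin 2 → Fin 2 → Pt → ℝ}

/-- The components of `row1 Γ ε a` are `Pₐ`, `S_{ca}` and `V_{cda}`. -/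
theorem row1_eq (hU : IsOpen U) (hΓ : IsConnection U Γ)
    (hε : IsParallelVolume U Γ ε) {p : Pt} (hp : p ∈ U) (a : Fin 2) :
    row1 Γ ε a p = rowOf (5 * cottonForm Γ ε a p)
      (fun c => 5 * cov1 Γ (cottonForm Γ ε) a c p + 2 * zTensor Γ ε a c p)
      (fun c d => cov2 Γ (zTensor Γ ε) a c d p
        - 5 * sym (fun c d => schouten Γ a c p * cottonForm Γ ε d p) c d) := by
  have hY : ∀ a, DifferentiableAt ℝ (cottonForm Γ ε a) p := fun a =>
    differentiableAt_of_contDiffOn hU (hε.contDiffOn_cottonForm hU hΓ a) (by norm_num) hp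
  rw [row1, covRow_tractor hU Γ (r := fun _ => 0) (m := fun c q => 5 * cottonForm Γ ε c q)
    (s := zTensor Γ ε) (W := row0 Γ ε) (fun q _ => rfl) hp (by rw [zTensor_comm])]
  congr 1
  · simp [pderiv_const]
  · funext c
    simp (disch := fun_prop) only [cov1, pderiv_const_mul, Fin.sum_univ_two]
    ring
  · funext c d
    simp only [sym]
    ring

/-- The components of the second derivative before symmetrisation in `ab`. The first one uses
`5 ∇ₐ Y_b + 5 ∇_b Y_a + 2 Z_{ab} = 12 Z_{ab}`. -/
theorem row2_eq (hU : IsOpen U) (hΓ : IsConnection U Γ)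
    (hε : IsParallelVolume U Γ ε) {p : Pt} (hp : p ∈ U) (a b : Fin 2) :
    row2 Γ ε a b p = rowOf
      (12 * zTensor Γ ε a b p)
      (fun c => 5 * cov2 Γ (cov1 Γ (cottonForm Γ ε)) a b c p + 2 * cov2 Γ (zTensor Γ ε) a b c p
        + 2 * cov2 Γ (zTensor Γ ε) b a c p
        - 10 * sym (fun a c => schouten Γ b a p * cottonForm Γ ε c p) a c
        - 10 * schouten Γ a c p * cottonForm Γ ε b p)
      (fun c d => cov3 Γ (cov2 Γ (zTensor Γ ε)) a b c d p
        - 5 * sym (fun c d => cov2 Γ (schouten Γ) a b c p * cottonForm Γ ε d p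
          + schouten Γ b c p * cov1 Γ (cottonForm Γ ε) a d p) c d
        - sym (fun c d => schouten Γ a c p
          * (5 * cov1 Γ (cottonForm Γ ε) b d p + 2 * zTensor Γ ε b d p)) c d
        + 10 * cottonForm Γ ε b p * sym (fun c d => cotton Γ a c d p) c d) := by
  have hY : ∀ a, DifferentiableAt ℝ (cottonForm Γ ε a) p := fun a =>
    differentiableAt_of_contDiffOn hU (hε.contDiffOn_cottonForm hU hΓ a) (by norm_num) hp
  have hY' : ∀ a b, DifferentiableAt ℝ (pderiv b (cottonForm Γ ε a)) p := fun a b =>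
    differentiableAt_of_contDiffOn hU (n := 2) (contDiffOn_pderiv hU
      (hε.contDiffOn_cottonForm hU hΓ a) (by norm_num) b) (by norm_num) hp
  have hZ : ∀ a b, DifferentiableAt ℝ (zTensor Γ ε a b) p := fun a b =>
    differentiableAt_of_contDiffOn hU (hε.contDiffOn_zTensor hU hΓ a b) (by norm_num) hp
  have hZ' : ∀ c a b, DifferentiableAt ℝ (pderiv c (zTensor Γ ε a b)) p := fun c a b =>
    differentiableAt_of_contDiffOn hU (n := 1) (contDiffOn_pderiv hU
      (hε.contDiffOn_zTensor hU hΓ a b) (by norm_num) c) (by norm_num) hp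
  have hG : ∀ c a b, DifferentiableAt ℝ (Γ c a b) p := fun c a b =>
    differentiableAt_of_contDiffOn hU (hΓ.contDiffOn c a b) (by norm_num) hp
  have hP : ∀ a b, DifferentiableAt ℝ (schouten Γ a b) p := fun a b =>
    differentiableAt_of_contDiffOn hU (hΓ.contDiffOn_schouten hU a b) (by norm_num) hp
  have hN : ∀ a b, DifferentiableAt ℝ (cov1 Γ (cottonForm Γ ε) a b) p := fun a b => by
    unfold cov1; simp only [Fin.sum_univ_two]; fun_prop
  have hN2 : ∀ a b c, DifferentiableAt ℝ (cov2 Γ (zTensor Γ ε) a b c) p := fun a b c => by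
    unfold cov2; simp only [Fin.sum_univ_two]; fun_prop
  rw [row2, covRow_tractor hU Γ (a := a) (W := row1 Γ ε b) (fun q hq => row1_eq hU hΓ hε hq b) hp
      (by simp only [sym, cov2, zTensor_comm Γ ε 1 0, Fin.sum_univ_two]; ring)]
  rw [Fin.sum_univ_two, row1_eq hU hΓ hε hp, row1_eq hU hΓ hε hp]
  refine rowOf_sub_smul ?_ (fun c => ?_) (fun c d => ?_)
  · have h : zTensor Γ ε a b p = (cov1 Γ (cottonForm Γ ε) a b p
      + cov1 Γ (cottonForm Γ ε) b a p) / 2 := rfl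
    have h' : cov1 Γ (cottonForm Γ ε) a b p = pderiv a (cottonForm Γ ε b) p
      - ∑ k, Γ k a b p * cottonForm Γ ε k p := rfl
    rw [pderiv_const_mul _ (hY b), zTensor_comm Γ ε b a, h, h', Fin.sum_univ_two]
    ring
  · have h : cov2 Γ (cov1 Γ (cottonForm Γ ε)) a b c p = _ := rfl
    conv_rhs at h => rw [cov2]
    have h' : cov2 Γ (zTensor Γ ε) a b c p = _ := rfl
    conv_rhs at h' => rw [cov2]
    rw [h, h']
    conv_lhs => rw [cov1]
    simp (disch := fun_prop) only [pderiv_const_mul, pderiv_add, Fin.sum_univ_two, sym]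
    ring
  · have h : cov3 Γ (cov2 Γ (zTensor Γ ε)) a b c d p = _ := rfl
    conv_rhs at h => rw [cov3]
    have h' : ∀ e f, cov2 Γ (schouten Γ) a e f p = pderiv a (schouten Γ e f) p
      - ∑ k, Γ k a e p * schouten Γ k f p - ∑ k, Γ k a f p * schouten Γ e k p := fun _ _ => rfl
    have h'' : ∀ e, cov1 Γ (cottonForm Γ ε) a e p = pderiv a (cottonForm Γ ε e) p
      - ∑ k, Γ k a e p * cottonForm Γ ε k p := fun _ => rfl
    rw [h, cov2]
    simp (disch := fun_prop) only [h', h'', pderiv_const_mul, pderiv_add, pderiv_sub,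
      pderiv_mul, pderiv_div_const, Fin.sum_univ_two, sym]
    ring

/-- The symmetrised second derivatives of `row0` are the columns of `Θ` with index pair `ab`; here
the symmetry of the Schouten tensor enters. -/
theorem sym_row2_eq (hU : IsOpen U) (hΓ : IsConnection U Γ)
    (hε : IsParallelVolume U Γ ε) {p : Pt} (hp : p ∈ U) (a b : Fin 2) :
    (fun j => sym (fun a b => row2 Γ ε a b p j) a b) = rowOf ((theta Γ ε p).Q a b)
      (fun c => (theta Γ ε p).T c a b) (fun c d => (theta Γ ε p).X c d a b) := by
  have hP : schouten Γ 1 0 p = schouten Γ 0 1 p := hε.schouten_comm hU hΓ hp 1 0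
  have hZ : zTensor Γ ε 1 0 p = zTensor Γ ε 0 1 p := by rw [zTensor_comm]
  funext j
  simp only [row2_eq hU hΓ hε hp, theta]
  fin_cases j <;> fin_cases a <;> fin_cases b <;>
    simp [rowOf, sym, hP, hZ] <;> try ring

end

/-- The transpose of `Θ` consists of a row section, its derivatives and its symmetrised second
derivatives, exactly as the matrix `M([Γ])` does. -/
theorem toMatrix_theta {U : Set Pt} {Γ : Symbols} {ε : Fin 2 → Fin 2 → Pt → ℝ} (hU : IsOpen U)
    (hΓ : IsConnection U Γ) (hε : IsParallelVolume U Γ ε) {p : Pt} (hp : p ∈ U) :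
    (theta Γ ε p).toMatrix.transpose = Matrix.of ![row0 Γ ε p, row1 Γ ε 0 p, row1 Γ ε 1 p,
      fun j => sym (fun a b => row2 Γ ε a b p j) 0 0, fun j => sym (fun a b => row2 Γ ε a b p j) 0 1,
      fun j => sym (fun a b => row2 Γ ε a b p j) 1 1] := by
  rw [sym_row2_eq hU hΓ hε hp, sym_row2_eq hU hΓ hε hp, sym_row2_eq hU hΓ hε hp,
    row1_eq hU hΓ hε hp, row1_eq hU hΓ hε hp]
  ext i j
  fin_cases i <;> fin_cases j <;> simp [Blocks.toMatrix, rowOf, row0, theta]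

theorem isSymm_theta {U : Set Pt} {Γ : Symbols} {ε : Fin 2 → Fin 2 → Pt → ℝ} (hU : IsOpen U)
    (hΓ : IsConnection U Γ) (hε : IsParallelVolume U Γ ε) {p : Pt} (hp : p ∈ U) :
    (theta Γ ε p).IsSymm where
  Q a b := by simp only [theta]; rw [zTensor_comm]
  T c a b := by
    simp only [theta, sym, hε.schouten_comm hU hΓ hp a b]; ring
  U c d := by simp only [theta]; rw [zTensor_comm]
  V c d a := by
    simp only [theta, sym, cov2, zTensor_comm Γ ε c, zTensor_comm Γ ε _ d, Fin.sum_univ_two]; ring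
  X_left c d a b := by
    have h1 : ∀ a c d : Fin 2, cov2 Γ (zTensor Γ ε) a c d = cov2 Γ (zTensor Γ ε) a d c :=
      fun a c d => by
        funext q
        simp only [cov2, zTensor_comm Γ ε c, zTensor_comm Γ ε _ d, Fin.sum_univ_two]; ring
    have h2 : ∀ a b : Fin 2, cov3 Γ (cov2 Γ (zTensor Γ ε)) a b c d p
        = cov3 Γ (cov2 Γ (zTensor Γ ε)) a b d c p := fun a b => by
      simp only [cov3, h1 _ c, h1 _ _ d, Fin.sum_univ_two]; ring
    simp only [theta, sym, h2]; ring
  X_right c d a b := by simp only [theta, sym]; ring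

theorem thetaBar_eq_bar (Γ : Symbols) (ε : Fin 2 → Fin 2 → Pt → ℝ) (p : Pt) :
    thetaBar Γ ε p = (theta Γ ε p).bar (fun a b => schouten Γ a b p) := rfl

theorem obstruction_eq_det {U : Set Pt} {Γ : Symbols} {ε : Fin 2 → Fin 2 → Pt → ℝ} (hU : IsOpen U)
    (hΓ : IsConnection U Γ) (hε : IsParallelVolume U Γ ε) {p : Pt} (hp : p ∈ U) :
    obstruction Γ ε p = ε 0 1 p ^ 8 * (theta Γ ε p).toMatrix.det :=
  Blocks.contraction_eq (fun a b => hε.skew a b p hp) _ (isSymm_theta hU hΓ hε hp)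

theorem det_thetaBar (Γ : Symbols) (ε : Fin 2 → Fin 2 → Pt → ℝ) (p : Pt) :
    (thetaBar Γ ε p).toMatrix.det = 4320 * (theta Γ ε p).toMatrix.det := by
  rw [thetaBar_eq_bar, Blocks.det_bar]

/-! ### Derivatives of row sections -/

theorem vecMul_fin_six (v : Fin 6 → ℝ) (M : Matrix (Fin 6) (Fin 6) ℝ) (j : Fin 6) :
    Matrix.vecMul v M j = v 0 * M 0 j + v 1 * M 1 j + v 2 * M 2 j + v 3 * M 3 j + v 4 * M 4 j
      + v 5 * M 5 j := by
  simp only [Matrix.vecMul, dotProduct, Fin.sum_univ_six]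

/-- The derivative after a gauge transformation `G`: if `∂ₐ G = G Nₐ - R`, then
`Dₐ (W G) = (∂ₐ W) G - W R`. -/
theorem covRow_vecMul (N : Fin 2 → Pt → Matrix (Fin 6) (Fin 6) ℝ) {W : Pt → Fin 6 → ℝ}
    {G : Pt → Matrix (Fin 6) (Fin 6) ℝ} {p : Pt} {a : Fin 2}
    (hW : ∀ i, DifferentiableAt ℝ (fun q => W q i) p)
    (hG : ∀ i j, DifferentiableAt ℝ (fun q => G q i j) p) (R : Matrix (Fin 6) (Fin 6) ℝ)
    (h : ∀ i j, pderiv a (fun q => G q i j) p = (G p * N a p - R) i j) :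
    covRow N a (fun q => Matrix.vecMul (W q) (G q)) p
      = Matrix.vecMul (fun i => pderiv a (fun q => W q i) p) (G p) - Matrix.vecMul (W p) R := by
  funext j
  have h1 : pderiv a (fun q => Matrix.vecMul (W q) (G q) j) p
      = ∑ i, (pderiv a (fun q => W q i) p * G p i j + W p i * (G p * N a p - R) i j) := by
    have h0 : (fun q => Matrix.vecMul (W q) (G q) j) = fun q => ∑ i, W q i * G q i j := rfl
    have h2 : fderiv ℝ (fun q => ∑ i, W q i * G q i j) p
        = ∑ i, fderiv ℝ (fun q => W q i * G q i j) p :=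
      fderiv_fun_sum (A := fun i q => W q i * G q i j) fun i _ => (hW i).fun_mul (hG i j)
    rw [h0, pderiv, h2, sum_apply]
    refine Finset.sum_congr rfl fun i _ => ?_
    rw [← h]
    exact pderiv_mul (hW i) (hG i j)
  rw [covRow, h1, Finset.sum_add_distrib, Matrix.vecMul_vecMul]
  simp only [Pi.sub_apply, Matrix.vecMul, dotProduct, Matrix.sub_apply, mul_sub,
    Finset.sum_sub_distrib]
  ring

section

variable {U : Set Pt}

theorem covRow_congr (hU : IsOpen U) (N : Fin 2 → Pt → Matrix (Fin 6) (Fin 6) ℝ) (a : Fin 2)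
    {W W' : Pt → Fin 6 → ℝ} (h : ∀ q ∈ U, W q = W' q) {p : Pt} (hp : p ∈ U) :
    covRow N a W p = covRow N a W' p := by
  funext j
  rw [covRow, covRow, h p hp, pderiv_congr hU (fun q hq => by rw [h q hq]) hp]

theorem covRow_sub (N : Fin 2 → Pt → Matrix (Fin 6) (Fin 6) ℝ) (a : Fin 2)
    {W W' : Pt → Fin 6 → ℝ} {p : Pt} (hW : ∀ i, DifferentiableAt ℝ (fun q => W q i) p)
    (hW' : ∀ i, DifferentiableAt ℝ (fun q => W' q i) p) :
    covRow N a (fun q => W q - W' q) p = covRow N a W p - covRow N a W' p := by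
  funext j
  simp only [covRow, Pi.sub_apply, Matrix.sub_vecMul]
  rw [pderiv_sub (hW j) (hW' j)]
  ring

theorem covRow_add (N : Fin 2 → Pt → Matrix (Fin 6) (Fin 6) ℝ) (a : Fin 2)
    {W W' : Pt → Fin 6 → ℝ} {p : Pt} (hW : ∀ i, DifferentiableAt ℝ (fun q => W q i) p)
    (hW' : ∀ i, DifferentiableAt ℝ (fun q => W' q i) p) :
    covRow N a (fun q => W q + W' q) p = covRow N a W p + covRow N a W' p := by
  funext j
  simp only [covRow, Pi.add_apply, Matrix.add_vecMul]
  rw [pderiv_add (hW j) (hW' j)]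
  ring

theorem covRow_smul (N : Fin 2 → Pt → Matrix (Fin 6) (Fin 6) ℝ) (a : Fin 2)
    {W : Pt → Fin 6 → ℝ} {u : Pt → ℝ} {p : Pt} (hu : DifferentiableAt ℝ u p)
    (hW : ∀ i, DifferentiableAt ℝ (fun q => W q i) p) :
    covRow N a (fun q => u q • W q) p = pderiv a u p • W p + u p • covRow N a W p := by
  funext j
  simp only [covRow, Pi.smul_apply, smul_eq_mul, Matrix.smul_vecMul, Pi.add_apply]
  rw [pderiv_mul hu (hW j)]
  ring

theorem contDiffOn_covRow {n m : WithTop ℕ∞} (hU : IsOpen U)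
    {N : Fin 2 → Pt → Matrix (Fin 6) (Fin 6) ℝ} {a : Fin 2} {W : Pt → Fin 6 → ℝ}
    (hN : ∀ i j, ContDiffOn ℝ m (fun q => N a q i j) U)
    (hW : ∀ i, ContDiffOn ℝ n (fun q => W q i) U) (hm : m + 1 ≤ n) (j : Fin 6) :
    ContDiffOn ℝ m (fun q => covRow N a W q j) U := by
  have h0 : ∀ i, ContDiffOn ℝ m (fun q => W q i) U := fun i =>
    (hW i).of_le (le_trans le_self_add hm)
  refine ContDiffOn.sub (contDiffOn_pderiv hU (hW j) hm a) ?_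
  simp only [Matrix.vecMul, dotProduct]
  exact ContDiffOn.sum fun i _ => (h0 i).mul (hN i j)

end

/-! ### Change of the connection in its projective class -/

section Change

variable {U : Set Pt} {Γ Γ' : Symbols} {ε ε' : Fin 2 → Fin 2 → Pt → ℝ} {f : Pt → ℝ}

/-- `P̂_{ab} = P_{ab} - ∇ₐ ω_b + ωₐ ω_b` for `ω = df`. -/
theorem schouten_projChange (hU : IsOpen U) (hΓ : IsConnection U Γ) (hf : ContDiffOn ℝ 6 f U)
    (h : IsProjChange U (fun a => pderiv a f) Γ Γ') {p : Pt} (hp : p ∈ U) (a b : Fin 2) :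
    schouten Γ' a b p = schouten Γ a b p - cov1 Γ (fun a => pderiv a f) a b p
      + pderiv a f p * pderiv b f p := by
  have hG : ∀ c a b, DifferentiableAt ℝ (Γ c a b) p := fun c a b =>
    differentiableAt_of_contDiffOn hU (hΓ.contDiffOn c a b) (by norm_num) hp
  have hω : ∀ a, DifferentiableAt ℝ (pderiv a f) p := fun a =>
    differentiableAt_of_contDiffOn hU (n := 5) (contDiffOn_pderiv hU hf (by norm_num) a)
      (by norm_num) hp
  have hc : pderiv 1 (pderiv 0 f) p = pderiv 0 (pderiv 1 f) p :=
    pderiv_comm hU hf (by norm_num) hp 1 0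
  have hT : ∀ c, Γ c 1 0 p = Γ c 0 1 p := fun c => hΓ.torsionFree c 1 0 p hp
  have hTd : ∀ e c, pderiv e (Γ c 1 0) p = pderiv e (Γ c 0 1) p := fun e c =>
    pderiv_congr hU (fun q hq => hΓ.torsionFree c 1 0 q hq) hp
  have hd : ∀ e c a b, pderiv e (Γ' c a b) p = pderiv e (Γ c a b) p
      + kron a c * pderiv e (pderiv b f) p + kron b c * pderiv e (pderiv a f) p := by
    intro e c a b
    rw [pderiv_congr hU (fun q hq => h q hq a b c) hp]
    simp (disch := fun_prop) only [pderiv_add, pderiv_const_mul]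
  simp only [schouten, ricci, curv, hd, h p hp _ _ _, cov1, Fin.sum_univ_two]
  fin_cases a <;> fin_cases b <;> simp [kron, hT, hTd, hc] <;> ring

/-- In dimension two the Cotton tensor is projectively invariant, since the projective Weyl tensor
vanishes. -/
theorem cotton_projChange (hU : IsOpen U) (hΓ : IsConnection U Γ) (hf : ContDiffOn ℝ 6 f U)
    (h : IsProjChange U (fun a => pderiv a f) Γ Γ') {p : Pt} (hp : p ∈ U) (a b c : Fin 2) :
    cotton Γ' a b c p = cotton Γ a b c p := by
  have hG : ∀ c a b, DifferentiableAt ℝ (Γ c a b) p := fun c a b =>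
    differentiableAt_of_contDiffOn hU (hΓ.contDiffOn c a b) (by norm_num) hp
  have hP : ∀ a b, DifferentiableAt ℝ (schouten Γ a b) p := fun a b =>
    differentiableAt_of_contDiffOn hU (hΓ.contDiffOn_schouten hU a b) (by norm_num) hp
  have h1 : ∀ a, ContDiffOn ℝ 5 (pderiv a f) U := fun a =>
    contDiffOn_pderiv hU hf (by norm_num) a
  have hω : ∀ a, DifferentiableAt ℝ (pderiv a f) p := fun a =>
    differentiableAt_of_contDiffOn hU (h1 a) (by norm_num) hp
  have hω' : ∀ a b, DifferentiableAt ℝ (pderiv b (pderiv a f)) p := fun a b =>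
    differentiableAt_of_contDiffOn hU (n := 4) (contDiffOn_pderiv hU (h1 a) (by norm_num) b)
      (by norm_num) hp
  have hT : ∀ c, Γ c 1 0 p = Γ c 0 1 p := fun c => hΓ.torsionFree c 1 0 p hp
  have hc : pderiv 1 (pderiv 0 f) p = pderiv 0 (pderiv 1 f) p :=
    pderiv_comm hU hf (by norm_num) hp 1 0
  have hc2 : ∀ c, pderiv 1 (pderiv 0 (pderiv c f)) p = pderiv 0 (pderiv 1 (pderiv c f)) p :=
    fun c => pderiv_comm hU (h1 c) (by norm_num) hp 1 0
  have hd : ∀ e a b, pderiv e (schouten Γ' a b) p = pderiv e (schouten Γ a b) p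
      - (pderiv e (pderiv a (pderiv b f)) p
        - ∑ k, (pderiv e (Γ k a b) p * pderiv k f p + Γ k a b p * pderiv e (pderiv k f) p))
      + (pderiv e (pderiv a f) p * pderiv b f p + pderiv a f p * pderiv e (pderiv b f) p) := by
    intro e a b
    rw [pderiv_congr hU (fun q hq => schouten_projChange hU hΓ hf h hq a b) hp]
    simp only [cov1, Fin.sum_univ_two]
    simp (disch := fun_prop) only [pderiv_add, pderiv_sub, pderiv_mul]
  have hcu := fun d => curv_decomposition Γ 0 1 c d p
  have h01 : cotton Γ' 0 1 c p = cotton Γ 0 1 c p := by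
    -- The difference is the decomposition of the curvature, contracted with `ω`.
    have e0 := hcu 0
    have e1 := hcu 1
    simp only [cotton, cov2, hd, schouten_projChange hU hΓ hf h hp, h p hp _ _ _, cov1,
      Fin.sum_univ_two]
    simp only [curv, Fin.sum_univ_two] at e0 e1
    fin_cases c <;> simp [kron, hT, hc, hc2] at e0 e1 ⊢ <;>
      linear_combination pderiv 0 f p * e0 + pderiv 1 f p * e1
  have hsk : ∀ Γ : Symbols, cotton Γ 1 0 c p = - cotton Γ 0 1 c p := fun Γ => by
    simp only [cotton]; ring
  have hz : ∀ (Γ : Symbols) (a : Fin 2), cotton Γ a a c p = 0 := fun Γ a => by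
    simp [cotton]
  fin_cases a <;> fin_cases b <;> simp [hsk, hz, h01]
theorem isParallelVolume_projChange (hU : IsOpen U)
    (hε : IsParallelVolume U Γ ε) (hf : ContDiffOn ℝ 6 f U)
    (h : IsProjChange U (fun a => pderiv a f) Γ Γ')
    (hε' : ∀ p ∈ U, ∀ b c, ε' b c p = Real.exp (-3 * f p) * ε b c p) :
    IsParallelVolume U Γ' ε' where
  contDiffOn b c := by
    have h1 : ContDiffOn ℝ 1 f U := hf.of_le (by norm_num)
    have h2 := hε.contDiffOn b c
    refine ContDiffOn.congr (f := fun p => Real.exp (-3 * f p) * ε b c p) ?_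
      fun p hp => hε' p hp b c
    fun_prop
  skew b c p hp := by rw [hε' p hp, hε' p hp, hε.skew b c p hp]; ring
  ne_zero p hp := by
    rw [hε' p hp]; exact mul_ne_zero (Real.exp_pos _).ne' (hε.ne_zero p hp)
  parallel a b c p hp := by
    have hfd : DifferentiableAt ℝ f p := differentiableAt_of_contDiffOn hU hf (by norm_num) hp
    have hεd : ∀ b c, DifferentiableAt ℝ (ε b c) p := fun b c =>
      differentiableAt_of_contDiffOn hU (hε.contDiffOn b c) (by norm_num) hp
    have hd : pderiv a (ε' b c) p = Real.exp (-3 * f p) *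
        (pderiv a (ε b c) p - 3 * pderiv a f p * ε b c p) := by
      rw [pderiv_congr hU (fun q hq => hε' q hq b c) hp]
      simp (disch := fun_prop) only [pderiv_mul, pderiv_exp]
      rw [pderiv_const]; ring
    simp only [covBivector, hd, hε.pderiv_eq hp, h p hp _ _ _, hε' p hp, Fin.sum_univ_two]
    fin_cases a <;> fin_cases b <;> fin_cases c <;>
      simp [kron, hε.diag_eq_zero hp, hε.skew 1 0 p hp] <;> ring

theorem cottonForm_projChange (hU : IsOpen U) (hΓ : IsConnection U Γ)
    (hε : IsParallelVolume U Γ ε) (hf : ContDiffOn ℝ 6 f U)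
    (h : IsProjChange U (fun a => pderiv a f) Γ Γ')
    (hε' : ∀ p ∈ U, ∀ b c, ε' b c p = Real.exp (-3 * f p) * ε b c p)
    {p : Pt} (hp : p ∈ U) (c : Fin 2) :
    cottonForm Γ' ε' c p = Real.exp (-3 * f p) * cottonForm Γ ε c p := by
  rw [(isParallelVolume_projChange hU hε hf h hε').cottonForm_eq hp, hε.cottonForm_eq hp,
    cotton_projChange hU hΓ hf h hp, hε' p hp]
  ring

theorem zTensor_projChange (hU : IsOpen U) (hΓ : IsConnection U Γ)
    (hε : IsParallelVolume U Γ ε) (hf : ContDiffOn ℝ 6 f U)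
    (h : IsProjChange U (fun a => pderiv a f) Γ Γ')
    (hε' : ∀ p ∈ U, ∀ b c, ε' b c p = Real.exp (-3 * f p) * ε b c p)
    {p : Pt} (hp : p ∈ U) (a b : Fin 2) :
    zTensor Γ' ε' a b p = Real.exp (-3 * f p) * (zTensor Γ ε a b p
      - 5 * sym (fun a b => pderiv a f p * cottonForm Γ ε b p) a b) := by
  have hfd : DifferentiableAt ℝ f p := differentiableAt_of_contDiffOn hU hf (by norm_num) hp
  have hY : ∀ a, DifferentiableAt ℝ (cottonForm Γ ε a) p := fun a =>
    differentiableAt_of_contDiffOn hU (hε.contDiffOn_cottonForm hU hΓ a) (by norm_num) hp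
  have hd : ∀ a b, pderiv a (cottonForm Γ' ε' b) p = Real.exp (-3 * f p) *
      (pderiv a (cottonForm Γ ε b) p - 3 * pderiv a f p * cottonForm Γ ε b p) := by
    intro a b
    rw [pderiv_congr hU (fun q hq => cottonForm_projChange hU hΓ hε hf h hε' hq b) hp]
    simp (disch := fun_prop) only [pderiv_mul, pderiv_exp]
    rw [pderiv_const]; ring
  simp only [zTensor, sym, cov1, hd, cottonForm_projChange hU hΓ hε hf h hε' hp, h p hp _ _ _,
    Fin.sum_univ_two]
  fin_cases a <;> fin_cases b <;> simp [kron] <;> ring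

/-- The gauge transformation of row sections for the change of connection by `df`; the factor comes
from the rescaling of the volume form. -/
noncomputable def projGauge (f : Pt → ℝ) (p : Pt) : Matrix (Fin 6) (Fin 6) ℝ :=
  Real.exp (-3 * f p) • Blocks.colMatrix (fun a => pderiv a f p)

theorem row0_projChange (hU : IsOpen U) (hΓ : IsConnection U Γ)
    (hε : IsParallelVolume U Γ ε) (hf : ContDiffOn ℝ 6 f U)
    (h : IsProjChange U (fun a => pderiv a f) Γ Γ')
    (hε' : ∀ p ∈ U, ∀ b c, ε' b c p = Real.exp (-3 * f p) * ε b c p)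
    {p : Pt} (hp : p ∈ U) :
    row0 Γ' ε' p = Matrix.vecMul (row0 Γ ε p) (projGauge f p) := by
  funext j
  simp only [row0, cottonForm_projChange hU hΓ hε hf h hε' hp,
    zTensor_projChange hU hΓ hε hf h hε' hp, projGauge]
  fin_cases j <;>
    simp [rowOf, Matrix.vecMul, dotProduct, Fin.sum_univ_succ, Blocks.colMatrix, Blocks.rowMatrix,
      sym] <;> ring

set_option maxHeartbeats 4000000 in
/-- The gauge transformation intertwines the tractor connections of `Γ` and `Γ'`, up to the multiple
`5 ω` of the identity which accounts for the weight. -/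
theorem pderiv_projGauge (hU : IsOpen U) (hΓ : IsConnection U Γ) (hf : ContDiffOn ℝ 6 f U)
    (h : IsProjChange U (fun a => pderiv a f) Γ Γ') {p : Pt} (hp : p ∈ U) (a : Fin 2)
    (i j : Fin 6) : pderiv a (fun q => projGauge f q i j) p = (projGauge f p * tractorMatrix Γ' a p
      - (tractorMatrix Γ a p + (5 * pderiv a f p) • 1) * projGauge f p) i j := by
  have hfd : DifferentiableAt ℝ f p := differentiableAt_of_contDiffOn hU hf (by norm_num) hp
  have hω : ∀ a, DifferentiableAt ℝ (pderiv a f) p := fun a =>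
    differentiableAt_of_contDiffOn hU (n := 5) (contDiffOn_pderiv hU hf (by norm_num) a)
      (by norm_num) hp
  have hc : pderiv 1 (pderiv 0 f) p = pderiv 0 (pderiv 1 f) p :=
    pderiv_comm hU hf (by norm_num) hp 1 0
  have hT : ∀ c, Γ c 1 0 p = Γ c 0 1 p := fun c => hΓ.torsionFree c 1 0 p hp
  simp only [tractorMatrix, schouten_projChange hU hΓ hf h hp, cotton_projChange hU hΓ hf h hp,
    h p hp _ _ _, cov1, Fin.sum_univ_two, projGauge]
  fin_cases i <;> fin_cases j <;>
    simp (disch := fun_prop) [Blocks.colMatrix, Blocks.rowMatrix, Matrix.mul_apply,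
      Fin.sum_univ_succ, pderiv_mul, pderiv_exp, pderiv_const, pderiv_neg, pderiv_pow,
      pderiv_div_const] <;>
    fin_cases a <;> simp [kron, hT, hc, Matrix.one_apply] <;> ring
end Change

section

variable {U : Set Pt} {Γ Γ' : Symbols} {ε ε' : Fin 2 → Fin 2 → Pt → ℝ} {f : Pt → ℝ}

theorem IsConnection.contDiffOn_tractorMatrix (hU : IsOpen U) (hΓ : IsConnection U Γ)
    (a : Fin 2) (i j : Fin 6) : ContDiffOn ℝ 3 (fun q => tractorMatrix Γ a q i j) U := by
  have h0 : ∀ c a b, ContDiffOn ℝ 3 (Γ c a b) U := fun c a b =>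
    (hΓ.contDiffOn c a b).of_le (by norm_num)
  have h1 : ∀ a b, ContDiffOn ℝ 3 (schouten Γ a b) U := fun a b =>
    (hΓ.contDiffOn_schouten hU a b).of_le (by norm_num)
  have h2 := fun a b c => hΓ.contDiffOn_cotton hU a b c
  fin_cases i <;> fin_cases j <;> simp [tractorMatrix, sym] <;> fun_prop

theorem IsParallelVolume.contDiffOn_row0 (hU : IsOpen U) (hΓ : IsConnection U Γ)
    (hε : IsParallelVolume U Γ ε) (i : Fin 6) : ContDiffOn ℝ 2 (fun q => row0 Γ ε q i) U := by
  have h1 : ∀ a, ContDiffOn ℝ 2 (cottonForm Γ ε a) U := fun a =>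
    (hε.contDiffOn_cottonForm hU hΓ a).of_le (by norm_num)
  have h2 := fun a b => hε.contDiffOn_zTensor hU hΓ a b
  fin_cases i <;> simp [row0, rowOf] <;> fun_prop

theorem IsParallelVolume.contDiffOn_row1 (hU : IsOpen U) (hΓ : IsConnection U Γ)
    (hε : IsParallelVolume U Γ ε) (a : Fin 2) (i : Fin 6) :
    ContDiffOn ℝ 1 (fun q => row1 Γ ε a q i) U :=
  contDiffOn_covRow hU (fun i j => (hΓ.contDiffOn_tractorMatrix hU a i j).of_le (by norm_num))
    (fun i => hε.contDiffOn_row0 hU hΓ i) (by norm_num) i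

theorem IsParallelVolume.differentiableAt_row0 (hU : IsOpen U) (hΓ : IsConnection U Γ)
    (hε : IsParallelVolume U Γ ε) {p : Pt} (hp : p ∈ U) (i : Fin 6) :
    DifferentiableAt ℝ (fun q => row0 Γ ε q i) p :=
  differentiableAt_of_contDiffOn hU (hε.contDiffOn_row0 hU hΓ i) (by norm_num) hp

theorem IsParallelVolume.differentiableAt_row1 (hU : IsOpen U) (hΓ : IsConnection U Γ)
    (hε : IsParallelVolume U Γ ε) (a : Fin 2) {p : Pt} (hp : p ∈ U) (i : Fin 6) :
    DifferentiableAt ℝ (fun q => row1 Γ ε a q i) p :=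
  differentiableAt_of_contDiffOn hU (hε.contDiffOn_row1 hU hΓ a i) (by norm_num) hp

theorem covRow_projGauge (hU : IsOpen U) (hΓ : IsConnection U Γ) (hf : ContDiffOn ℝ 6 f U)
    (h : IsProjChange U (fun a => pderiv a f) Γ Γ') {W : Pt → Fin 6 → ℝ} {p : Pt} (hp : p ∈ U)
    (hW : ∀ i, DifferentiableAt ℝ (fun q => W q i) p) (a : Fin 2) :
    covRow (tractorMatrix Γ') a (fun q => Matrix.vecMul (W q) (projGauge f q)) p
      = Matrix.vecMul (covRow (tractorMatrix Γ) a W p - (5 * pderiv a f p) • W p)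
        (projGauge f p) := by
  have hfd : DifferentiableAt ℝ f p := differentiableAt_of_contDiffOn hU hf (by norm_num) hp
  have hω : ∀ a, DifferentiableAt ℝ (pderiv a f) p := fun a =>
    differentiableAt_of_contDiffOn hU (n := 5) (contDiffOn_pderiv hU hf (by norm_num) a)
      (by norm_num) hp
  have hG : ∀ i j, DifferentiableAt ℝ (fun q => projGauge f q i j) p := by
    intro i j
    fin_cases i <;> fin_cases j <;>
      simp [projGauge, Blocks.colMatrix, Blocks.rowMatrix] <;> fun_prop
  rw [covRow_vecMul _ hW hG _ (pderiv_projGauge hU hΓ hf h hp a), ← Matrix.vecMul_vecMul,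
    ← Matrix.sub_vecMul, Matrix.vecMul_add, Matrix.vecMul_smul, Matrix.vecMul_one]
  congr 1
  funext j
  simp only [Pi.sub_apply, Pi.add_apply, covRow]
  ring

section

variable (hU : IsOpen U) (hΓ : IsConnection U Γ)
    (hε : IsParallelVolume U Γ ε) (hf : ContDiffOn ℝ 6 f U)
    (h : IsProjChange U (fun a => pderiv a f) Γ Γ')
    (hε' : ∀ p ∈ U, ∀ b c, ε' b c p = Real.exp (-3 * f p) * ε b c p) {p : Pt} (hp : p ∈ U)
include hU hΓ hε hf h hε' hp

theorem row1_projChange (a : Fin 2) :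
    row1 Γ' ε' a p = Matrix.vecMul (row1 Γ ε a p - (5 * pderiv a f p) • row0 Γ ε p)
      (projGauge f p) := by
  rw [row1, covRow_congr hU _ a (fun q hq => row0_projChange hU hΓ hε hf h hε' hq) hp,
    covRow_projGauge hU hΓ hf h hp (hε.differentiableAt_row0 hU hΓ hp)]
  rfl

/-- The second derivatives change by lower derivatives only, with coefficients polynomial in `ω = df`
and `∇ω`. -/
theorem row2_projChange (a b : Fin 2) :
    row2 Γ' ε' a b p = Matrix.vecMul (row2 Γ ε a b p
      - (6 * pderiv a f p) • row1 Γ ε b p - (6 * pderiv b f p) • row1 Γ ε a p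
      + (35 * (pderiv a f p * pderiv b f p) - 5 * cov1 Γ (fun a => pderiv a f) a b p) • row0 Γ ε p)
      (projGauge f p) := by
  have hω : ∀ a, DifferentiableAt ℝ (pderiv a f) p := fun a =>
    differentiableAt_of_contDiffOn hU (n := 5) (contDiffOn_pderiv hU hf (by norm_num) a)
      (by norm_num) hp
  have d0 := fun i => hε.differentiableAt_row0 hU hΓ hp i
  have d1 := fun a i => hε.differentiableAt_row1 hU hΓ a hp i
  have d2 : ∀ i, DifferentiableAt ℝ (fun q => ((5 * pderiv b f q) • row0 Γ ε q) i) p := by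
    intro i
    simp only [Pi.smul_apply, smul_eq_mul]
    have := d0 i
    fun_prop
  have d3 : ∀ i, DifferentiableAt ℝ
      (fun q => (row1 Γ ε b q - (5 * pderiv b f q) • row0 Γ ε q) i) p :=
    fun i => (d1 b i).sub (d2 i)
  have e1 : ∀ a, covRow (tractorMatrix Γ) a (row0 Γ ε) p = row1 Γ ε a p := fun _ => rfl
  rw [row2, covRow_congr hU _ a (fun q hq => row1_projChange hU hΓ hε hf h hε' hq b) hp,
    covRow_projGauge hU hΓ hf h hp d3, covRow_sub _ _ (d1 b) d2,
    covRow_smul _ _ (by have := hω b; fun_prop) d0, e1, pderiv_const_mul _ (hω b)]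
  simp only [row1_projChange hU hΓ hε hf h hε' hp, Fin.sum_univ_two, h p hp _ _ _]
  rw [← Matrix.smul_vecMul, ← Matrix.smul_vecMul, ← Matrix.add_vecMul, ← Matrix.sub_vecMul]
  congr 1
  funext j
  simp only [row2, cov1, Fin.sum_univ_two, Pi.sub_apply, Pi.add_apply, Pi.smul_apply, smul_eq_mul]
  fin_cases a <;> fin_cases b <;> simp [kron] <;> ring

end

end

section

variable {U : Set Pt} {Γ Γ' : Symbols} {ε ε' : Fin 2 → Fin 2 → Pt → ℝ} {f : Pt → ℝ}

/-- The behaviour of `Θ̄`. The derivatives of `row0` mix by the unipotent matrix `C` below, and the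
change of the Schouten tensor in `Θ̄` compensates the second derivatives of `f` in `C`. -/
theorem thetaBar_projChange (hU : IsOpen U) (hΓ : IsConnection U Γ) (hΓ' : IsConnection U Γ')
    (hε : IsParallelVolume U Γ ε) (hf : ContDiffOn ℝ 6 f U)
    (h : IsProjChange U (fun a => pderiv a f) Γ Γ')
    (hε' : ∀ p ∈ U, ∀ b c, ε' b c p = Real.exp (-3 * f p) * ε b c p) {p : Pt} (hp : p ∈ U) :
    thetaBar Γ' ε' p = (((thetaBar Γ ε p).rowOps (fun a => pderiv a f p)).colOps
      (fun a => pderiv a f p)).scale (Real.exp (-3 * f p)) := by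
  have hε'' := isParallelVolume_projChange hU hε hf h hε'
  have hP := fun a b => hε.schouten_comm hU hΓ hp a b
  have hP' := fun a b => hε''.schouten_comm hU hΓ' hp a b
  refine ((isSymm_theta hU hΓ' hε'' hp).bar hP').ext_toMatrix
    (((((isSymm_theta hU hΓ hε hp).bar hP).rowOps _).colOps _).scale _) ?_
  rw [Blocks.toMatrix_scale, Blocks.toMatrix_colOps, Blocks.toMatrix_rowOps, thetaBar_eq_bar,
    Blocks.toMatrix_bar, Blocks.toMatrix_bar]
  set ω : Fin 2 → ℝ := fun a => pderiv a f p with hω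
  set w : Fin 2 → Fin 2 → ℝ := fun a b => sym (fun a b => cov1 Γ (fun a => pderiv a f) a b p) a b
    with hw
  -- `C` collects the coefficients in `row1_projChange` and `row2_projChange`.
  set C : Matrix (Fin 6) (Fin 6) ℝ :=
    !![1, 0, 0, 0, 0, 0;
       -5 * ω 0, 1, 0, 0, 0, 0;
       -5 * ω 1, 0, 1, 0, 0, 0;
       35 * ω 0 ^ 2 - 5 * w 0 0, -12 * ω 0, 0, 1, 0, 0;
       35 * (ω 0 * ω 1) - 5 * w 0 1, -6 * ω 1, -6 * ω 0, 0, 1, 0;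
       35 * ω 1 ^ 2 - 5 * w 1 1, 0, -12 * ω 1, 0, 0, 1] with hC
  have key : (theta Γ' ε' p).toMatrix.transpose
      = C * (theta Γ ε p).toMatrix.transpose * projGauge f p := by
    rw [toMatrix_theta hU hΓ' hε'' hp, toMatrix_theta hU hΓ hε hp]
    simp only [sym, row0_projChange hU hΓ hε hf h hε' hp, row1_projChange hU hΓ hε hf h hε' hp,
      row2_projChange hU hΓ hε hf h hε' hp]
    ext i j
    rw [Matrix.mul_apply]
    fin_cases i <;>
      simp [hC, hw, hω, Matrix.mul_apply, Fin.sum_univ_succ, vecMul_fin_six, sym] <;> ring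
  have key' : (theta Γ' ε' p).toMatrix
      = Real.exp (-3 * f p) • (Blocks.rowMatrix ω * (theta Γ ε p).toMatrix * C.transpose) := by
    have := congrArg Matrix.transpose key
    rw [Matrix.transpose_transpose] at this
    rw [this, projGauge, Matrix.transpose_mul, Matrix.transpose_mul, Matrix.transpose_transpose,
      Matrix.transpose_smul, Blocks.colMatrix, Matrix.transpose_transpose, Matrix.smul_mul,
      Matrix.mul_assoc]
  have hbar : C.transpose * Blocks.barMatrix (fun a b => schouten Γ' a b p)
      = Blocks.barMatrix (fun a b => schouten Γ a b p) * Blocks.colMatrix ω := by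
    have hs : ∀ a b, schouten Γ' a b p = schouten Γ a b p - w a b + ω a * ω b := by
      intro a b
      have h1 := schouten_projChange hU hΓ hf h hp a b
      have h2 := schouten_projChange hU hΓ hf h hp b a
      rw [hP' b a, hP b a] at h2
      simp only [hw, hω, sym]
      linarith
    ext i j
    fin_cases i <;> fin_cases j <;>
      simp [hC, Matrix.mul_apply, Fin.sum_univ_succ, Blocks.barMatrix, Blocks.colMatrix,
        Blocks.rowMatrix, hs] <;> ring
  rw [key', Matrix.smul_mul, Matrix.mul_assoc, hbar]
  simp only [Matrix.mul_assoc]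

/-- The weight is `-42 = -3 * (6 + 8)`: six from the determinant of `Θ̄` and eight from the powers of
the volume form. -/
theorem obstruction_projChange (hU : IsOpen U) (hΓ : IsConnection U Γ) (hΓ' : IsConnection U Γ')
    (hε : IsParallelVolume U Γ ε) (hf : ContDiffOn ℝ 6 f U)
    (h : IsProjChange U (fun a => pderiv a f) Γ Γ')
    (hε' : ∀ p ∈ U, ∀ b c, ε' b c p = Real.exp (-3 * f p) * ε b c p) {p : Pt} (hp : p ∈ U) :
    obstruction Γ' ε' p = Real.exp (-42 * f p) * obstruction Γ ε p := by
  have hdet : (theta Γ' ε' p).toMatrix.det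
      = Real.exp (-3 * f p) ^ 6 * (theta Γ ε p).toMatrix.det := by
    have := congrArg (fun B => B.toMatrix.det) (thetaBar_projChange hU hΓ hΓ' hε hf h hε' hp)
    simp only [Blocks.toMatrix_scale, Blocks.toMatrix_colOps, Blocks.toMatrix_rowOps,
      Matrix.det_smul, Matrix.det_mul, Blocks.det_rowMatrix, Blocks.det_colMatrix,
      det_thetaBar, Fintype.card_fin] at this
    linarith
  rw [obstruction_eq_det hU hΓ' (isParallelVolume_projChange hU hε hf h hε') hp,
    obstruction_eq_det hU hΓ hε hp, hdet, hε' p hp, mul_pow]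
  have : Real.exp (-42 * f p) = Real.exp (-3 * f p) ^ 14 := by
    rw [← Real.exp_nat_mul]; ring_nf
  rw [this]; ring

end

/-! ### Invariance of the section -/

theorem power14_smul (c : ℝ) (κ : Canonical) : power14 (c • κ) = c ^ 14 • power14 κ := by
  rw [power14, MultilinearMap.map_smul_univ (PiTensorProduct.tprod ℝ) (fun _ : Fin 14 => c)
    (fun _ => κ)]
  simp [power14]

theorem obstructionSection_eq (Γ : Symbols) (ε : Fin 2 → Fin 2 → Pt → ℝ) (p : Pt) :
    obstructionSection Γ ε p = (obstruction Γ ε p * (ε 0 1 p)⁻¹ ^ 14) • power14 dxdy := by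
  rw [obstructionSection, power14_smul, smul_smul]

/-- The representative of the projective class of `Γ` with vanishing trace. -/
noncomputable def traceFree (Γ : Symbols) : Symbols := fun c a b p =>
  Γ c a b p + kron a c * (-(1 / 3) * (Γ 0 b 0 p + Γ 1 b 1 p))
    + kron b c * (-(1 / 3) * (Γ 0 a 0 p + Γ 1 a 1 p))

/-- The constant bivector with component `ε^{01} = 1`. -/
def unitVolume : Fin 2 → Fin 2 → Pt → ℝ := fun b c _ => kron b 0 * kron c 1 - kron b 1 * kron c 0

section

variable {U : Set Pt} {Γ Γ' : Symbols} {ε ε' : Fin 2 → Fin 2 → Pt → ℝ} {f : Pt → ℝ}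

theorem isProjChange_traceFree (U : Set Pt) (Γ : Symbols) :
    IsProjChange U (fun a p => -(1 / 3) * (Γ 0 a 0 p + Γ 1 a 1 p)) Γ (traceFree Γ) :=
  fun _ _ _ _ _ => rfl

theorem IsConnection.traceFree (hΓ : IsConnection U Γ) : IsConnection U (traceFree Γ) where
  contDiffOn c a b := by
    have := hΓ.contDiffOn
    unfold ProjSurf.traceFree
    fun_prop
  torsionFree c a b p hp := by
    simp only [ProjSurf.traceFree, hΓ.torsionFree c a b p hp]; ring

theorem trace_traceFree (Γ : Symbols) (a : Fin 2) (p : Pt) :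
    traceFree Γ 0 a 0 p + traceFree Γ 1 a 1 p = 0 := by
  fin_cases a <;> simp [traceFree, kron] <;> ring

theorem isParallelVolume_unitVolume (h : ∀ a, ∀ p ∈ U, Γ 0 a 0 p + Γ 1 a 1 p = 0) :
    IsParallelVolume U Γ unitVolume where
  contDiffOn b c := contDiffOn_const
  skew b c p hp := by simp only [unitVolume]; ring
  ne_zero p hp := by simp [unitVolume, kron]
  parallel a b c p hp := by
    have h0 := h a p hp
    have e : ∀ b c, pderiv a (unitVolume b c) p = 0 := fun b c => by
      unfold unitVolume; exact pderiv_const _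
    fin_cases b <;> fin_cases c <;>
      simp [covBivector, e, unitVolume, kron] <;> linarith

theorem exists_isParallelVolume (hΓ : IsConnection U Γ) :
    ∃ (Γ' : Symbols) (ε : Fin 2 → Fin 2 → Pt → ℝ),
      IsConnection U Γ' ∧ ProjEquiv U Γ Γ' ∧ IsParallelVolume U Γ' ε :=
  ⟨traceFree Γ, unitVolume, hΓ.traceFree, ⟨_, isProjChange_traceFree U Γ⟩,
    isParallelVolume_unitVolume fun a p _ => trace_traceFree Γ a p⟩

theorem cottonForm_neg (Γ : Symbols) (ε : Fin 2 → Fin 2 → Pt → ℝ) (c : Fin 2) :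
    cottonForm Γ (fun a b q => - ε a b q) c = fun p => - cottonForm Γ ε c p := by
  funext p
  simp only [cottonForm, Fin.sum_univ_two]; ring

theorem cov1_neg (Γ : Symbols) (φ : Fin 2 → Pt → ℝ) (a b : Fin 2) :
    cov1 Γ (fun b p => - φ b p) a b = fun p => - cov1 Γ φ a b p := by
  funext p
  simp only [cov1, pderiv_neg, Fin.sum_univ_two]; ring

theorem cov2_neg (Γ : Symbols) (φ : Fin 2 → Fin 2 → Pt → ℝ) (a b c : Fin 2) :
    cov2 Γ (fun b c p => - φ b c p) a b c = fun p => - cov2 Γ φ a b c p := by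
  funext p
  simp only [cov2, pderiv_neg, Fin.sum_univ_two]; ring

theorem cov3_neg (Γ : Symbols) (φ : Fin 2 → Fin 2 → Fin 2 → Pt → ℝ) (a b c d : Fin 2) :
    cov3 Γ (fun b c d p => - φ b c d p) a b c d = fun p => - cov3 Γ φ a b c d p := by
  funext p
  simp only [cov3, pderiv_neg, Fin.sum_univ_two]; ring

theorem theta_neg (Γ : Symbols) (ε : Fin 2 → Fin 2 → Pt → ℝ) (p : Pt) :
    theta Γ (fun a b q => - ε a b q) p = (theta Γ ε p).scale (-1) := by
  have hY : cottonForm Γ (fun a b q => - ε a b q) = fun c p => - cottonForm Γ ε c p :=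
    funext fun c => cottonForm_neg Γ ε c
  have hY1 : cov1 Γ (fun c p => - cottonForm Γ ε c p)
      = fun a b p => - cov1 Γ (cottonForm Γ ε) a b p :=
    funext fun a => funext fun b => cov1_neg Γ _ a b
  have hY2 : cov2 Γ (fun a b p => - cov1 Γ (cottonForm Γ ε) a b p)
      = fun a b c p => - cov2 Γ (cov1 Γ (cottonForm Γ ε)) a b c p :=
    funext fun a => funext fun b => funext fun c => cov2_neg Γ _ a b c
  have hZ : zTensor Γ (fun a b q => - ε a b q) = fun a b p => - zTensor Γ ε a b p := by
    funext a b p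
    simp only [zTensor, sym, hY, hY1]; ring
  have hZ1 : cov2 Γ (fun a b p => - zTensor Γ ε a b p)
      = fun a b c p => - cov2 Γ (zTensor Γ ε) a b c p :=
    funext fun a => funext fun b => funext fun c => cov2_neg Γ _ a b c
  have hZ2 : cov3 Γ (fun a b c p => - cov2 Γ (zTensor Γ ε) a b c p)
      = fun a b c d p => - cov3 Γ (cov2 Γ (zTensor Γ ε)) a b c d p :=
    funext fun a => funext fun b => funext fun c => funext fun d => cov3_neg Γ _ a b c d
  ext <;> simp only [theta, Blocks.scale, hY, hY1, hY2, hZ, hZ1, hZ2, sym] <;> ring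

/-- Reversing the sign of the volume form multiplies the six rows of `Θ` by `-1`. -/
theorem obstruction_neg (hU : IsOpen U)
    (hΓ : IsConnection U Γ) (hε : IsParallelVolume U Γ ε)
    (hε' : IsParallelVolume U Γ (fun a b q => - ε a b q)) {p : Pt} (hp : p ∈ U) :
    obstruction Γ (fun a b q => - ε a b q) p = obstruction Γ ε p := by
  rw [obstruction_eq_det hU hΓ hε' hp, obstruction_eq_det hU hΓ hε hp, theta_neg,
    Blocks.toMatrix_scale, Matrix.det_smul]
  simp only [Fintype.card_fin]; ring

theorem IsConnection.mono {V : Set Pt} (hΓ : IsConnection U Γ) (h : V ⊆ U) : IsConnection V Γ :=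
  ⟨fun c a b => (hΓ.contDiffOn c a b).mono h, fun c a b p hp => hΓ.torsionFree c a b p (h hp)⟩

theorem IsParallelVolume.mono {V : Set Pt} (hε : IsParallelVolume U Γ ε) (h : V ⊆ U) :
    IsParallelVolume V Γ ε :=
  ⟨fun b c => (hε.contDiffOn b c).mono h, fun b c p hp => hε.skew b c p (h hp),
    fun p hp => hε.ne_zero p (h hp), fun a b c p hp => hε.parallel a b c p (h hp)⟩

theorem IsParallelVolume.neg (hε : IsParallelVolume U Γ ε) :
    IsParallelVolume U Γ (fun a b q => - ε a b q) where
  contDiffOn b c := (hε.contDiffOn b c).neg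
  skew b c p hp := by rw [hε.skew b c p hp]
  ne_zero p hp := neg_ne_zero.2 (hε.ne_zero p hp)
  parallel a b c p hp := by
    have := hε.parallel a b c p hp
    simp only [covBivector, pderiv_neg, Fin.sum_univ_two] at this ⊢
    linarith

/-- Invariance of the section when the two volume forms have the same sign: their quotient is then
`e^{-3f}`, and comparing traces shows that the connections differ by `df`. -/
theorem obstructionSection_congr_of_pos (hU : IsOpen U) (hΓ : IsConnection U Γ)
    (hΓ' : IsConnection U Γ') (h : ProjEquiv U Γ Γ') (hε : IsParallelVolume U Γ ε)
    (hε' : IsParallelVolume U Γ' ε') (hpos : ∀ p ∈ U, 0 < ε' 0 1 p / ε 0 1 p) {p : Pt}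
    (hp : p ∈ U) : obstructionSection Γ' ε' p = obstructionSection Γ ε p := by
  obtain ⟨ω, hω⟩ := h
  set f : Pt → ℝ := fun q => -(1 / 3) * Real.log (ε' 0 1 q / ε 0 1 q) with hf
  have h6 := hε.contDiffOn_six hU hΓ 0 1
  have h6' := hε'.contDiffOn_six hU hΓ' 0 1
  have hfs : ContDiffOn ℝ 6 f U := contDiffOn_const.mul
    ((h6'.div h6 hε.ne_zero).log fun q hq => (hpos q hq).ne')
  have hexp : ∀ q ∈ U, Real.exp (-3 * f q) = ε' 0 1 q / ε 0 1 q := fun q hq => by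
    have : -3 * f q = Real.log (ε' 0 1 q / ε 0 1 q) := by simp only [hf]; ring
    rw [this, Real.exp_log (hpos q hq)]
  have hεε : ∀ q ∈ U, ∀ b c, ε' b c q = Real.exp (-3 * f q) * ε b c q := by
    intro q hq
    have h01 : ε' 0 1 q = Real.exp (-3 * f q) * ε 0 1 q := by
      rw [hexp q hq, div_mul_cancel₀ _ (hε.ne_zero q hq)]
    intro b c
    fin_cases b <;> fin_cases c <;>
      simp [hε.diag_eq_zero hq, hε'.diag_eq_zero hq, h01, hε.skew 1 0 q hq, hε'.skew 1 0 q hq]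
  have hdf : ∀ q ∈ U, ∀ a, pderiv a f q = ω a q := by
    intro q hq a
    have d1 : DifferentiableAt ℝ (ε 0 1) q :=
      differentiableAt_of_contDiffOn hU h6 (by norm_num) hq
    have d2 : DifferentiableAt ℝ f q :=
      differentiableAt_of_contDiffOn hU hfs (by norm_num) hq
    have e1 := hε'.pderiv_eq_trace hq a
    rw [pderiv_congr hU (fun q hq => hεε q hq 0 1) hq, pderiv_mul (by fun_prop) d1,
      pderiv_exp (by fun_prop), pderiv_const_mul _ d2, hε.pderiv_eq_trace hq, hεε q hq] at e1
    have hne : Real.exp (-3 * f q) * ε 0 1 q ≠ 0 :=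
      mul_ne_zero (Real.exp_pos _).ne' (hε.ne_zero q hq)
    have e2 : -3 * pderiv a f q - (Γ 0 a 0 q + Γ 1 a 1 q) = -(Γ' 0 a 0 q + Γ' 1 a 1 q) := by
      apply mul_right_cancel₀ hne
      linear_combination e1
    simp only [hω q hq _ _ _] at e2
    fin_cases a <;> simp [kron] at e2 ⊢ <;> linarith
  have hch : IsProjChange U (fun a => pderiv a f) Γ Γ' := fun q hq a b c => by
    simp only [hdf q hq]; exact hω q hq a b c
  rw [obstructionSection_eq, obstructionSection_eq,
    obstruction_projChange hU hΓ hΓ' hε hfs hch hεε hp, hεε p hp]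
  congr 1
  have : Real.exp (-42 * f p) = Real.exp (-3 * f p) ^ 14 := by
    rw [← Real.exp_nat_mul]; ring_nf
  rw [this, mul_inv, mul_pow]
  have h0 := (Real.exp_pos (-3 * f p)).ne'
  field_simp

/-- The sign of the quotient of the volume forms is locally constant, and both `obstruction` and the
14th power of the area form are even in the volume form. -/
theorem obstructionSection_congr (hU : IsOpen U) (hΓ : IsConnection U Γ)
    (hΓ' : IsConnection U Γ') (h : ProjEquiv U Γ Γ') (hε : IsParallelVolume U Γ ε)
    (hε' : IsParallelVolume U Γ' ε') {p : Pt}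
    (hp : p ∈ U) : obstructionSection Γ' ε' p = obstructionSection Γ ε p := by
  have key : ∀ ε'', IsParallelVolume U Γ' ε'' → 0 < ε'' 0 1 p / ε 0 1 p →
      obstructionSection Γ' ε'' p = obstructionSection Γ ε p := by
    intro ε'' hε'' hpos
    set V : Set Pt := U ∩ (fun q => ε'' 0 1 q / ε 0 1 q) ⁻¹' Set.Ioi 0 with hV
    have hVo : IsOpen V := ((hε''.contDiffOn 0 1).continuousOn.div
      (hε.contDiffOn 0 1).continuousOn hε.ne_zero).isOpen_inter_preimage hU isOpen_Ioi
    have hVU : V ⊆ U := Set.inter_subset_left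
    obtain ⟨ω, hω⟩ := h
    exact obstructionSection_congr_of_pos hVo (hΓ.mono hVU) (hΓ'.mono hVU)
      ⟨ω, fun q hq => hω q (hVU hq)⟩ (hε.mono hVU) (hε''.mono hVU) (fun q hq => hq.2) ⟨hp, hpos⟩
  rcases lt_or_gt_of_ne (div_ne_zero (hε'.ne_zero p hp) (hε.ne_zero p hp)) with hneg | hpos
  · rw [← key _ hε'.neg (by rw [neg_div]; linarith), obstructionSection_eq, obstructionSection_eq,
      obstruction_neg hU hΓ' hε' hε'.neg hp, inv_neg, Even.neg_pow (by decide)]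
  · exact key _ hε' hpos

end

/-! ### The curvature under changes of coordinates -/

section

variable {U U' : Set Pt} {φ : Pt → Pt} {Γ Γ' : Symbols} {ε ε' : Fin 2 → Fin 2 → Pt → ℝ}

theorem IsCoordChange.contDiffOn_jac (hU : IsOpen U) (hφ : IsCoordChange U U' φ) (k a : Fin 2) :
    ContDiffOn ℝ 6 (fun q => jac φ q k a) U := by
  have h : ContDiffOn ℝ 7 (fun q => φ q k) U := contDiffOn_pi.1 hφ.contDiffOn k
  exact contDiffOn_pderiv hU h (by norm_num) a

theorem IsCoordChange.differentiableAt_jac (hU : IsOpen U) (hφ : IsCoordChange U U' φ) {p : Pt}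
    (hp : p ∈ U) (k a : Fin 2) : DifferentiableAt ℝ (fun q => jac φ q k a) p :=
  differentiableAt_of_contDiffOn hU (hφ.contDiffOn_jac hU k a) (by norm_num) hp

theorem IsCoordChange.differentiableAt (hU : IsOpen U) (hφ : IsCoordChange U U' φ) {p : Pt}
    (hp : p ∈ U) : DifferentiableAt ℝ φ p :=
  (hφ.contDiffOn.contDiffAt (hU.mem_nhds hp)).differentiableAt (by norm_num)

theorem IsCoordChange.det_jac_eq (φ : Pt → Pt) (p : Pt) :
    (jac φ p).det = jac φ p 0 0 * jac φ p 1 1 - jac φ p 0 1 * jac φ p 1 0 :=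
  Matrix.det_fin_two _

/-- The second derivatives of the map in terms of the two connections. -/
theorem IsPullback.pderiv_jac (h : IsPullback U φ Γ Γ') {p : Pt} (hp : p ∈ U) (a b k : Fin 2) :
    pderiv a (fun q => jac φ q k b) p = ∑ c, jac φ p k c * Γ' c a b p
      - ∑ i, ∑ j, Γ k i j (φ p) * jac φ p i a * jac φ p j b := by
  have e : pderiv a (fun q => pderiv b (fun r => φ r k) q) p = pderiv a (fun q => jac φ q k b) p :=
    rfl
  rw [h p hp a b k, e]; ring

/-- Tensors are determined by their images under the invertible Jacobian matrix. -/
theorem eq_zero_of_jac {p : Pt} (hJ : (jac φ p).det ≠ 0) {X : Fin 2 → ℝ}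
    (h : ∀ k, ∑ c, jac φ p k c * X c = 0) (c : Fin 2) : X c = 0 := by
  have : (jac φ p).mulVec X = 0 := funext h
  exact congrFun (Matrix.eq_zero_of_mulVec_eq_zero hJ this) c

set_option maxHeartbeats 1000000 in
/-- The curvature is a tensor: this is the integrability condition `∂₀∂₁ J = ∂₁∂₀ J` for the
equations of `IsPullback`. -/
theorem curv_pullback (hU : IsOpen U) (hU' : IsOpen U') (hφ : IsCoordChange U U' φ)
    (hΓ : IsConnection U' Γ) (hΓ' : IsConnection U Γ') (h : IsPullback U φ Γ Γ') {p : Pt}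
    (hp : p ∈ U) (d k : Fin 2) :
    ∑ c, jac φ p k c * curv Γ' 0 1 d c p
      = (jac φ p 0 0 * jac φ p 1 1 - jac φ p 0 1 * jac φ p 1 0)
        * ∑ l, jac φ p l d * curv Γ 0 1 l k (φ p) := by
  have hφp : φ p ∈ U' := hφ.mapsTo hp
  have dφ := hφ.differentiableAt hU hp
  have dJ := fun k a => hφ.differentiableAt_jac hU hp k a
  have dG' : ∀ c a b, DifferentiableAt ℝ (Γ' c a b) p := fun c a b =>
    differentiableAt_of_contDiffOn hU (hΓ'.contDiffOn c a b) (by norm_num) hp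
  have dG0 : ∀ c a b, DifferentiableAt ℝ (Γ c a b) (φ p) := fun c a b =>
    differentiableAt_of_contDiffOn hU' (hΓ.contDiffOn c a b) (by norm_num) hφp
  have dG : ∀ c a b, DifferentiableAt ℝ (fun q => Γ c a b (φ q)) p := fun c a b =>
    (dG0 c a b).comp p dφ
  have dJJ : ∀ k a b, DifferentiableAt ℝ (fun q => pderiv b (fun q => jac φ q k a) q) p :=
    fun k a b => differentiableAt_of_contDiffOn hU (n := 5)
      (contDiffOn_pderiv hU (hφ.contDiffOn_jac hU k a) (by norm_num) b) (by norm_num) hp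
  have hc : pderiv 1 (fun q => pderiv 0 (fun q => jac φ q k d) q) p
      = pderiv 0 (fun q => pderiv 1 (fun q => jac φ q k d) q) p :=
    pderiv_comm hU (hφ.contDiffOn_jac hU k d) (by norm_num) hp 1 0
  have hE : ∀ a b, pderiv a (fun q => ∑ c, jac φ q k c * Γ' c b d q) p
      = pderiv a (fun q => pderiv b (fun q => jac φ q k d) q
        + ∑ i, ∑ j, Γ k i j (φ q) * jac φ q i b * jac φ q j d) p := fun a b =>
    pderiv_congr hU (fun q hq => h q hq b d k) hp
  have hT : ∀ c, Γ c 1 0 (φ p) = Γ c 0 1 (φ p) := fun c => hΓ.torsionFree c 1 0 _ hφp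
  have hT' : ∀ c, Γ' c 1 0 p = Γ' c 0 1 p := fun c => hΓ'.torsionFree c 1 0 _ hp
  have hTd : ∀ e c, pderiv e (Γ c 1 0) (φ p) = pderiv e (Γ c 0 1) (φ p) := fun e c =>
    pderiv_congr hU' (fun q hq => hΓ.torsionFree c 1 0 q hq) hφp
  have hTd' : ∀ e c, pderiv e (Γ' c 1 0) p = pderiv e (Γ' c 0 1) p := fun e c =>
    pderiv_congr hU (fun q hq => hΓ'.torsionFree c 1 0 q hq) hp
  simp only [Fin.sum_univ_two] at hE
  simp (disch := fun_prop) only [pderiv_add, pderiv_mul, pderiv_comp (dG0 _ _ _) dφ] at hE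
  have e01 := hE 0 1
  have e10 := hE 1 0
  simp only [h.pderiv_jac hp, Fin.sum_univ_two] at e01 e10
  simp only [curv, Fin.sum_univ_two]
  fin_cases d <;> simp only [Fin.zero_eta, Fin.mk_one, hT, hT', hTd, hTd'] at e01 e10 hc ⊢ <;>
    linear_combination e01 - e10 - hc

end

section

variable {U U' : Set Pt} {φ : Pt → Pt} {Γ Γ' : Symbols} {ε ε' : Fin 2 → Fin 2 → Pt → ℝ}

/-- The Schouten tensor is a tensor, by the uniqueness of the decomposition of the curvature. -/
theorem schouten_pullback (hU : IsOpen U) (hU' : IsOpen U') (hφ : IsCoordChange U U' φ)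
    (hΓ : IsConnection U' Γ) (hΓ' : IsConnection U Γ') (h : IsPullback U φ Γ Γ') {p : Pt}
    (hp : p ∈ U) (b d : Fin 2) :
    schouten Γ' b d p = ∑ i, ∑ j, schouten Γ i j (φ p) * jac φ p i b * jac φ p j d := by
  refine (schouten_unique Γ' p (fun b d => ∑ i, ∑ j, schouten Γ i j (φ p) * jac φ p i b
    * jac φ p j d) ?_ b d).symm
  have h01 : ∀ d c, curv Γ' 0 1 d c p =
      kron 0 c * (∑ i, ∑ j, schouten Γ i j (φ p) * jac φ p i 1 * jac φ p j d)
      - kron 1 c * (∑ i, ∑ j, schouten Γ i j (φ p) * jac φ p i 0 * jac φ p j d)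
      + ((∑ i, ∑ j, schouten Γ i j (φ p) * jac φ p i 1 * jac φ p j 0)
        - (∑ i, ∑ j, schouten Γ i j (φ p) * jac φ p i 0 * jac φ p j 1)) * kron d c := by
    intro d c
    rw [← sub_eq_zero]
    refine eq_zero_of_jac (φ := φ) (hφ.det_ne_zero p hp) (X := fun c => curv Γ' 0 1 d c p -
      (kron 0 c * (∑ i, ∑ j, schouten Γ i j (φ p) * jac φ p i 1 * jac φ p j d)
      - kron 1 c * (∑ i, ∑ j, schouten Γ i j (φ p) * jac φ p i 0 * jac φ p j d)
      + ((∑ i, ∑ j, schouten Γ i j (φ p) * jac φ p i 1 * jac φ p j 0)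
        - (∑ i, ∑ j, schouten Γ i j (φ p) * jac φ p i 0 * jac φ p j 1)) * kron d c)) (fun k => ?_) c
    have hc := curv_pullback hU hU' hφ hΓ hΓ' h hp d k
    simp only [curv_decomposition Γ, Fin.sum_univ_two] at hc
    simp only [Fin.sum_univ_two]
    fin_cases d <;> fin_cases k <;> simp [kron] at hc ⊢ <;> linear_combination hc
  have hsk : ∀ d c, curv Γ' 1 0 d c p = - curv Γ' 0 1 d c p := fun d c => by
    simp only [curv]; ring
  have hz : ∀ a d c, curv Γ' a a d c p = 0 := fun a d c => by simp only [curv]; ring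
  intro a b d c
  fin_cases a <;> fin_cases b <;> simp only [Fin.zero_eta, Fin.mk_one, hz, hsk, h01] <;> ring

theorem cotton_pullback (hU : IsOpen U) (hU' : IsOpen U') (hφ : IsCoordChange U U' φ)
    (hΓ : IsConnection U' Γ) (hΓ' : IsConnection U Γ') (h : IsPullback U φ Γ Γ') {p : Pt}
    (hp : p ∈ U) (a b c : Fin 2) :
    cotton Γ' a b c p = ∑ i, ∑ j, ∑ k, cotton Γ i j k (φ p)
      * jac φ p i a * jac φ p j b * jac φ p k c := by
  have hφp : φ p ∈ U' := hφ.mapsTo hp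
  have dφ := hφ.differentiableAt hU hp
  have dJ := fun k a => hφ.differentiableAt_jac hU hp k a
  have dP0 : ∀ a b, DifferentiableAt ℝ (schouten Γ a b) (φ p) := fun a b =>
    differentiableAt_of_contDiffOn hU' (hΓ.contDiffOn_schouten hU' a b) (by norm_num) hφp
  have dP : ∀ a b, DifferentiableAt ℝ (fun q => schouten Γ a b (φ q)) p := fun a b =>
    (dP0 a b).comp p dφ
  have hd : ∀ a b c, pderiv a (schouten Γ' b c) p = _ := fun a b c =>
    pderiv_congr hU (fun q hq => schouten_pullback hU hU' hφ hΓ hΓ' h hq b c) hp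
  simp only [Fin.sum_univ_two] at hd
  simp (disch := fun_prop) only [pderiv_add, pderiv_mul, pderiv_comp (dP0 _ _) dφ] at hd
  have hT : ∀ c, Γ c 1 0 (φ p) = Γ c 0 1 (φ p) := fun c => hΓ.torsionFree c 1 0 _ hφp
  have hT' : ∀ c, Γ' c 1 0 p = Γ' c 0 1 p := fun c => hΓ'.torsionFree c 1 0 _ hp
  have h01 : cotton Γ' 0 1 c p = ∑ i, ∑ j, ∑ k, cotton Γ i j k (φ p)
      * jac φ p i 0 * jac φ p j 1 * jac φ p k c := by
    simp only [cotton, cov2, hd, h.pderiv_jac hp,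
      schouten_pullback hU hU' hφ hΓ hΓ' h hp, Fin.sum_univ_two, hT, hT']
    fin_cases c <;> simp only [Fin.zero_eta, Fin.mk_one, hT'] <;> ring
  have hsk : ∀ (Γ : Symbols) p c, cotton Γ 1 0 c p = - cotton Γ 0 1 c p := fun Γ p c => by
    simp only [cotton]; ring
  have hz : ∀ (Γ : Symbols) (a : Fin 2) p c, cotton Γ a a c p = 0 := fun Γ a p c => by
    simp [cotton]
  simp only [Fin.sum_univ_two, hsk, hz] at h01 ⊢
  fin_cases a <;> fin_cases b <;> simp only [Fin.zero_eta, Fin.mk_one, hz, hsk, h01] <;> ring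

theorem IsBivectorPullback.eq_det (h : IsBivectorPullback U φ ε ε') (hε' : IsParallelVolume U Γ' ε')
    {p : Pt} (hp : p ∈ U) : ε 0 1 (φ p) = (jac φ p).det * ε' 0 1 p := by
  rw [h p hp, IsCoordChange.det_jac_eq]
  simp only [Fin.sum_univ_two, hε'.diag_eq_zero hp, hε'.skew 1 0 p hp]
  ring

section

variable (hU : IsOpen U) (hU' : IsOpen U') (hφ : IsCoordChange U U' φ)
    (hΓ : IsConnection U' Γ) (hε : IsParallelVolume U' Γ ε)
    (hΓ' : IsConnection U Γ') (hε' : IsParallelVolume U Γ' ε') (h : IsPullback U φ Γ Γ')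
    (hb : IsBivectorPullback U φ ε ε') {p : Pt} (hp : p ∈ U)
include hU hU' hφ hΓ hε hΓ' hε' h hb hp

theorem cottonForm_pullback (c : Fin 2) :
    cottonForm Γ' ε' c p = ∑ k, jac φ p k c * cottonForm Γ ε k (φ p) := by
  have hsk : ∀ c, cotton Γ 1 0 c (φ p) = - cotton Γ 0 1 c (φ p) := fun c => by
    simp only [cotton]; ring
  have hz : ∀ (a : Fin 2) c, cotton Γ a a c (φ p) = 0 := fun a c => by
    simp [cotton]
  simp only [hε'.cottonForm_eq hp, hε.cottonForm_eq (hφ.mapsTo hp), hb.eq_det hε' hp,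
    cotton_pullback hU hU' hφ hΓ hΓ' h hp, IsCoordChange.det_jac_eq, Fin.sum_univ_two, hsk, hz]
  ring

theorem zTensor_pullback (a b : Fin 2) :
    zTensor Γ' ε' a b p = ∑ i, ∑ j, zTensor Γ ε i j (φ p) * jac φ p i a * jac φ p j b := by
  have hφp : φ p ∈ U' := hφ.mapsTo hp
  have dφ := hφ.differentiableAt hU hp
  have dJ := fun k a => hφ.differentiableAt_jac hU hp k a
  have dY0 : ∀ a, DifferentiableAt ℝ (cottonForm Γ ε a) (φ p) := fun a =>
    differentiableAt_of_contDiffOn hU' (hε.contDiffOn_cottonForm hU' hΓ a) (by norm_num) hφp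
  have dY : ∀ a, DifferentiableAt ℝ (fun q => cottonForm Γ ε a (φ q)) p := fun a =>
    (dY0 a).comp p dφ
  have hd : ∀ a c, pderiv a (cottonForm Γ' ε' c) p = _ := fun a c =>
    pderiv_congr hU (fun q hq => cottonForm_pullback hU hU' hφ hΓ hε hΓ' hε' h hb hq c) hp
  simp only [Fin.sum_univ_two] at hd
  simp (disch := fun_prop) only [pderiv_add, pderiv_mul, pderiv_comp (dY0 _) dφ] at hd
  simp only [zTensor, sym, cov1, hd, h.pderiv_jac hp,
    cottonForm_pullback hU hU' hφ hΓ hε hΓ' hε' h hb hp, Fin.sum_univ_two]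
  ring

end

/-- The matrix of the pull-back of row sections `(r, m_c, s_{cd})` by `φ`: the identity, the Jacobian
matrix and its symmetric square. -/
noncomputable def jacGauge (φ : Pt → Pt) (p : Pt) : Matrix (Fin 6) (Fin 6) ℝ :=
  let J := jac φ p
  !![1, 0, 0, 0, 0, 0;
     0, J 0 0, J 0 1, 0, 0, 0;
     0, J 1 0, J 1 1, 0, 0, 0;
     0, 0, 0, J 0 0 ^ 2, J 0 0 * J 0 1, J 0 1 ^ 2;
     0, 0, 0, 2 * J 0 0 * J 1 0, J 0 0 * J 1 1 + J 1 0 * J 0 1, 2 * J 0 1 * J 1 1;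
     0, 0, 0, J 1 0 ^ 2, J 1 0 * J 1 1, J 1 1 ^ 2]

set_option maxHeartbeats 1000000 in
theorem det_jacGauge (φ : Pt → Pt) (p : Pt) : (jacGauge φ p).det = (jac φ p).det ^ 4 := by
  rw [IsCoordChange.det_jac_eq]
  simp [jacGauge, Matrix.det_succ_row_zero, Fin.sum_univ_succ, Fin.succAbove]
  ring

set_option maxHeartbeats 4000000 in
/-- The pull-back of row sections intertwines the tractor connections of `Γ` and of its pull-back. -/
theorem pderiv_jacGauge (hU : IsOpen U) (hU' : IsOpen U') (hφ : IsCoordChange U U' φ)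
    (hΓ : IsConnection U' Γ) (hΓ' : IsConnection U Γ') (h : IsPullback U φ Γ Γ') {p : Pt}
    (hp : p ∈ U) (a : Fin 2) (i j : Fin 6) :
    pderiv a (fun q => jacGauge φ q i j) p = (jacGauge φ p * tractorMatrix Γ' a p
      - (∑ i, jac φ p i a • tractorMatrix Γ i (φ p)) * jacGauge φ p) i j := by
  have dJ := fun k a => hφ.differentiableAt_jac hU hp k a
  have hT : ∀ c, Γ c 1 0 (φ p) = Γ c 0 1 (φ p) := fun c =>
    hΓ.torsionFree c 1 0 _ (hφ.mapsTo hp)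
  have hT' : ∀ c, Γ' c 1 0 p = Γ' c 0 1 p := fun c => hΓ'.torsionFree c 1 0 _ hp
  have hP := schouten_pullback hU hU' hφ hΓ hΓ' h hp
  have hC := cotton_pullback hU hU' hφ hΓ hΓ' h hp
  have hJ := h.pderiv_jac hp
  simp only [Fin.sum_univ_two] at hP hC hJ
  rw [Matrix.sub_apply, Matrix.mul_apply, Matrix.mul_apply, Fin.sum_univ_six, Fin.sum_univ_six]
  simp only [Fin.sum_univ_two, Matrix.add_apply, Matrix.smul_apply, smul_eq_mul]
  fin_cases i <;> fin_cases j <;>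
    simp (disch := fun_prop) [jacGauge, tractorMatrix, sym, pderiv_add, pderiv_mul,
      pderiv_const, pderiv_pow] <;>
    fin_cases a <;> simp [kron, hT, hT', hP, hC, hJ] <;> ring

end

section

variable {U U' : Set Pt} {φ : Pt → Pt} {Γ Γ' : Symbols} {ε ε' : Fin 2 → Fin 2 → Pt → ℝ}

theorem covRow_jacGauge (hU : IsOpen U) (hU' : IsOpen U') (hφ : IsCoordChange U U' φ)
    (hΓ : IsConnection U' Γ) (hΓ' : IsConnection U Γ') (h : IsPullback U φ Γ Γ')
    {W : Pt → Fin 6 → ℝ} {p : Pt} (hp : p ∈ U)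
    (hW : ∀ i, DifferentiableAt ℝ (fun q => W q i) (φ p)) (a : Fin 2) :
    covRow (tractorMatrix Γ') a (fun q => Matrix.vecMul (W (φ q)) (jacGauge φ q)) p
      = Matrix.vecMul (∑ i, jac φ p i a • covRow (tractorMatrix Γ) i W (φ p)) (jacGauge φ p) := by
  have dφ := hφ.differentiableAt hU hp
  have dJ := fun k a => hφ.differentiableAt_jac hU hp k a
  have hG : ∀ i j, DifferentiableAt ℝ (fun q => jacGauge φ q i j) p := by
    intro i j
    fin_cases i <;> fin_cases j <;> simp [jacGauge] <;> fun_prop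
  have hW' : ∀ i, DifferentiableAt ℝ (fun q => W (φ q) i) p := fun i => (hW i).comp p dφ
  rw [covRow_vecMul _ hW' hG _ (pderiv_jacGauge hU hU' hφ hΓ hΓ' h hp a), ← Matrix.vecMul_vecMul,
    ← Matrix.sub_vecMul]
  congr 1
  funext j
  rw [Pi.sub_apply, pderiv_comp (hW j) dφ]
  simp only [Fin.sum_univ_two, Matrix.vecMul_add, Matrix.vecMul_smul, Pi.add_apply, Pi.smul_apply,
    smul_eq_mul, covRow]
  ring

section

variable (hU : IsOpen U) (hU' : IsOpen U') (hφ : IsCoordChange U U' φ)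
    (hΓ : IsConnection U' Γ) (hε : IsParallelVolume U' Γ ε)
    (hΓ' : IsConnection U Γ') (hε' : IsParallelVolume U Γ' ε') (h : IsPullback U φ Γ Γ')
    (hb : IsBivectorPullback U φ ε ε') {p : Pt} (hp : p ∈ U)
include hU hU' hφ hΓ hε hΓ' hε' h hb hp

theorem row0_pullback : row0 Γ' ε' p = Matrix.vecMul (row0 Γ ε (φ p)) (jacGauge φ p) := by
  funext j
  simp only [row0, cottonForm_pullback hU hU' hφ hΓ hε hΓ' hε' h hb hp,
    zTensor_pullback hU hU' hφ hΓ hε hΓ' hε' h hb hp, Fin.sum_univ_two, vecMul_fin_six,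
    zTensor_comm Γ ε 1 0]
  fin_cases j <;> simp [rowOf, jacGauge] <;> ring

theorem row1_pullback (a : Fin 2) : row1 Γ' ε' a p
    = Matrix.vecMul (∑ i, jac φ p i a • row1 Γ ε i (φ p)) (jacGauge φ p) := by
  rw [row1, covRow_congr hU _ a
    (fun q hq => row0_pullback hU hU' hφ hΓ hε hΓ' hε' h hb hq) hp,
    covRow_jacGauge hU hU' hφ hΓ hΓ' h hp (hε.differentiableAt_row0 hU' hΓ (hφ.mapsTo hp))]
  rfl

theorem row2_pullback (a b : Fin 2) : row2 Γ' ε' a b p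
    = Matrix.vecMul (∑ i, ∑ j, (jac φ p i a * jac φ p j b) • row2 Γ ε i j (φ p))
      (jacGauge φ p) := by
  have dφ := hφ.differentiableAt hU hp
  have dJ := fun k a => hφ.differentiableAt_jac hU hp k a
  have hG : ∀ i j, DifferentiableAt ℝ (fun q => jacGauge φ q i j) p := by
    intro i j
    fin_cases i <;> fin_cases j <;> simp [jacGauge] <;> fun_prop
  have d1 : ∀ a i, DifferentiableAt ℝ (fun q => row1 Γ ε a q i) (φ p) := fun a i =>
    hε.differentiableAt_row1 hU' hΓ a (hφ.mapsTo hp) i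
  have d1' : ∀ a i, DifferentiableAt ℝ (fun q => row1 Γ ε a (φ q) i) p := fun a i =>
    (d1 a i).comp p dφ
  have d2 : ∀ a i, DifferentiableAt ℝ
      (fun q => Matrix.vecMul (row1 Γ ε a (φ q)) (jacGauge φ q) i) p := by
    intro a i
    have := d1' a
    simp only [vecMul_fin_six]
    fun_prop
  have d3 : ∀ k a i, DifferentiableAt ℝ (fun q =>
      (jac φ q k b • Matrix.vecMul (row1 Γ ε a (φ q)) (jacGauge φ q)) i) p := fun k a i =>
    (dJ k b).mul (d2 a i)
  have e : ∀ q ∈ U, row1 Γ' ε' b q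
      = jac φ q 0 b • Matrix.vecMul (row1 Γ ε 0 (φ q)) (jacGauge φ q)
        + jac φ q 1 b • Matrix.vecMul (row1 Γ ε 1 (φ q)) (jacGauge φ q) := fun q hq => by
    rw [row1_pullback hU hU' hφ hΓ hε hΓ' hε' h hb hq, Fin.sum_univ_two, Matrix.add_vecMul,
      Matrix.smul_vecMul, Matrix.smul_vecMul]
  rw [row2, covRow_congr hU _ a e hp, covRow_add _ _ (d3 0 0) (d3 1 1),
    covRow_smul _ _ (dJ 0 b) (d2 0), covRow_smul _ _ (dJ 1 b) (d2 1),
    covRow_jacGauge hU hU' hφ hΓ hΓ' h hp (d1 0), covRow_jacGauge hU hU' hφ hΓ hΓ' h hp (d1 1)]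
  simp only [row1_pullback hU hU' hφ hΓ hε hΓ' hε' h hb hp, h.pderiv_jac hp]
  simp only [← Matrix.smul_vecMul, ← Matrix.add_vecMul, ← Matrix.sub_vecMul, Fin.sum_univ_two]
  congr 1
  funext j
  simp only [row2, Fin.sum_univ_two, Pi.sub_apply, Pi.add_apply, Pi.smul_apply, smul_eq_mul]
  ring

/-- Both the components of the sections and the derivative indices transform by `jacGauge`, whose
determinant is `(det J)^4`. -/
theorem det_theta_pullback : (theta Γ' ε' p).toMatrix.det
    = (jac φ p).det ^ 8 * (theta Γ ε (φ p)).toMatrix.det := by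
  have key : ∀ M, jacGauge φ p = M → (theta Γ' ε' p).toMatrix.transpose
      = (jacGauge φ p).transpose * (theta Γ ε (φ p)).toMatrix.transpose * M := by
    intro M hM
    have r0 := row0_pullback hU hU' hφ hΓ hε hΓ' hε' h hb hp
    have r1 := row1_pullback hU hU' hφ hΓ hε hΓ' hε' h hb hp
    have r2 := row2_pullback hU hU' hφ hΓ hε hΓ' hε' h hb hp
    rw [hM] at r0
    simp only [hM] at r1 r2
    rw [toMatrix_theta hU hΓ' hε' hp, toMatrix_theta hU' hΓ hε (hφ.mapsTo hp)]
    simp only [sym, r0, r1, r2]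
    ext i j
    rw [Matrix.mul_apply]
    fin_cases i <;>
      simp [jacGauge, Matrix.mul_apply, Fin.sum_univ_succ, vecMul_fin_six] <;> ring
  replace key := key _ rfl
  have := congrArg Matrix.det key
  rw [Matrix.det_mul, Matrix.det_mul, Matrix.det_transpose, Matrix.det_transpose,
    Matrix.det_transpose, det_jacGauge] at this
  rw [this]; ring

/-- The factor `(det J)^8` of `det_theta_pullback` cancels against the eight volume forms. -/
theorem obstruction_pullback : obstruction Γ' ε' p = obstruction Γ ε (φ p) := by
  rw [obstruction_eq_det hU hΓ' hε' hp, obstruction_eq_det hU' hΓ hε (hφ.mapsTo hp),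
    det_theta_pullback hU hU' hφ hΓ hε hΓ' hε' h hb hp, hb.eq_det hε' hp]
  ring

end

end

/-! ### The frame of the geodesic equation -/

section

variable {U : Set Pt} {Γ : Symbols}

/-- The matrix which carries row sections for the tractor connection of the trace-free representative
to row sections for the connection with matrices `omega1`, `omega2`. All rows but the first are read
off from `vecV_eq`; the first one then follows from the equations of `pderiv_liouvilleGauge`. -/
noncomputable def liouvilleGauge (A : Fin 4 → Pt → ℝ) (p : Pt) : Matrix (Fin 6) (Fin 6) ℝ :=
  !![-2 * pderiv 0 (A 3) p - (2 / 3) * (A 1 p * A 3 p) - (2 / 9) * A 2 p ^ 2,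
      (2 / 3) * pderiv 0 (A 2) p - (2 / 3) * pderiv 1 (A 1) p + 6 * (A 0 p * A 3 p)
        + (2 / 9) * (A 1 p * A 2 p),
      2 * pderiv 1 (A 0) p - (2 / 3) * (A 0 p * A 2 p) - (2 / 9) * A 1 p ^ 2,
      A 2 p / 3, -(A 1 p / 3), 1;
     -2 * A 3 p, 0, (2 / 3) * A 1 p, 0, 1, 0;
     -(2 / 3) * A 2 p, 0, 2 * A 0 p, 1, 0, 0;
     0, 0, -2, 0, 0, 0;
     0, 4, 0, 0, 0, 0;
     -2, 0, 0, 0, 0, 0]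

set_option maxHeartbeats 1000000 in
theorem det_liouvilleGauge (A : Fin 4 → Pt → ℝ) (p : Pt) : (liouvilleGauge A p).det = -16 := by
  simp [liouvilleGauge, Matrix.det_succ_row_zero, Fin.sum_univ_succ, Fin.succAbove]
  ring

theorem IsConnection.contDiffOn_odeCoeff (hΓ : IsConnection U Γ) (i : Fin 4) :
    ContDiffOn ℝ 5 (odeCoeff Γ i) U := by
  have := hΓ.contDiffOn
  fin_cases i <;> simp [odeCoeff] <;> fun_prop

section

variable (hU : IsOpen U) (hΓ : IsConnection U Γ)
  (htr : ∀ a, ∀ q ∈ U, Γ 0 a 0 q + Γ 1 a 1 q = 0) {p : Pt} (hp : p ∈ U)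
include hΓ htr hp

/-- A trace-free connection is determined by the coefficients of its geodesic equation. -/
theorem symbols_eq_odeCoeff : Γ 0 0 0 p = odeCoeff Γ 1 p / 3 ∧ Γ 0 0 1 p = odeCoeff Γ 2 p / 3 ∧
    Γ 0 1 0 p = odeCoeff Γ 2 p / 3 ∧ Γ 0 1 1 p = odeCoeff Γ 3 p ∧ Γ 1 0 0 p = - odeCoeff Γ 0 p ∧
    Γ 1 0 1 p = -(odeCoeff Γ 1 p / 3) ∧ Γ 1 1 0 p = -(odeCoeff Γ 1 p / 3) ∧
    Γ 1 1 1 p = -(odeCoeff Γ 2 p / 3) := by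
  have h0 := htr 0 p hp
  have h1 := htr 1 p hp
  have h2 := hΓ.torsionFree 0 1 0 p hp
  have h3 := hΓ.torsionFree 1 1 0 p hp
  simp [odeCoeff]
  refine ⟨?_, ?_, ?_, ?_, ?_, ?_⟩ <;> linarith

include hU

theorem pderiv_symbols_eq_odeCoeff (e : Fin 2) :
    pderiv e (Γ 0 0 0) p = pderiv e (odeCoeff Γ 1) p / 3 ∧
    pderiv e (Γ 0 0 1) p = pderiv e (odeCoeff Γ 2) p / 3 ∧
    pderiv e (Γ 0 1 0) p = pderiv e (odeCoeff Γ 2) p / 3 ∧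
    pderiv e (Γ 0 1 1) p = pderiv e (odeCoeff Γ 3) p ∧
    pderiv e (Γ 1 0 0) p = - pderiv e (odeCoeff Γ 0) p ∧
    pderiv e (Γ 1 0 1) p = -(pderiv e (odeCoeff Γ 1) p / 3) ∧
    pderiv e (Γ 1 1 0) p = -(pderiv e (odeCoeff Γ 1) p / 3) ∧
    pderiv e (Γ 1 1 1) p = -(pderiv e (odeCoeff Γ 2) p / 3) := by
  have h := fun q hq => symbols_eq_odeCoeff hΓ htr (p := q) hq
  have hA : ∀ i, DifferentiableAt ℝ (odeCoeff Γ i) p := fun i =>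
    differentiableAt_of_contDiffOn hU (hΓ.contDiffOn_odeCoeff i) (by norm_num) hp
  refine ⟨?_, ?_, ?_, ?_, ?_, ?_, ?_, ?_⟩
  · rw [pderiv_congr hU (fun q hq => (h q hq).1) hp, pderiv_div_const _ (hA _)]
  · rw [pderiv_congr hU (fun q hq => (h q hq).2.1) hp, pderiv_div_const _ (hA _)]
  · rw [pderiv_congr hU (fun q hq => (h q hq).2.2.1) hp, pderiv_div_const _ (hA _)]
  · rw [pderiv_congr hU (fun q hq => (h q hq).2.2.2.1) hp]
  · rw [pderiv_congr hU (fun q hq => (h q hq).2.2.2.2.1) hp, pderiv_neg]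
  · rw [pderiv_congr hU (fun q hq => (h q hq).2.2.2.2.2.1) hp, pderiv_neg,
      pderiv_div_const _ (hA _)]
  · rw [pderiv_congr hU (fun q hq => (h q hq).2.2.2.2.2.2.1) hp, pderiv_neg,
      pderiv_div_const _ (hA _)]
  · rw [pderiv_congr hU (fun q hq => (h q hq).2.2.2.2.2.2.2) hp, pderiv_neg,
      pderiv_div_const _ (hA _)]

theorem schouten_eq_odeCoeff :
    schouten Γ 0 0 p = pderiv 0 (odeCoeff Γ 1) p / 3 - pderiv 1 (odeCoeff Γ 0) p
      - (2 / 9) * odeCoeff Γ 1 p ^ 2 + (2 / 3) * (odeCoeff Γ 0 p * odeCoeff Γ 2 p) ∧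
    schouten Γ 0 1 p = (pderiv 0 (odeCoeff Γ 2) p - pderiv 1 (odeCoeff Γ 1) p) / 3
      + odeCoeff Γ 0 p * odeCoeff Γ 3 p - (1 / 9) * (odeCoeff Γ 1 p * odeCoeff Γ 2 p) ∧
    schouten Γ 1 0 p = (pderiv 0 (odeCoeff Γ 2) p - pderiv 1 (odeCoeff Γ 1) p) / 3
      + odeCoeff Γ 0 p * odeCoeff Γ 3 p - (1 / 9) * (odeCoeff Γ 1 p * odeCoeff Γ 2 p) ∧
    schouten Γ 1 1 p = pderiv 0 (odeCoeff Γ 3) p - pderiv 1 (odeCoeff Γ 2) p / 3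
      - (2 / 9) * odeCoeff Γ 2 p ^ 2 + (2 / 3) * (odeCoeff Γ 1 p * odeCoeff Γ 3 p) := by
  obtain ⟨g0, g1, g2, g3, g4, g5, g6, g7⟩ := symbols_eq_odeCoeff hΓ htr hp
  have d := pderiv_symbols_eq_odeCoeff hU hΓ htr hp
  simp only [schouten, ricci, curv, Fin.sum_univ_two, g0, g1, g2, g3, g4, g5, g6, g7,
    (d _).1, (d _).2.1, (d _).2.2.1, (d _).2.2.2.1, (d _).2.2.2.2.1, (d _).2.2.2.2.2.1,
    (d _).2.2.2.2.2.2.1, (d _).2.2.2.2.2.2.2]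
  refine ⟨?_, ?_, ?_, ?_⟩ <;> ring

theorem cotton_eq_liouville : cotton Γ 0 1 0 p = -(liouvilleL1 (odeCoeff Γ) p / 2) ∧
    cotton Γ 0 1 1 p = -(liouvilleL2 (odeCoeff Γ) p / 2) := by
  obtain ⟨g0, g1, g2, g3, g4, g5, g6, g7⟩ := symbols_eq_odeCoeff hΓ htr hp
  obtain ⟨P0, P1, P2, P3⟩ := schouten_eq_odeCoeff hU hΓ htr hp
  have hAs := fun i => hΓ.contDiffOn_odeCoeff i
  have hA : ∀ i, DifferentiableAt ℝ (odeCoeff Γ i) p := fun i =>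
    differentiableAt_of_contDiffOn hU (hAs i) (by norm_num) hp
  have hA' : ∀ a i, DifferentiableAt ℝ (pderiv a (odeCoeff Γ i)) p := fun a i =>
    differentiableAt_of_contDiffOn hU (n := 4) (contDiffOn_pderiv hU (hAs i) (by norm_num) a)
      (by norm_num) hp
  have hc : ∀ i, pderiv 1 (pderiv 0 (odeCoeff Γ i)) p = pderiv 0 (pderiv 1 (odeCoeff Γ i)) p :=
    fun i => pderiv_comm hU (hAs i) (by norm_num) hp 1 0
  have e := fun q hq => schouten_eq_odeCoeff hU hΓ htr (p := q) hq
  have e0 := fun a => pderiv_congr (a := a) hU (fun q hq => (e q hq).1) hp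
  have e1 := fun a => pderiv_congr (a := a) hU (fun q hq => (e q hq).2.1) hp
  have e2 := fun a => pderiv_congr (a := a) hU (fun q hq => (e q hq).2.2.1) hp
  have e3 := fun a => pderiv_congr (a := a) hU (fun q hq => (e q hq).2.2.2) hp
  simp (disch := fun_prop) only [pderiv_add, pderiv_sub, pderiv_mul, pderiv_div_const, pderiv_const,
    pderiv_pow] at e0 e1 e2 e3
  simp only [cotton, cov2, Fin.sum_univ_two, e0, e1, e2, e3, g0, g1, g2, g3, g4, g5, g6, g7,
    P0, P1, P2, P3, liouvilleL1, liouvilleL2, hc]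
  constructor <;> push_cast <;> ring

theorem cottonForm_eq_liouville : cottonForm Γ unitVolume 0 p = - liouvilleL1 (odeCoeff Γ) p ∧
    cottonForm Γ unitVolume 1 p = - liouvilleL2 (odeCoeff Γ) p := by
  obtain ⟨h0, h1⟩ := cotton_eq_liouville hU hΓ htr hp
  have hε := isParallelVolume_unitVolume htr
  rw [hε.cottonForm_eq hp, hε.cottonForm_eq hp, h0, h1]
  constructor <;> simp [unitVolume, kron] <;> ring

/-- The vector `V` is the section `(0, 5 Y_c, Z_{cd})` in the other frame. -/
theorem vecV_eq : vecV (odeCoeff Γ) p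
    = Matrix.vecMul (row0 Γ unitVolume p) (liouvilleGauge (odeCoeff Γ) p) := by
  obtain ⟨g0, g1, g2, g3, g4, g5, g6, g7⟩ := symbols_eq_odeCoeff hΓ htr hp
  obtain ⟨y0, y1⟩ := cottonForm_eq_liouville hU hΓ htr hp
  have d0 := fun a => pderiv_congr (a := a) hU
    (fun q hq => (cottonForm_eq_liouville hU hΓ htr (p := q) hq).1) hp
  have d1 := fun a => pderiv_congr (a := a) hU
    (fun q hq => (cottonForm_eq_liouville hU hΓ htr (p := q) hq).2) hp
  simp only [pderiv_neg] at d0 d1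
  funext j
  simp only [row0, zTensor, sym, cov1, Fin.sum_univ_two, vecMul_fin_six]
  fin_cases j <;>
    simp [vecV, rowOf, liouvilleGauge, y0, y1, d0, d1, g0, g1, g2, g3, g4, g5, g6, g7] <;> ring

set_option maxHeartbeats 4000000 in
/-- The matrices `omega1`, `omega2` are the tractor connection of the trace-free representative in
another frame. -/
theorem pderiv_liouvilleGauge (a : Fin 2) (i j : Fin 6) :
    pderiv a (fun q => liouvilleGauge (odeCoeff Γ) q i j) p
      = (liouvilleGauge (odeCoeff Γ) p * (![omega1, omega2] a) (odeCoeff Γ) p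
        - tractorMatrix Γ a p * liouvilleGauge (odeCoeff Γ) p) i j := by
  obtain ⟨g0, g1, g2, g3, g4, g5, g6, g7⟩ := symbols_eq_odeCoeff hΓ htr hp
  obtain ⟨P0, P1, P2, P3⟩ := schouten_eq_odeCoeff hU hΓ htr hp
  obtain ⟨c0, c1⟩ := cotton_eq_liouville hU hΓ htr hp
  have hsk : ∀ c, cotton Γ 1 0 c p = - cotton Γ 0 1 c p := fun c => by
    simp only [cotton]; ring
  have hz : ∀ (a : Fin 2) c, cotton Γ a a c p = 0 := fun a c => by
    simp [cotton]
  have hAs := fun i => hΓ.contDiffOn_odeCoeff i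
  have hA : ∀ i, DifferentiableAt ℝ (odeCoeff Γ i) p := fun i =>
    differentiableAt_of_contDiffOn hU (hAs i) (by norm_num) hp
  have hA' : ∀ a i, DifferentiableAt ℝ (pderiv a (odeCoeff Γ i)) p := fun a i =>
    differentiableAt_of_contDiffOn hU (n := 4) (contDiffOn_pderiv hU (hAs i) (by norm_num) a)
      (by norm_num) hp
  have hc : ∀ i, pderiv 1 (pderiv 0 (odeCoeff Γ i)) p = pderiv 0 (pderiv 1 (odeCoeff Γ i)) p :=
    fun i => pderiv_comm hU (hAs i) (by norm_num) hp 1 0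
  rw [Matrix.sub_apply, Matrix.mul_apply, Matrix.mul_apply, Fin.sum_univ_six, Fin.sum_univ_six]
  generalize odeCoeff Γ = A at *
  fin_cases a <;> fin_cases i <;> fin_cases j <;>
    simp only [liouvilleGauge, tractorMatrix, omega1, omega2, Fin.zero_eta, Fin.mk_one,
      Fin.reduceFinMk, Matrix.of_apply, Matrix.cons_val', Matrix.cons_val] <;>
    simp (disch := fun_prop) [sym, kron, pderiv_add, pderiv_sub, pderiv_mul, pderiv_neg,
      pderiv_div_const, pderiv_const, pderiv_pow, hsk, hz, c0, c1, P0, P1, P2, P3,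
      g0, g1, g2, g3, g4, g5, g6, g7, hc, liouvilleL1, liouvilleL2] <;> ring

end

end

/-! ### The determinant of the matrix `M([Γ])` -/

section

variable {U : Set Pt} {Γ Γ' : Symbols} {ε ε' : Fin 2 → Fin 2 → Pt → ℝ}

set_option maxHeartbeats 1000000 in
/-- The operators `Dₐ` of the matrix `M([Γ])` are the tractor derivatives in the other frame. -/
theorem opD_liouvilleGauge (hU : IsOpen U) (hΓ : IsConnection U Γ)
    (htr : ∀ a, ∀ q ∈ U, Γ 0 a 0 q + Γ 1 a 1 q = 0) {p : Pt} (hp : p ∈ U) {W : Pt → Fin 6 → ℝ}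
    (hW : ∀ i, DifferentiableAt ℝ (fun q => W q i) p) {W' : Pt → Fin 6 → ℝ}
    (hW' : ∀ q ∈ U, W' q = Matrix.vecMul (W q) (liouvilleGauge (odeCoeff Γ) q)) (a : Fin 2) :
    opD (odeCoeff Γ) a W' p
      = Matrix.vecMul (covRow (tractorMatrix Γ) a W p) (liouvilleGauge (odeCoeff Γ) p) := by
  have hA : ∀ i, DifferentiableAt ℝ (odeCoeff Γ i) p := fun i =>
    differentiableAt_of_contDiffOn hU (hΓ.contDiffOn_odeCoeff i) (by norm_num) hp
  have hA' : ∀ a i, DifferentiableAt ℝ (pderiv a (odeCoeff Γ i)) p := fun a i =>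
    differentiableAt_of_contDiffOn hU (n := 4) (contDiffOn_pderiv hU (hΓ.contDiffOn_odeCoeff i)
      (by norm_num) a) (by norm_num) hp
  have hG : ∀ i j, DifferentiableAt ℝ (fun q => liouvilleGauge (odeCoeff Γ) q i j) p := by
    intro i j
    generalize odeCoeff Γ = A at *
    fin_cases i <;> fin_cases j <;> simp [liouvilleGauge] <;> fun_prop
  have e : opD (odeCoeff Γ) a W' p
      = covRow (fun a q => (![omega1, omega2] a) (odeCoeff Γ) q) a W' p := rfl
  rw [e, covRow_congr hU _ a hW' hp, covRow_vecMul _ hW hG _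
    (pderiv_liouvilleGauge hU hΓ htr hp a), ← Matrix.vecMul_vecMul, ← Matrix.sub_vecMul]
  rfl

/-- For a trace-free connection `M([Γ])` and the transpose of `Θ` differ by the frame change, of
determinant `-16`, and by the unipotent matrix `C` which turns iterated derivatives into covariant
second derivatives. -/
theorem det_matrixM_of_trace_eq_zero (hU : IsOpen U) (hΓ : IsConnection U Γ)
    (htr : ∀ a, ∀ q ∈ U, Γ 0 a 0 q + Γ 1 a 1 q = 0) {p : Pt} (hp : p ∈ U) :
    (matrixM Γ p).det = -16 * obstruction Γ unitVolume p := by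
  have hε := isParallelVolume_unitVolume htr
  have h0 := fun q hq => vecV_eq hU hΓ htr (p := q) hq
  have h1 : ∀ a, ∀ q ∈ U, opD (odeCoeff Γ) a (vecV (odeCoeff Γ)) q
      = Matrix.vecMul (row1 Γ unitVolume a q) (liouvilleGauge (odeCoeff Γ) q) := fun a q hq =>
    opD_liouvilleGauge hU hΓ htr hq (hε.differentiableAt_row0 hU hΓ hq) h0 a
  have h2 : ∀ a b, opD (odeCoeff Γ) a (opD (odeCoeff Γ) b (vecV (odeCoeff Γ))) p
      = Matrix.vecMul (row2 Γ unitVolume a b p + ∑ e, Γ e a b p • row1 Γ unitVolume e p)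
        (liouvilleGauge (odeCoeff Γ) p) := fun a b => by
    rw [opD_liouvilleGauge hU hΓ htr hp (hε.differentiableAt_row1 hU hΓ b hp) (h1 b) a, row2,
      sub_add_cancel]
  have hT : ∀ c, Γ c 1 0 p = Γ c 0 1 p := fun c => hΓ.torsionFree c 1 0 p hp
  set C : Matrix (Fin 6) (Fin 6) ℝ :=
    !![1, 0, 0, 0, 0, 0;
       0, 1, 0, 0, 0, 0;
       0, 0, 1, 0, 0, 0;
       0, Γ 0 0 0 p, Γ 1 0 0 p, 1, 0, 0;
       0, Γ 0 0 1 p, Γ 1 0 1 p, 0, 1, 0;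
       0, Γ 0 1 1 p, Γ 1 1 1 p, 0, 0, 1] with hC
  have hdetC : C.det = 1 := by
    rw [Matrix.det_of_isLowerTriangular]
    · simp [hC, Fin.prod_univ_succ]
    · intro i j h
      replace h : i < j := h
      fin_cases i <;> fin_cases j <;> first | (exfalso; revert h; decide) | simp [hC]
  have key : ∀ M, liouvilleGauge (odeCoeff Γ) p = M →
      matrixM Γ p = C * (theta Γ unitVolume p).toMatrix.transpose * M := by
    intro M hM
    rw [toMatrix_theta hU hΓ hε hp]
    simp only [matrixM, h0 p hp, h1 _ p hp, h2, hM, sym]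
    ext i j
    rw [Matrix.mul_apply]
    fin_cases i <;>
      simp [hC, hT, Matrix.mul_apply, Fin.sum_univ_succ, vecMul_fin_six] <;> ring
  rw [key _ rfl, Matrix.det_mul, Matrix.det_mul, hdetC, Matrix.det_transpose,
    det_liouvilleGauge, obstruction_eq_det hU hΓ hε hp]
  simp [unitVolume, kron, mul_comm]

theorem odeCoeff_traceFree (Γ : Symbols) : odeCoeff (traceFree Γ) = odeCoeff Γ := by
  funext i p
  fin_cases i <;> simp [odeCoeff, traceFree, kron] <;> ring

theorem detMSection_traceFree (Γ : Symbols) (p : Pt) :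
    detMSection (traceFree Γ) p = detMSection Γ p := by
  simp only [detMSection, matrixM, odeCoeff_traceFree]

theorem ProjEquiv.symm (h : ProjEquiv U Γ Γ') : ProjEquiv U Γ' Γ := by
  obtain ⟨ω, hω⟩ := h
  refine ⟨fun a p => - ω a p, fun p hp a b c => ?_⟩
  rw [hω p hp]; ring

theorem ProjEquiv.trans {Γ'' : Symbols} (h : ProjEquiv U Γ Γ') (h' : ProjEquiv U Γ' Γ'') :
    ProjEquiv U Γ Γ'' := by
  obtain ⟨ω, hω⟩ := h
  obtain ⟨ω', hω'⟩ := h'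
  refine ⟨fun a p => ω a p + ω' a p, fun p hp a b c => ?_⟩
  rw [hω' p hp, hω p hp]; ring

theorem projEquiv_traceFree (U : Set Pt) (Γ : Symbols) : ProjEquiv U Γ (traceFree Γ) :=
  ⟨_, isProjChange_traceFree U Γ⟩

theorem detMSection_eq_traceFree (hU : IsOpen U) (hΓ : IsConnection U Γ) {p : Pt} (hp : p ∈ U) :
    detMSection Γ p = (-16 : ℝ) • obstructionSection (traceFree Γ) unitVolume p := by
  rw [← detMSection_traceFree, detMSection, det_matrixM_of_trace_eq_zero hU hΓ.traceFree
    (fun a q _ => trace_traceFree Γ a q) hp, obstructionSection_eq, smul_smul]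
  simp [unitVolume, kron]

theorem detMSection_eq_obstructionSection (hU : IsOpen U) (hΓ : IsConnection U Γ)
    (hε : IsParallelVolume U Γ ε) {p : Pt} (hp : p ∈ U) :
    detMSection Γ p = (-16 : ℝ) • obstructionSection Γ ε p := by
  rw [detMSection_eq_traceFree hU hΓ hp, obstructionSection_congr hU hΓ hΓ.traceFree
    (projEquiv_traceFree U Γ) hε (isParallelVolume_unitVolume fun a q _ => trace_traceFree Γ a q) hp]

theorem detMSection_congr (hU : IsOpen U) (hΓ : IsConnection U Γ) (hΓ' : IsConnection U Γ')
    (h : ProjEquiv U Γ Γ') {p : Pt} (hp : p ∈ U) : detMSection Γ' p = detMSection Γ p := by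
  rw [detMSection_eq_traceFree hU hΓ hp, detMSection_eq_traceFree hU hΓ' hp,
    obstructionSection_congr hU hΓ.traceFree hΓ'.traceFree
      (((projEquiv_traceFree U Γ).symm.trans h).trans (projEquiv_traceFree U Γ'))
      (isParallelVolume_unitVolume fun a q _ => trace_traceFree Γ a q)
      (isParallelVolume_unitVolume fun a q _ => trace_traceFree Γ' a q) hp]

end

/-! ### The section `det M([Γ]) (dx ∧ dy)^{⊗14}` under changes of coordinates -/

theorem pullForm_dxdy (L : Pt →ₗ[ℝ] Pt) : pullForm L dxdy = LinearMap.det L • dxdy := by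
  ext v
  have e : (fun i => L (v i)) = (Matrix.of v * (LinearMap.toMatrix' L).transpose : Matrix _ _ ℝ) := by
    funext i
    rw [Matrix.mul_apply_eq_vecMul, Matrix.vecMul_transpose, ← Matrix.toLin'_apply,
      Matrix.toLin'_toMatrix']
    rfl
  change Matrix.det (fun i => L (v i)) = LinearMap.det L * Matrix.det (Matrix.of v)
  rw [e, Matrix.det_mul, Matrix.det_transpose, LinearMap.det_toMatrix', mul_comm]

theorem pull14_power14 (L : Pt →ₗ[ℝ] Pt) (κ : Canonical) :
    pull14 L (power14 κ) = power14 (pullForm L κ) := by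
  simp [pull14, power14]

theorem det_fderiv_eq_det_jac {φ : Pt → Pt} {p : Pt} (hφ : DifferentiableAt ℝ φ p) :
    LinearMap.det (fderiv ℝ φ p : Pt →ₗ[ℝ] Pt) = (jac φ p).det := by
  rw [← LinearMap.det_toMatrix']
  congr 1
  ext k a
  rw [LinearMap.toMatrix'_apply]
  simp only [jac, Matrix.of_apply, pderiv]
  rw [fderiv_apply hφ]
  rfl

section

variable {U U' : Set Pt} {φ : Pt → Pt} {Γ Γ' : Symbols} {ε ε' : Fin 2 → Fin 2 → Pt → ℝ}

/-- The pull-back of the constant volume form is parallel for the pull-back of a trace-free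
connection. -/
theorem isParallelVolume_pullback_unitVolume (hU : IsOpen U) (hφ : IsCoordChange U U' φ)
    (hΓ : IsConnection U' Γ) (htr : ∀ a, ∀ q ∈ U', Γ 0 a 0 q + Γ 1 a 1 q = 0)
    (hΓ' : IsConnection U Γ') (h : IsPullback U φ Γ Γ') :
    IsParallelVolume U Γ' fun b c q => unitVolume b c q * ((jac φ q).det)⁻¹ := by
  have hdet : ContDiffOn ℝ 6 (fun q => (jac φ q).det) U := by
    have := fun i j => hφ.contDiffOn_jac hU i j
    simp only [IsCoordChange.det_jac_eq]
    fun_prop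
  refine ⟨fun b c => ?_, fun b c q hq => ?_, fun q hq => ?_, fun a b c q hq => ?_⟩
  · exact contDiffOn_const.mul ((hdet.of_le (by norm_num)).inv hφ.det_ne_zero)
  · simp only [unitVolume]; ring
  · simpa [unitVolume, kron] using hφ.det_ne_zero q hq
  · have hd : DifferentiableAt ℝ (fun q => (jac φ q).det) q :=
      differentiableAt_of_contDiffOn hU hdet (by norm_num) hq
    have dJ := fun k a => hφ.differentiableAt_jac hU hq k a
    have hdd : pderiv a (fun q => (jac φ q).det) q
        = (jac φ q).det * (Γ' 0 a 0 q + Γ' 1 a 1 q) := by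
      simp only [IsCoordChange.det_jac_eq]
      simp (disch := fun_prop) only [pderiv_sub, pderiv_mul, h.pderiv_jac hq]
      have ht := fun i => htr i (φ q) (hφ.mapsTo hq)
      have h0 := ht 0
      have h1 := ht 1
      have hT := fun c => hΓ'.torsionFree c 1 0 q hq
      have hT' := fun c => hΓ.torsionFree c 1 0 (φ q) (hφ.mapsTo hq)
      simp only [Fin.sum_univ_two, hT'] at h0 h1 ⊢
      fin_cases a <;> simp only [Fin.zero_eta, Fin.mk_one, hT]
      · linear_combination
          -(jac φ q 0 0 * jac φ q 1 1 - jac φ q 0 1 * jac φ q 1 0) *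
            (jac φ q 0 0 * h0 + jac φ q 1 0 * h1)
      · linear_combination
          -(jac φ q 0 0 * jac φ q 1 1 - jac φ q 0 1 * jac φ q 1 0) *
            (jac φ q 0 1 * h0 + jac φ q 1 1 * h1)
    have hinv : pderiv a (fun q => ((jac φ q).det)⁻¹) q
        = -(Γ' 0 a 0 q + Γ' 1 a 1 q) * ((jac φ q).det)⁻¹ := by
      have hne := hφ.det_ne_zero q hq
      have e1 := pderiv_mul (a := a) (g := fun r => ((jac φ r).det)⁻¹) hd (hd.inv hne)
      have e2 : pderiv a (fun r => (jac φ r).det * ((jac φ r).det)⁻¹) q = 0 := by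
        rw [pderiv_congr hU (g := fun _ => 1)
          (fun r hr => mul_inv_cancel₀ (hφ.det_ne_zero r hr)) hq]
        exact pderiv_const _
      rw [e2, hdd] at e1
      apply mul_left_cancel₀ hne
      linear_combination -e1
    have he : ∀ b c, pderiv a (fun q => unitVolume b c q * ((jac φ q).det)⁻¹) q = unitVolume b c q *
        (-(Γ' 0 a 0 q + Γ' 1 a 1 q) * ((jac φ q).det)⁻¹) := fun b c => by
      rw [← hinv]
      exact pderiv_const_mul _ (hd.inv (hφ.det_ne_zero q hq))
    simp only [covBivector, he, Fin.sum_univ_two]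
    fin_cases b <;> fin_cases c <;> simp [unitVolume, kron] <;> ring

theorem isBivectorPullback_unitVolume (hφ : IsCoordChange U U' φ) :
    IsBivectorPullback U φ unitVolume fun b c q => unitVolume b c q * ((jac φ q).det)⁻¹ := by
  intro q hq i j
  have e := mul_inv_cancel₀ (hφ.det_ne_zero q hq)
  simp only [Fin.sum_univ_two]
  generalize ((jac φ q).det)⁻¹ = d at e ⊢
  rw [IsCoordChange.det_jac_eq] at e
  fin_cases i <;> fin_cases j <;> simp [unitVolume, kron] <;>
    first | ring1 | linear_combination -e | linear_combination e

/-- A pull-back of the connection need not be trace-free, but it is projectively equivalent to the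
pull-back of the trace-free representative, to which `obstruction_pullback` applies. -/
theorem detMSection_pullback (hU : IsOpen U) (hU' : IsOpen U') (hφ : IsCoordChange U U' φ)
    (hΓ : IsConnection U' Γ) (hΓ' : IsConnection U Γ') (h : IsPullback U φ Γ Γ') {p : Pt}
    (hp : p ∈ U) : detMSection Γ' p
      = pull14 (fderiv ℝ φ p : Pt →ₗ[ℝ] Pt) (detMSection Γ (φ p)) := by
  -- The pull-back of the one-form which changes `Γ` into its trace-free representative.
  set ω : Fin 2 → Pt → ℝ := fun a q => ∑ i, jac φ q i a *
    (-(1 / 3) * (Γ 0 i 0 (φ q) + Γ 1 i 1 (φ q))) with hω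
  set Γ₁ : Symbols := fun c a b q => Γ' c a b q + kron a c * ω b q + kron b c * ω a q with hΓ₁
  have hch : IsProjChange U ω Γ' Γ₁ := fun _ _ _ _ _ => rfl
  have hωs : ∀ a, ContDiffOn ℝ 5 (ω a) U := by
    intro a
    have hJ : ∀ i, ContDiffOn ℝ 5 (fun q => jac φ q i a) U := fun i =>
      (hφ.contDiffOn_jac hU i a).of_le (by norm_num)
    have hG : ∀ c a b, ContDiffOn ℝ 5 (fun q => Γ c a b (φ q)) U := fun c a b =>
      (hΓ.contDiffOn c a b).comp (hφ.contDiffOn.of_le (by norm_num)) hφ.mapsTo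
    simp only [hω, Fin.sum_univ_two]
    exact ((hJ 0).mul (contDiffOn_const.mul ((hG 0 0 0).add (hG 1 0 1)))).add
      ((hJ 1).mul (contDiffOn_const.mul ((hG 0 1 0).add (hG 1 1 1))))
  have hΓ₁c : IsConnection U Γ₁ := by
    refine ⟨fun c a b => ?_, fun c a b q hq => ?_⟩
    · have := hΓ'.contDiffOn
      simp only [hΓ₁]
      fun_prop
    · simp only [hΓ₁, hΓ'.torsionFree c a b q hq]; ring
  have hpb : IsPullback U φ (traceFree Γ) Γ₁ := by
    intro q hq a b k
    have e := h q hq a b k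
    simp only [hΓ₁, hω, traceFree, Fin.sum_univ_two] at e ⊢
    fin_cases a <;> fin_cases b <;> fin_cases k <;> simp [kron] at e ⊢ <;> linear_combination e
  have hpar := isParallelVolume_pullback_unitVolume hU hφ hΓ.traceFree
    (fun a q _ => trace_traceFree Γ a q) hΓ₁c hpb
  have hbv := isBivectorPullback_unitVolume hφ
  have hvol := isParallelVolume_unitVolume (U := U') (Γ := traceFree Γ)
    fun a q _ => trace_traceFree Γ a q
  rw [← detMSection_congr hU hΓ' hΓ₁c ⟨ω, hch⟩ hp,
    detMSection_eq_obstructionSection hU hΓ₁c hpar hp, detMSection_eq_traceFree hU' hΓ (hφ.mapsTo hp),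
    obstructionSection_eq, obstructionSection_eq,
    obstruction_pullback hU hU' hφ hΓ.traceFree hvol hΓ₁c hpar hpb hbv hp,
    map_smul, map_smul, pull14_power14, pullForm_dxdy,
    det_fderiv_eq_det_jac (hφ.differentiableAt hU hp), power14_smul, smul_smul]
  simp only [smul_smul]
  congr 1
  simp [unitVolume, kron]

end

end ProjSurf

theorem mainTheorem6 :
    -- the operations on the matrix are unipotent row and column operations
    (∀ ω : Fin 2 → ℝ, ∃ L : Matrix (Fin 6) (Fin 6) ℝ,
      (∀ i, L i i = 1) ∧ (∀ i j, i < j → L i j = 0) ∧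
      ∀ B : Blocks, (B.rowOps ω).toMatrix = L * B.toMatrix) ∧
    (∀ ω : Fin 2 → ℝ, ∃ K : Matrix (Fin 6) (Fin 6) ℝ,
      (∀ i, K i i = 1) ∧ (∀ i j, j < i → K i j = 0) ∧
      ∀ B : Blocks, (B.colOps ω).toMatrix = B.toMatrix * K) ∧
    -- `D(Γ)` is the determinant of the matrix, up to the normalisation
    (∀ U : Set Pt, IsOpen U → ∀ (Γ : Symbols) (ε : Fin 2 → Fin 2 → Pt → ℝ),
      IsConnection U Γ → IsParallelVolume U Γ ε → ∀ p ∈ U,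
        obstruction Γ ε p = (1 / 4320) * (ε 0 1 p) ^ 8 * (thetaBar Γ ε p).toMatrix.det) ∧
    -- change of the connection in the projective class, with the change of the volume form:
    -- the matrix changes by row and column operations, and `D(Γ)` has weight `-42`
    (∀ U : Set Pt, IsOpen U → ∀ (Γ Γ' : Symbols) (ε ε' : Fin 2 → Fin 2 → Pt → ℝ) (f : Pt → ℝ),
      IsConnection U Γ → IsConnection U Γ' → IsParallelVolume U Γ ε → ContDiffOn ℝ 6 f U →
      IsProjChange U (fun a => pderiv a f) Γ Γ' →
      (∀ p ∈ U, ∀ b c, ε' b c p = Real.exp (-3 * f p) * ε b c p) →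
        IsParallelVolume U Γ' ε' ∧
        ∀ p ∈ U,
          thetaBar Γ' ε' p = (((thetaBar Γ ε p).rowOps (fun a => pderiv a f p)).colOps
            (fun a => pderiv a f p)).scale (Real.exp (-3 * f p)) ∧
          obstruction Γ' ε' p = Real.exp (-42 * f p) * obstruction Γ ε p) ∧
    -- every projective class contains connections for which `D(Γ)` is defined
    (∀ U : Set Pt, IsOpen U → ∀ Γ : Symbols, IsConnection U Γ →
      ∃ (Γ' : Symbols) (ε : Fin 2 → Fin 2 → Pt → ℝ),
        IsConnection U Γ' ∧ ProjEquiv U Γ Γ' ∧ IsParallelVolume U Γ' ε) ∧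
    -- as a section of the 14th power of the canonical bundle, `D(Γ)` depends only on the class
    (∀ U : Set Pt, IsOpen U → ∀ (Γ Γ' : Symbols) (ε ε' : Fin 2 → Fin 2 → Pt → ℝ),
      IsConnection U Γ → IsConnection U Γ' → ProjEquiv U Γ Γ' →
      IsParallelVolume U Γ ε → IsParallelVolume U Γ' ε' →
        ∀ p ∈ U, obstructionSection Γ' ε' p = obstructionSection Γ ε p) ∧
    -- `D(Γ)` is independent of the choice of coordinates
    (∀ U U' : Set Pt, IsOpen U → IsOpen U' → ∀ (φ : Pt → Pt) (Γ Γ' : Symbols)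
      (ε ε' : Fin 2 → Fin 2 → Pt → ℝ), IsCoordChange U U' φ →
      IsConnection U' Γ → IsParallelVolume U' Γ ε → IsConnection U Γ' → IsParallelVolume U Γ' ε' →
      IsPullback U φ Γ Γ' → IsBivectorPullback U φ ε ε' →
        ∀ p ∈ U, obstruction Γ' ε' p = obstruction Γ ε (φ p)) ∧
    -- `det M([Γ]) (dx ∧ dy)^{⊗14}` is the section defined by `D(Γ)`, up to a universal constant
    (∃ k : ℝ, k ≠ 0 ∧ ∀ U : Set Pt, IsOpen U →
      ∀ (Γ : Symbols) (ε : Fin 2 → Fin 2 → Pt → ℝ),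
      IsConnection U Γ → IsParallelVolume U Γ ε →
        ∀ p ∈ U, detMSection Γ p = k • obstructionSection Γ ε p) ∧
    -- `det M([Γ]) (dx ∧ dy)^{⊗14}` depends only on the projective class
    (∀ U : Set Pt, IsOpen U → ∀ Γ Γ' : Symbols,
      IsConnection U Γ → IsConnection U Γ' → ProjEquiv U Γ Γ' →
        ∀ p ∈ U, detMSection Γ' p = detMSection Γ p) ∧
    -- and it is independent of the choice of coordinates
    (∀ U U' : Set Pt, IsOpen U → IsOpen U' → ∀ (φ : Pt → Pt) (Γ Γ' : Symbols),
      IsCoordChange U U' φ → IsConnection U' Γ → IsConnection U Γ' → IsPullback U φ Γ Γ' →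
        ∀ p ∈ U, detMSection Γ' p =
          pull14 (fderiv ℝ φ p : Pt →ₗ[ℝ] Pt) (detMSection Γ (φ p))) := by
  refine ⟨fun ω => ⟨Blocks.rowMatrix ω, Blocks.rowMatrix_diag ω, Blocks.rowMatrix_upper ω,
      Blocks.toMatrix_rowOps ω⟩,
    fun ω => ⟨Blocks.colMatrix ω, Blocks.rowMatrix_diag ω,
      fun i j h => Blocks.rowMatrix_upper ω j i h, Blocks.toMatrix_colOps ω⟩,
    fun U hU Γ ε hΓ hε p hp => ?_,
    fun U hU Γ Γ' ε ε' f hΓ hΓ' hε hf h hε' => ⟨isParallelVolume_projChange hU hε hf h hε',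
      fun p hp => ⟨thetaBar_projChange hU hΓ hΓ' hε hf h hε' hp,
        obstruction_projChange hU hΓ hΓ' hε hf h hε' hp⟩⟩,
    fun U _ Γ hΓ => exists_isParallelVolume hΓ,
    fun U hU Γ Γ' ε ε' hΓ hΓ' h hε hε' p hp => obstructionSection_congr hU hΓ hΓ' h hε hε' hp,
    fun U U' hU hU' φ Γ Γ' ε ε' hφ hΓ hε hΓ' hε' h hb p hp =>
      obstruction_pullback hU hU' hφ hΓ hε hΓ' hε' h hb hp,
    ⟨-16, by norm_num, fun U hU Γ ε hΓ hε p hp => detMSection_eq_obstructionSection hU hΓ hε hp⟩,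
    fun U hU Γ Γ' hΓ hΓ' h p hp => detMSection_congr hU hΓ hΓ' h hp,
    fun U U' hU hU' φ Γ Γ' hφ hΓ hΓ' h p hp => detMSection_pullback hU hU' hφ hΓ hΓ' h hp⟩
  rw [obstruction_eq_det hU hΓ hε hp, det_thetaBar]
  ring
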